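/- Let $r>3$ and let $V_1,V_2\in C^{r+1}(\mathbb R)$ be two potentials, each with finitely many critical points, all of them nondegenerate, bounded from below and tending to $+\infty$ as $|q|\to\infty$; a *saddle* of $V_i$ is a local maximum point of $V_i$. Let $V_r\in C^{r+1}(\mathbb R^2)$, put $H_i=\tfrac12p_i^2+V_i(q_i)$, and consider on the half plane $q_1\ge 0$ the Hamiltonian $$H_\epsilon=H_1(q_1,p_1)+H_2(q_2,p_2)+\epsilon V_r(q_1,q_2)$$ with elastic reflection $p_1\mapsto-p_1$ at the vertical wall $q_1=0$. Assume that the wall is in regular position: $V_1'(0)\ne0$ and $V_1(0)\neq V_1(s)$ for every saddle $s$ of $V_1$. For $\delta>0$ and $H\in\mathbb R$ let $\mathbb H_2^{R,\delta}(H)$ be the set of $h_2\in[\min V_2,\,H-\min V_1]$ with $|h_2-V_2(s)|\ge\delta$ for every saddle $s$ of $V_2$ and $|h_2-(H-V_1(s))|\ge\delta$ for every saddle $s$ of $V_1$; define $\mathbb H_1^{R,\delta}(H)$ by exchanging the indices. The level $H$ is *$\delta$-regular* if $V_1(0)\in\mathbb H_1^{R,\delta}(H)$. For such regular energies, a leaf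 is a connected component of $\{H_i=h_i\}$ (a closed curve, or a centre point); $J$ and $I=\frac1{2\pi}\oint p_2\,dq_2$ denote the actions of leaves in the $(q_1,p_1)$- and the $(q_2,p_2)$-plane, and a branch is a one-parameter family of regular leaves together with the centre point at which it may end. On each leaf of $H_2$, $\theta$ is the angle that vanishes at the rightmost point and grows at the rate $\omega_2(I)=2\pi/T_2(I)$ along the flow of $H_2$, with $T_2$ the period ($\omega_2=\sqrt{V_2''}$ at a centre). Write $I_{tan}(H)$ for the action of the leaf of energy $H_2=H-V_1(0)$ of a branch, if that branch contains one. Let $\Sigma=\{p_1=0,\ \dot p_1<0\}$. For a leaf of $H_1$ with energy $h_1$, over the interval $[q_{1min},q_{1max}]$ with $q_{1max}>0$, let $$\tilde T_1(J)=2\int_{q_{1min}}^{q_{1max}}\frac{dq_1}{\sqrt{2(h_1-V_1(q_1))}}-\Delta t_{travel}(J),$$ where $\Delta t_{travel}(J)=2\int_{q_{1min}}^{0}\frac{dq_1}{\sqrt{2(h_1-V_1(q_1))}}$ if $q_{1min}<0$ (impact) and $\Delta t_{travel}(J)=0$ otherwise. **Theorem.** Fix $\delta,\rho,\kappa>0$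 and a $\delta$-regular $H$. There are $\epsilon_0,\eta>0$ and $C$ such that the following holds for every leaf of $H_2$ with energy $h_2\in\mathbb H_2^{R,\delta}(H)$ whose action $I$ satisfies $|I-I_{tan}(H)|\ge\rho$ (if its branch has a tangent leaf), every leaf of $H_1$ of energy $H-h_2$ with $q_{1max}>0$ and action $J\ge\kappa$, every angle $\theta$, and every $\epsilon$ with $0<|\epsilon|<\epsilon_0$. Let $(q_2,p_2)$ be the point with coordinates $(I,\theta)$, and let $z_0^{im}$ be the impact trajectory of the unperturbed system ($\epsilon=0$) that starts at $(q_{1max},0,q_2,p_2)$; it exists on $[0,\tilde T_1(J)]$. Then there is exactly one $q_1$ with $|q_1-q_{1max}|<\eta$ such that $(q_1,0,q_2,p_2)\in\Sigma$ has perturbed energy $H_\epsilon=H$; the perturbed impact trajectory of this point returns to $\Sigma$; and at the first return the action $I'$ of the leaf of $H_2$ through the return point is $$I'=I+\epsilon f,\qquad \Big|\,f+\frac1{\omega_2(I)}\int_0^{\tilde T_1(J)}\Big(\frac{\partial V_r}{\partial q_2}\,p_2\Big)_{z_0^{im}(t)}dt\,\Big|\le C|\epsilon| .$$ That is, $f(I,\theta;\epsilon)=-\frac1{\omega_2(I)}\int_0^{\tilde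 T_1(J)}\big(\frac{\partial V_r}{\partial q_2}\,p_2\big)_{z_0^{im}(t)}dt+\mathcal O(\epsilon)$, uniformly on this set. -/

import Mathlib

open Set Filter Topology

namespace ImpactSystem

/-! ### Potentials and regular energies -/

/-- One of the two potentials of a separable Hamiltonian
`p₁²/2 + V₁(q₁) + p₂²/2 + V₂(q₂)` of the S3B class: smooth of class `C^{r+1}`, simple (finitely many
critical points, all nondegenerate), bounded from below, and tending to infinity as `|q| → ∞`. -/
structure IsS3BPotential (r : ℕ) (V : ℝ → ℝ) : Prop where
  smooth : ContDiff ℝ ((r + 1 : ℕ) : WithTop ℕ∞) V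
  finite_critical : {x | deriv V x = 0}.Finite
  nondegenerate : ∀ x, deriv V x = 0 → deriv (deriv V) x ≠ 0
  bddBelow : BddBelow (range V)
  coercive : Tendsto V (cocompact ℝ) atTop

/-- Positions of the saddle fixed points `(s, 0)` of `p²/2 + V(q)`. -/
def saddles (V : ℝ → ℝ) : Set ℝ := {s | deriv V s = 0 ∧ deriv (deriv V) s < 0}

/-- The closed set of `δ`-regular values of the partial energy `p²/2 + V(q)` on the level `H` of
`p²/2 + V(q) + p'²/2 + W(q')`: the allowed values, at distance at least `δ` from every saddle energy
of `V`, and such that the complementary energy is at distance at least `δ` from every saddle energy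
of `W`. -/
def regularEnergies (V W : ℝ → ℝ) (δ H : ℝ) : Set ℝ :=
  {h | h ∈ Icc (⨅ x, V x) (H - ⨅ x, W x) ∧
    (∀ s ∈ saddles V, δ ≤ |h - V s|) ∧ (∀ s ∈ saddles W, δ ≤ |h - (H - W s)|)}

/-- The wall `q₁ = 0` is in regular position for `V₁`. -/
def IsRegularWall (V₁ : ℝ → ℝ) : Prop :=
  deriv V₁ 0 ≠ 0 ∧ ∀ s ∈ saddles V₁, V₁ 0 ≠ V₁ s

/-- The energy level `H` is `δ`-regular with respect to the wall `q₁ = 0`. -/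
def IsRegularLevel (V₁ V₂ : ℝ → ℝ) (δ H : ℝ) : Prop :=
  V₁ 0 ∈ regularEnergies V₁ V₂ δ H

/-! ### Leaves of a one-degree-of-freedom mechanical Hamiltonian `p²/2 + V(q)`

A leaf of regular energy `h` is the closed curve (or centre point) `p = ± √(2 (h - V q))` over a
connected component of `{V ≤ h}`. It is given by `h` and by any point `q` of that component. -/

/-- The projection to the `q`-axis of the leaf of energy `h` over the point `q`. -/
def well (V : ℝ → ℝ) (h q : ℝ) : Set ℝ := connectedComponentIn {x | V x ≤ h} q

/-- Leftmost position on the leaf. -/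
noncomputable def leftEnd (V : ℝ → ℝ) (h q : ℝ) : ℝ := sInf (well V h q)

/-- Rightmost position on the leaf. -/
noncomputable def rightEnd (V : ℝ → ℝ) (h q : ℝ) : ℝ := sSup (well V h q)

/-- The action of the leaf, `(1/2π) ∮ p dq`. -/
noncomputable def action (V : ℝ → ℝ) (h q : ℝ) : ℝ :=
  1 / (2 * Real.pi) * (2 * ∫ x in well V h q, √(2 * (h - V x)))

/-- The action of the leaf through the phase point `(q, p)`. -/
noncomputable def actionAt (V : ℝ → ℝ) (q p : ℝ) : ℝ := action V (p ^ 2 / 2 + V q) q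

/-- The period of the motion on a (nondegenerate) leaf. -/
noncomputable def period (V : ℝ → ℝ) (h q : ℝ) : ℝ :=
  2 * ∫ x in well V h q, 1 / √(2 * (h - V x))

open Classical in
/-- The frequency `ω` of the leaf: `2π / period`, and at a centre point (action zero) the linear
frequency `√V''`, which is the limit of the frequencies of the surrounding leaves. -/
noncomputable def frequency (V : ℝ → ℝ) (h q : ℝ) : ℝ :=
  if leftEnd V h q = rightEnd V h q then √(deriv (deriv V) (rightEnd V h q))
  else 2 * Real.pi / period V h q

/-- The angle coordinate on a leaf: `γ θ = (q, p)` is the point of angle `θ`. The angle vanishes at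
the rightmost point of the leaf and grows at the rate `ω` along the motion `q' = p`, `p' = -V'(q)`. -/
structure IsAngleChart (V : ℝ → ℝ) (h q : ℝ) (γ : ℝ → ℝ × ℝ) : Prop where
  origin : γ 0 = (rightEnd V h q, 0)
  flow : ∀ θ, HasDerivAt γ
    ((γ θ).2 / frequency V h q, -(deriv V (γ θ).1) / frequency V h q) θ

/-- Two leaves belong to the same branch (one-parameter family of regular leaves, including the centre
point where the family ends at one): one well contains the other, and there is no critical point
of `V` between them. -/
def SameBranch (V : ℝ → ℝ) (h q h' q' : ℝ) : Prop :=
  (well V h q ⊆ well V h' q' ∧ ∀ x ∈ well V h' q' \ well V h q, deriv V x ≠ 0) ∨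
  (well V h' q' ⊆ well V h q ∧ ∀ x ∈ well V h q \ well V h' q', deriv V x ≠ 0)

/-- The action of the leaf of `p₂²/2 + V₂(q₂)` of energy `h` over `q` is outside the open
`ρ`-neighbourhood of the tangency action `I_tan(H)`, the action of the leaf of energy
`H - V₁(0)` of the same branch (if there is one). -/
def FarFromTangency (V₁ V₂ : ℝ → ℝ) (ρ H h q : ℝ) : Prop :=
  ∀ q', V₂ q' ≤ H - V₁ 0 → SameBranch V₂ h q (H - V₁ 0) q' →
    ρ ≤ |action V₂ h q - action V₂ (H - V₁ 0) q'|

open Classical in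
/-- The time `Δt_travel` which the motion on the leaf spends to the left of the wall, `q < 0`. -/
noncomputable def travelTime (V : ℝ → ℝ) (h q : ℝ) : ℝ :=
  if leftEnd V h q < 0 then 2 * ∫ x in (leftEnd V h q)..0, 1 / √(2 * (h - V x)) else 0

/-- The period of the motion that is reflected at the wall. -/
noncomputable def impactPeriod (V : ℝ → ℝ) (h q : ℝ) : ℝ := period V h q - travelTime V h q

/-! ### The impact system -/

/-- Points `(q₁, p₁, q₂, p₂)` of the phase space. -/
structure Phase where
  q₁ : ℝ
  p₁ : ℝ
  q₂ : ℝ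
  p₂ : ℝ

/-- `∂V/∂q₁`. -/
noncomputable def partial₁ (V : ℝ × ℝ → ℝ) (q₁ q₂ : ℝ) : ℝ := deriv (fun x => V (x, q₂)) q₁

/-- `∂V/∂q₂`. -/
noncomputable def partial₂ (V : ℝ × ℝ → ℝ) (q₁ q₂ : ℝ) : ℝ := deriv (fun y => V (q₁, y)) q₂

/-- The Hamiltonian `H_int + ε V_r` (inside the billiard). -/
noncomputable def energy (V₁ V₂ : ℝ → ℝ) (Vr : ℝ × ℝ → ℝ) (ε : ℝ) (x : Phase) : ℝ :=
  x.p₁ ^ 2 / 2 + V₁ x.q₁ + (x.p₂ ^ 2 / 2 + V₂ x.q₂) + ε * Vr (x.q₁, x.q₂)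

/-- `z` is on `[0, T]` a trajectory of the Hamiltonian `H_int + ε V_r` in the half plane `q₁ ≥ 0` with
elastic reflections at the vertical wall `q₁ = 0`: there are finitely many impact times; at
these `p₁` jumps from `-p₁ < 0` to `p₁ > 0` (and takes the outgoing value), and at all
other times Hamilton's equations hold. -/
structure IsImpactTrajectory (V₁ V₂ : ℝ → ℝ) (Vr : ℝ × ℝ → ℝ) (ε T : ℝ) (z : ℝ → Phase) :
    Prop where
  domain : ∀ t ∈ Icc 0 T, 0 ≤ (z t).q₁
  continuous_q₁ : ContinuousOn (fun t => (z t).q₁) (Icc 0 T)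
  deriv_q₂ : ∀ t ∈ Icc 0 T, HasDerivWithinAt (fun s => (z s).q₂) (z t).p₂ (Icc 0 T) t
  deriv_p₂ : ∀ t ∈ Icc 0 T, HasDerivWithinAt (fun s => (z s).p₂)
    (-(deriv V₂ (z t).q₂ + ε * partial₂ Vr (z t).q₁ (z t).q₂)) (Icc 0 T) t
  impacts : ∃ S : Finset ℝ, (S : Set ℝ) ⊆ Ioc 0 T ∧
    (∀ t ∈ S, (z t).q₁ = 0 ∧ 0 < (z t).p₁ ∧
      Tendsto (fun s => (z s).p₁) (𝓝[<] t) (𝓝 (-(z t).p₁)) ∧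
      ContinuousWithinAt (fun s => (z s).p₁) (Icc t T) t) ∧
    ∀ t ∈ Icc 0 T, t ∉ S →
      HasDerivWithinAt (fun s => (z s).q₁) (z t).p₁ (Icc 0 T) t ∧
      HasDerivWithinAt (fun s => (z s).p₁)
        (-(deriv V₁ (z t).q₁ + ε * partial₁ Vr (z t).q₁ (z t).q₂)) (Icc 0 T) t

/-- The cross-section `Σ = {p₁ = 0, dp₁/dt < 0}`. -/
def section₀ (V₁ : ℝ → ℝ) (Vr : ℝ × ℝ → ℝ) (ε : ℝ) : Set Phase :=
  {x | x.p₁ = 0 ∧ -(deriv V₁ x.q₁ + ε * partial₁ Vr x.q₁ x.q₂) < 0}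

/-- The impact trajectory of `x ∈ Σ` returns to `Σ`, for the first time at the point `x'`. -/
def IsFirstReturn (V₁ V₂ : ℝ → ℝ) (Vr : ℝ × ℝ → ℝ) (ε : ℝ) (x x' : Phase) : Prop :=
  x ∈ section₀ V₁ Vr ε ∧ x' ∈ section₀ V₁ Vr ε ∧
  ∃ T > 0, ∃ z : ℝ → Phase, IsImpactTrajectory V₁ V₂ Vr ε T z ∧ z 0 = x ∧ z T = x' ∧
    ∀ t ∈ Ioo 0 T, z t ∉ section₀ V₁ Vr ε

end ImpactSystem

open ImpactSystem

namespace ImpactSystem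

open Metric NNReal

/-! ### Ordinary differential equations -/

section ODE

variable {E : Type*} [NormedAddCommGroup E] [NormedSpace ℝ E]

/-- A bounded Lipschitz vector field is complete. -/
theorem exists_integralCurve_of_bounded_of_lipschitz [CompleteSpace E] {F : E → E} {K M : ℝ≥0}
    (hF : LipschitzWith K F) (hM : ∀ x, ‖F x‖ ≤ M) (x : E) :
    ∃ y : ℝ → E, y 0 = x ∧ ∀ t, HasDerivAt y (F (y t)) t := by
  have key : ∀ n : ℕ, ∃ α : ℝ → E, α 0 = x ∧
      ∀ t ∈ Ioo (-((n : ℝ) + 1)) (n + 1), HasDerivAt α (F (α t)) t := by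
    intro n
    have hn : (0 : ℝ) ≤ n := n.cast_nonneg
    have hpl : IsPicardLindelof (fun _ : ℝ => F) (tmin := -((n : ℝ) + 1)) (tmax := n + 1)
        ⟨0, by constructor <;> linarith⟩ x (M * (n + 1)) 0 M K := by
      apply IsPicardLindelof.of_time_independent
      · exact fun y _ => hM y
      · exact hF.lipschitzOnWith
      · simp
    obtain ⟨α, h0, h1⟩ := hpl.exists_eq_forall_mem_Icc_hasDerivWithinAt₀
    exact ⟨α, h0, fun t ht => (h1 t (Ioo_subset_Icc_self ht)).hasDerivAt (Icc_mem_nhds ht.1 ht.2)⟩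
  choose α h0 h1 using key
  have agree : ∀ n m : ℕ, n ≤ m → ∀ s ∈ Ioo (-((n : ℝ) + 1)) (n + 1), α n s = α m s := by
    intro n m hnm
    have hn : (0 : ℝ) ≤ n := n.cast_nonneg
    have hnm' : (n : ℝ) ≤ m := by exact_mod_cast hnm
    refine ODE_solution_unique_of_mem_Ioo (v := fun _ => F) (s := fun _ => univ) (K := K) (t₀ := 0)
      (fun t _ => hF.lipschitzOnWith) (by constructor <;> linarith)
      (fun t ht => ⟨h1 n t ht, trivial⟩) (fun t ht => ⟨h1 m t ⟨?_, ?_⟩, trivial⟩) (by rw [h0, h0])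
    · have := ht.1; linarith
    · have := ht.2; linarith
  have mem : ∀ s : ℝ, ∀ n : ℕ, ⌈|s|⌉₊ ≤ n → s ∈ Ioo (-((n : ℝ) + 1)) (n + 1) := by
    intro s n hn
    have h2 : |s| ≤ n := (Nat.le_ceil _).trans (by exact_mod_cast hn)
    have := abs_le.1 h2
    constructor <;> linarith
  refine ⟨fun t => α ⌈|t|⌉₊ t, by simp [h0], fun t => ?_⟩
  set N := ⌈|t|⌉₊ + 1
  have hN : HasDerivAt (α N) (F (α N t)) t := h1 N t (mem t N (by simp [N]))
  have ht : α ⌈|t|⌉₊ t = α N t := agree _ _ (by simp [N]) t (mem t _ le_rfl)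
  simp only [ht]
  refine hN.congr_of_eventuallyEq ?_
  have : ∀ᶠ s in 𝓝 t, |s| < |t| + 1 := continuous_abs.continuousAt.eventually_lt
    continuousAt_const (by linarith)
  filter_upwards [this] with s hs
  refine agree _ _ ?_ s (mem s _ le_rfl)
  rw [Nat.ceil_le]
  push_cast [N]
  linarith [Nat.le_ceil |t|]

theorem hasDerivWithinAt_Ici_of_Ioo {F : E → E} (hF : Continuous F) {f : ℝ → E} {a b : ℝ}
    (hab : a < b) (hf : ContinuousOn f (Icc a b))
    (hf' : ∀ t ∈ Ioo a b, HasDerivAt f (F (f t)) t) : HasDerivWithinAt f (F (f a)) (Ici a) a := by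
  have hc : ContinuousWithinAt f (Ioo a b) a :=
    (hf a (left_mem_Icc.2 hab.le)).mono Ioo_subset_Icc_self
  refine hasDerivWithinAt_Ici_of_tendsto_deriv (s := Ioo a b)
    (fun t ht => (hf' t ht).differentiableAt.differentiableWithinAt) hc (Ioo_mem_nhdsGT hab) ?_
  have h1 : Tendsto f (𝓝[>] a) (𝓝 (f a)) := by
    rw [← nhdsWithin_Ioo_eq_nhdsGT hab]; exact hc
  refine ((hF.tendsto _).comp h1).congr' ?_
  filter_upwards [Ioo_mem_nhdsGT hab] with t ht
  exact (hf' t ht).deriv.symm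

/-- Uniqueness for an autonomous locally Lipschitz equation, from the left end of an interval. -/
theorem eqOn_of_hasDerivAt_Ioo {F : E → E} (hFc : Continuous F)
    (hF : ∀ R, ∃ K : ℝ≥0, LipschitzOnWith K F (closedBall 0 R)) {f g : ℝ → E} {a b : ℝ}
    (hf : ContinuousOn f (Icc a b)) (hf' : ∀ t ∈ Ioo a b, HasDerivAt f (F (f t)) t)
    (hg : ContinuousOn g (Icc a b)) (hg' : ∀ t ∈ Ioo a b, HasDerivAt g (F (g t)) t)
    (ha : f a = g a) : EqOn f g (Icc a b) := by
  rcases lt_or_ge a b with hab | hab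
  · obtain ⟨R₁, h₁⟩ := (isCompact_Icc.image_of_continuousOn hf).isBounded.subset_closedBall 0
    obtain ⟨R₂, h₂⟩ := (isCompact_Icc.image_of_continuousOn hg).isBounded.subset_closedBall 0
    obtain ⟨K, hK⟩ := hF (max R₁ R₂)
    refine ODE_solution_unique_of_mem_Icc_right (v := fun _ => F)
      (s := fun _ => closedBall 0 (max R₁ R₂)) (fun _ _ => hK) hf (fun t ht => ?_) (fun t ht => ?_)
      hg (fun t ht => ?_) (fun t ht => ?_) ha
    · rcases eq_or_lt_of_le ht.1 with h | h
      · rw [← h]; exact hasDerivWithinAt_Ici_of_Ioo hFc hab hf hf'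
      · exact (hf' t ⟨h, ht.2⟩).hasDerivWithinAt
    · exact closedBall_subset_closedBall (le_max_left _ _)
        (h₁ (mem_image_of_mem f (Ico_subset_Icc_self ht)))
    · rcases eq_or_lt_of_le ht.1 with h | h
      · rw [← h]; exact hasDerivWithinAt_Ici_of_Ioo hFc hab hg hg'
      · exact (hg' t ⟨h, ht.2⟩).hasDerivWithinAt
    · exact closedBall_subset_closedBall (le_max_right _ _)
        (h₂ (mem_image_of_mem g (Ico_subset_Icc_self ht)))
  · intro t ht
    have : t = a := le_antisymm (ht.2.trans hab) ht.1
    rw [this, ha]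

/-- Global solutions of an autonomous locally Lipschitz equation are determined by one value. -/
theorem eq_of_hasDerivAt {F : E → E}
    (hF : ∀ R, ∃ K : ℝ≥0, LipschitzOnWith K F (closedBall 0 R)) {f g : ℝ → E}
    (hf : ∀ t, HasDerivAt f (F (f t)) t) (hg : ∀ t, HasDerivAt g (F (g t)) t) {a : ℝ}
    (ha : f a = g a) : f = g := by
  ext t
  set A := min a t - 1
  set B := max a t + 1
  have hA : A < a ∧ A < t := ⟨by linarith [min_le_left a t], by linarith [min_le_right a t]⟩
  have hB : a < B ∧ t < B := ⟨by linarith [le_max_left a t], by linarith [le_max_right a t]⟩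
  have hfc : Continuous f := continuous_iff_continuousAt.2 fun t => (hf t).continuousAt
  have hgc : Continuous g := continuous_iff_continuousAt.2 fun t => (hg t).continuousAt
  obtain ⟨R₁, h₁⟩ := (isCompact_Icc (a := A) (b := B)).image hfc |>.isBounded.subset_closedBall 0
  obtain ⟨R₂, h₂⟩ := (isCompact_Icc (a := A) (b := B)).image hgc |>.isBounded.subset_closedBall 0
  obtain ⟨K, hK⟩ := hF (max R₁ R₂)
  refine ODE_solution_unique_of_mem_Ioo (v := fun _ => F) (t₀ := a) (a := A) (b := B)
      (s := fun _ => closedBall 0 (max R₁ R₂)) (fun _ _ => hK) ⟨hA.1, hB.1⟩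
      (fun t ht => ⟨hf t, ?_⟩) (fun t ht => ⟨hg t, ?_⟩) ha ⟨hA.2, hB.2⟩
  · exact closedBall_subset_closedBall (le_max_left _ _)
        (h₁ (mem_image_of_mem f (Ioo_subset_Icc_self ht)))
  · exact closedBall_subset_closedBall (le_max_right _ _)
        (h₂ (mem_image_of_mem g (Ioo_subset_Icc_self ht)))

theorem exists_lipschitzOnWith_closedBall {F' : Type*} [NormedAddCommGroup F'] [NormedSpace ℝ F']
    [ProperSpace E] {F : E → F'} (hF : ContDiff ℝ 1 F) (R : ℝ) :
    ∃ K : ℝ≥0, LipschitzOnWith K F (closedBall 0 R) :=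
  hF.contDiffOn.exists_lipschitzOnWith one_ne_zero (convex_closedBall _ _)
    (isCompact_closedBall _ _)

/-- Gronwall's inequality with a linear bound on a fixed time interval. -/
theorem exists_dist_le_mul_of_approx {K : ℝ≥0} (N : ℝ) :
    ∃ C : ℝ, 0 ≤ C ∧ ∀ (F : E → E), LipschitzWith K F → ∀ (f f' g : ℝ → E) (d e : ℝ),
      (∀ t, HasDerivAt f (f' t) t) → (∀ t, dist (f' t) (F (f t)) ≤ e) →
      (∀ t, HasDerivAt g (F (g t)) t) → dist (f 0) (g 0) ≤ d →
      ∀ t ∈ Icc 0 N, dist (f t) (g t) ≤ C * (d + e) := by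
  rcases lt_or_ge N 0 with hN | hN
  · exact ⟨0, le_rfl, fun _ _ _ _ _ _ _ _ _ _ _ t ht => absurd (ht.1.trans ht.2) (not_le.2 hN)⟩
  refine ⟨Real.exp ((K + 1) * N), (Real.exp_pos _).le, fun F hF f f' g d e hf hfe hg hd t ht => ?_⟩
  have he : 0 ≤ e := dist_nonneg.trans (hfe 0)
  have hd0 : 0 ≤ d := dist_nonneg.trans hd
  have hF' : LipschitzWith (K + 1) F := hF.weaken (by simp)
  have := dist_le_of_approx_trajectories_ODE (v := fun _ => F) (K := K + 1) (a := 0) (b := N)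
    (f := f) (f' := f') (g := g) (g' := fun t => F (g t)) (εf := e) (εg := 0) (δ := d)
    (fun _ => hF') (fun t _ => (hf t).continuousAt.continuousWithinAt)
    (fun t _ => (hf t).hasDerivWithinAt) (fun t _ => hfe t)
    (fun t _ => (hg t).continuousAt.continuousWithinAt)
    (fun t _ => (hg t).hasDerivWithinAt) (fun t _ => by simp) hd t ht
  refine this.trans ?_
  have hK : ((K + 1 : ℝ≥0) : ℝ) ≠ 0 := by positivity
  rw [gronwallBound_of_K_ne_0 hK, sub_zero, add_zero]
  have h1 : Real.exp (((K + 1 : ℝ≥0) : ℝ) * t) ≤ Real.exp ((K + 1) * N) := by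
    apply Real.exp_le_exp.2
    push_cast
    have := ht.2
    gcongr
  have h2 : e / ((K + 1 : ℝ≥0) : ℝ) ≤ e := by
    apply div_le_self he
    push_cast
    linarith [K.2]
  have h3 : 0 ≤ Real.exp (((K + 1 : ℝ≥0) : ℝ) * t) - 1 := by
    have := ht.1
    linarith [Real.one_le_exp (x := ((K + 1 : ℝ≥0) : ℝ) * t) (by positivity)]
  calc d * Real.exp (((K + 1 : ℝ≥0) : ℝ) * t)
        + e / ((K + 1 : ℝ≥0) : ℝ) * (Real.exp (((K + 1 : ℝ≥0) : ℝ) * t) - 1)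
      ≤ d * Real.exp ((K + 1) * N) + e * Real.exp ((K + 1) * N) := by
        gcongr
        linarith
    _ = _ := by ring

end ODE

/-! ### Clamping to a box -/

/-- Clamping of a real number to `[-R, R]`. -/
noncomputable def clamp (R x : ℝ) : ℝ := max (-R) (min R x)

/-- Coordinatewise clamping in the plane. -/
noncomputable def clamp₂ (R : ℝ) : ℝ × ℝ → ℝ × ℝ := Prod.map (clamp R) (clamp R)

/-- Coordinatewise clamping in the phase space. -/
noncomputable def clamp₄ (R : ℝ) : (ℝ × ℝ) × (ℝ × ℝ) → (ℝ × ℝ) × (ℝ × ℝ) :=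
  Prod.map (clamp₂ R) (clamp₂ R)

theorem lipschitzWith_clamp (R : ℝ) : LipschitzWith 1 (clamp R) :=
  (LipschitzWith.id.const_min R).const_max (-R)

theorem abs_clamp_le {R : ℝ} (hR : 0 ≤ R) (x : ℝ) : |clamp R x| ≤ R := by
  rw [abs_le, clamp]
  exact ⟨le_max_left _ _, max_le (by linarith) (min_le_left _ _)⟩

theorem clamp_of_abs_le {R x : ℝ} (h : |x| ≤ R) : clamp R x = x := by
  rw [abs_le] at h
  rw [clamp, min_eq_right h.2, max_eq_right h.1]

theorem lipschitzWith_prodMap {α β : Type*} [PseudoMetricSpace α] [PseudoMetricSpace β]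
    {f : α → α} {g : β → β} (hf : LipschitzWith 1 f) (hg : LipschitzWith 1 g) :
    LipschitzWith 1 (Prod.map f g) := by
  refine LipschitzWith.of_dist_le_mul fun x y => ?_
  have h1 := hf.dist_le_mul x.1 y.1
  have h2 := hg.dist_le_mul x.2 y.2
  simp only [Prod.dist_eq, Prod.map, NNReal.coe_one, one_mul] at *
  exact max_le_max h1 h2

theorem lipschitzWith_clamp₂ (R : ℝ) : LipschitzWith 1 (clamp₂ R) :=
  lipschitzWith_prodMap (lipschitzWith_clamp R) (lipschitzWith_clamp R)

theorem lipschitzWith_clamp₄ (R : ℝ) : LipschitzWith 1 (clamp₄ R) :=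
  lipschitzWith_prodMap (lipschitzWith_clamp₂ R) (lipschitzWith_clamp₂ R)

theorem clamp₂_mem {R : ℝ} (hR : 0 ≤ R) (x : ℝ × ℝ) : clamp₂ R x ∈ closedBall 0 R := by
  simp [clamp₂, Prod.norm_def, abs_clamp_le hR]

theorem clamp₄_mem {R : ℝ} (hR : 0 ≤ R) (x : (ℝ × ℝ) × (ℝ × ℝ)) :
    clamp₄ R x ∈ closedBall 0 R := by
  simp [clamp₄, clamp₂, Prod.norm_def, abs_clamp_le hR]

theorem clamp₂_of_mem {R : ℝ} {x : ℝ × ℝ} (h : ‖x‖ ≤ R) : clamp₂ R x = x := by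
  simp only [Prod.norm_def, sup_le_iff, Real.norm_eq_abs] at h
  ext <;> simp [clamp₂, clamp_of_abs_le, h]

theorem clamp₄_of_mem {R : ℝ} {x : (ℝ × ℝ) × (ℝ × ℝ)} (h : ‖x‖ ≤ R) : clamp₄ R x = x := by
  simp only [Prod.norm_def, sup_le_iff, Real.norm_eq_abs] at h
  obtain ⟨⟨h1, h2⟩, h3, h4⟩ := h
  ext <;> simp [clamp₄, clamp₂, clamp_of_abs_le, *]

theorem exists_bound_closedBall {E F' : Type*} [NormedAddCommGroup E] [ProperSpace E]
    [NormedAddCommGroup F'] {F : E → F'}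
    (hF : Continuous F) (R : ℝ) : ∃ M : ℝ≥0, ∀ x ∈ closedBall 0 R, ‖F x‖ ≤ M := by
  obtain ⟨M, hM⟩ := (isCompact_closedBall (0 : E) R).exists_bound_of_continuousOn hF.continuousOn
  exact ⟨M.toNNReal, fun x hx => (hM x hx).trans (Real.le_coe_toNNReal M)⟩

section Clamped

variable {E : Type*} [NormedAddCommGroup E] [NormedSpace ℝ E] [ProperSpace E]

theorem exists_lipschitzWith_comp_retraction {F : E → E} (hF : ContDiff ℝ 1 F) {R : ℝ}
    {π : E → E} (hπ : LipschitzWith 1 π) (hm : ∀ x, π x ∈ closedBall 0 R) :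
    ∃ K : ℝ≥0, LipschitzWith K (F ∘ π) := by
  obtain ⟨K, hK⟩ := exists_lipschitzOnWith_closedBall hF R
  refine ⟨K * 1, ?_⟩
  rw [← lipschitzOnWith_univ]
  exact hK.comp hπ.lipschitzOnWith fun x _ => hm x

theorem exists_clamped_solution [CompleteSpace E] {F : E → E} (hF : ContDiff ℝ 1 F) {R : ℝ}
    {π : E → E} (hπ : LipschitzWith 1 π) (hm : ∀ x, π x ∈ closedBall 0 R) (x : E) :
    ∃ y : ℝ → E, y 0 = x ∧ ∀ t, HasDerivAt y (F (π (y t))) t := by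
  obtain ⟨K, hK⟩ := exists_lipschitzWith_comp_retraction hF hπ hm
  obtain ⟨M, hM⟩ := exists_bound_closedBall hF.continuous R
  exact exists_integralCurve_of_bounded_of_lipschitz hK (fun x => hM _ (hm x)) x

end Clamped

/-! ### Orbits of `p²/2 + V(q)` -/

/-- The Hamiltonian vector field of `p²/2 + V(q)`. -/
noncomputable def planeField (V : ℝ → ℝ) (x : ℝ × ℝ) : ℝ × ℝ := (x.2, -deriv V x.1)

/-- The energy `p²/2 + V(q)`. -/
noncomputable def planeEnergy (V : ℝ → ℝ) (x : ℝ × ℝ) : ℝ := x.2 ^ 2 / 2 + V x.1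

/-- Complete orbits of `p²/2 + V(q)`. -/
def IsOrbit (V : ℝ → ℝ) (Φ : ℝ → ℝ × ℝ) : Prop := ∀ t, HasDerivAt Φ (planeField V (Φ t)) t

theorem contDiff_deriv {V : ℝ → ℝ} (hV : ContDiff ℝ 2 V) : ContDiff ℝ 1 (deriv V) :=
  ((contDiff_succ_iff_deriv (n := 1)).1 (by rwa [one_add_one_eq_two])).2.2

theorem contDiff_planeField {V : ℝ → ℝ} (hV : ContDiff ℝ 2 V) : ContDiff ℝ 1 (planeField V) :=
  contDiff_snd.prodMk ((contDiff_deriv hV).comp contDiff_fst).neg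

theorem hasDerivAt_potential {V : ℝ → ℝ} (hV : ContDiff ℝ 2 V) (x : ℝ) :
    HasDerivAt V (deriv V x) x :=
  (hV.differentiable (by norm_num) x).hasDerivAt

theorem hasDerivAt_fst {f : ℝ → ℝ × ℝ} {f' : ℝ × ℝ} {t : ℝ} (h : HasDerivAt f f' t) :
    HasDerivAt (fun s => (f s).1) f'.1 t :=
  (ContinuousLinearMap.fst ℝ ℝ ℝ).hasFDerivAt.comp_hasDerivAt t h

theorem hasDerivAt_snd {f : ℝ → ℝ × ℝ} {f' : ℝ × ℝ} {t : ℝ} (h : HasDerivAt f f' t) :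
    HasDerivAt (fun s => (f s).2) f'.2 t :=
  (ContinuousLinearMap.snd ℝ ℝ ℝ).hasFDerivAt.comp_hasDerivAt t h

theorem IsOrbit.hasDerivAt_q {V : ℝ → ℝ} {Φ : ℝ → ℝ × ℝ} (h : IsOrbit V Φ) (t : ℝ) :
    HasDerivAt (fun s => (Φ s).1) (Φ t).2 t := hasDerivAt_fst (h t)

theorem IsOrbit.hasDerivAt_p {V : ℝ → ℝ} {Φ : ℝ → ℝ × ℝ} (h : IsOrbit V Φ) (t : ℝ) :
    HasDerivAt (fun s => (Φ s).2) (-deriv V (Φ t).1) t := hasDerivAt_snd (h t)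

theorem IsOrbit.continuous {V : ℝ → ℝ} {Φ : ℝ → ℝ × ℝ} (h : IsOrbit V Φ) : Continuous Φ :=
  continuous_iff_continuousAt.2 fun t => (h t).continuousAt

theorem IsOrbit.comp_add {V : ℝ → ℝ} {Φ : ℝ → ℝ × ℝ} (h : IsOrbit V Φ) (c : ℝ) :
    IsOrbit V (fun t => Φ (c + t)) := fun t => (h (c + t)).comp_const_add c t

theorem IsOrbit.reverse {V : ℝ → ℝ} {Φ : ℝ → ℝ × ℝ} (h : IsOrbit V Φ) (c : ℝ) :
    IsOrbit V (fun t => ((Φ (c - t)).1, -(Φ (c - t)).2)) := by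
  intro t
  have h1 : HasDerivAt (fun s : ℝ => c - s) (-1) t := by
    simpa using (hasDerivAt_id t).const_sub c
  have hq := (h.hasDerivAt_q (c - t)).comp t h1
  have hp := ((h.hasDerivAt_p (c - t)).comp t h1).neg
  convert! hq.prodMk hp using 1
  simp [planeField]

theorem hasDerivAt_planeEnergy {V : ℝ → ℝ} (hV : ContDiff ℝ 2 V) {f : ℝ → ℝ × ℝ} {f' : ℝ × ℝ}
    {t : ℝ} (h : HasDerivAt f f' t) :
    HasDerivAt (fun s => planeEnergy V (f s)) ((f t).2 * f'.2 + deriv V (f t).1 * f'.1) t := by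
  have h1 := ((hasDerivAt_snd h).pow 2).div_const 2
  have h2 := (hasDerivAt_potential hV (f t).1).comp t (hasDerivAt_fst h)
  convert! h1.add h2 using 1
  simp; ring

theorem continuous_planeEnergy {V : ℝ → ℝ} (hV : ContDiff ℝ 2 V) : Continuous (planeEnergy V) := by
  have := hV.continuous
  unfold planeEnergy
  fun_prop

theorem IsOrbit.energy_eq {V : ℝ → ℝ} (hV : ContDiff ℝ 2 V) {Φ : ℝ → ℝ × ℝ} (h : IsOrbit V Φ)
    (s t : ℝ) : planeEnergy V (Φ s) = planeEnergy V (Φ t) := by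
  have hd : ∀ t, HasDerivAt (fun s => planeEnergy V (Φ s)) 0 t := by
    intro t
    convert hasDerivAt_planeEnergy hV (h t) using 1
    simp [planeField]; ring
  exact is_const_of_deriv_eq_zero (fun t => (hd t).differentiableAt) (fun t => (hd t).deriv) s t

theorem exists_orbit {V : ℝ → ℝ} (hV : ContDiff ℝ 2 V) {x : ℝ × ℝ} {R : ℝ}
    (hR : ∀ y, planeEnergy V y = planeEnergy V x → ‖y‖ < R) : ∃ Φ, IsOrbit V Φ ∧ Φ 0 = x := by
  have hR0 : 0 ≤ R := (norm_nonneg x).trans (hR x rfl).le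
  obtain ⟨y, h0, h1⟩ := exists_clamped_solution (contDiff_planeField hV) (lipschitzWith_clamp₂ R)
    (clamp₂_mem hR0) x
  have hyc : Continuous y := continuous_iff_continuousAt.2 fun t => (h1 t).continuousAt
  have hec : Continuous fun t => planeEnergy V (y t) := (continuous_planeEnergy hV).comp hyc
  have hS : IsClopen {t | planeEnergy V (y t) = planeEnergy V x} := by
    refine ⟨isClosed_eq hec continuous_const, ?_⟩
    rw [Metric.isOpen_iff]
    intro t ht
    have hnear : ∀ᶠ s in 𝓝 t, ‖y s‖ < R :=
      hyc.norm.continuousAt.eventually_lt continuousAt_const (hR _ ht)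
    obtain ⟨ε, hε, hball⟩ := Metric.eventually_nhds_iff_ball.1 hnear
    refine ⟨ε, hε, fun s hs => ?_⟩
    have hd : ∀ u ∈ ball t ε, HasDerivAt (fun s => planeEnergy V (y s)) 0 u := by
      intro u hu
      have h2 := h1 u
      rw [clamp₂_of_mem (hball u hu).le] at h2
      convert hasDerivAt_planeEnergy hV h2 using 1
      simp [planeField]; ring
    have := (convex_ball t ε).is_const_of_fderivWithin_eq_zero (𝕜 := ℝ)
      (f := fun s => planeEnergy V (y s))
      (fun u hu => (hd u hu).differentiableAt.differentiableWithinAt)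
      (fun u hu => by
        rw [fderivWithin_of_isOpen isOpen_ball hu]
        ext; simp [(hd u hu).deriv]) hs (mem_ball_self hε)
    simp only [mem_ofPred_eq] at ht ⊢
    rw [this, ht]
  have huniv := hS.eq_univ ⟨0, by simp [h0]⟩
  refine ⟨y, fun t => ?_, h0⟩
  have ht : t ∈ {t | planeEnergy V (y t) = planeEnergy V x} := huniv ▸ mem_univ t
  have := h1 t
  rwa [clamp₂_of_mem (hR _ ht).le] at this

theorem IsOrbit.eq {V : ℝ → ℝ} (hV : ContDiff ℝ 2 V) {Φ Ψ : ℝ → ℝ × ℝ} (hΦ : IsOrbit V Φ)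
    (hΨ : IsOrbit V Ψ) {a : ℝ} (ha : Φ a = Ψ a) : Φ = Ψ :=
  eq_of_hasDerivAt (exists_lipschitzOnWith_closedBall (contDiff_planeField hV)) hΦ hΨ ha

end ImpactSystem

namespace ImpactSystem

open MeasureTheory

/-! ### Expansion of the action -/

/-- The positive momentum on the level `h` over `x` (zero if there is none). -/
noncomputable def mom (V : ℝ → ℝ) (h x : ℝ) : ℝ := √(2 * (h - V x))

theorem mom_nonneg (V : ℝ → ℝ) (h x : ℝ) : 0 ≤ mom V h x := Real.sqrt_nonneg _

theorem mom_eq_zero {V : ℝ → ℝ} {h x : ℝ} (hx : h ≤ V x) : mom V h x = 0 :=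
  Real.sqrt_eq_zero_of_nonpos (by linarith)

theorem mom_pos {V : ℝ → ℝ} {h x : ℝ} (hx : V x < h) : 0 < mom V h x :=
  Real.sqrt_pos.2 (by linarith)

theorem mom_sq {V : ℝ → ℝ} {h x : ℝ} (hx : V x ≤ h) : mom V h x ^ 2 = 2 * (h - V x) :=
  Real.sq_sqrt (by linarith)

theorem continuous_mom {V : ℝ → ℝ} (hV : Continuous V) (h : ℝ) : Continuous (mom V h) := by
  unfold mom; fun_prop

theorem hasDerivAt_mom {V : ℝ → ℝ} (hV : ContDiff ℝ 2 V) {h x : ℝ} (hx : V x < h) :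
    HasDerivAt (mom V h) (-(deriv V x / mom V h x)) x := by
  have h1 : HasDerivAt (fun y => 2 * (h - V y)) (2 * (-deriv V x)) x :=
    ((hasDerivAt_potential hV x).const_sub h).const_mul 2
  convert! h1.sqrt (by linarith) using 1
  have := (mom_pos hx).ne'
  unfold mom at *
  field_simp

/-- `V` increases on `[a, b]` away from a well bottom or from a regular point `a`. -/
structure IsSlope (V : ℝ → ℝ) (a b C : ℝ) : Prop where
  lt : a < b
  nonneg : 0 ≤ C
  pos : ∀ x ∈ Ioc a b, 0 < deriv V x
  curv : ∀ x ∈ Ioc a b, |deriv (deriv V) x| * (V x - V a) ≤ C * deriv V x ^ 2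
  lin : ∀ x ∈ Ioc a b, V x - V a ≤ C * deriv V x * (x - a)
  quad : ∀ x ∈ Ioc a b, (x - a) ^ 2 ≤ C * (V x - V a)

/-- The derivative of `(V - V a) / V'`. -/
noncomputable def slopeWeight (V : ℝ → ℝ) (a x : ℝ) : ℝ :=
  1 - (V x - V a) * deriv (deriv V) x / deriv V x ^ 2

variable {V : ℝ → ℝ} {a b C : ℝ}

theorem IsSlope.strictMonoOn (hS : IsSlope V a b C) (hV : ContDiff ℝ 2 V) :
    StrictMonoOn V (Icc a b) :=
  strictMonoOn_of_deriv_pos (convex_Icc a b) hV.continuous.continuousOn fun x hx => by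
    rw [interior_Icc] at hx; exact hS.pos x (Ioo_subset_Ioc_self hx)

theorem IsSlope.sub_nonneg (hS : IsSlope V a b C) (hV : ContDiff ℝ 2 V) {x : ℝ}
    (hx : x ∈ Icc a b) : 0 ≤ V x - V a := by
  have := (hS.strictMonoOn hV).monotoneOn (left_mem_Icc.2 hS.lt.le) hx hx.1
  linarith

theorem IsSlope.abs_weight_le (hS : IsSlope V a b C) (hV : ContDiff ℝ 2 V) {x : ℝ}
    (hx : x ∈ Ioc a b) : |slopeWeight V a x| ≤ 1 + C := by
  have h1 := hS.pos x hx
  have h2 := hS.sub_nonneg hV (Ioc_subset_Icc_self hx)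
  have h3 : |(V x - V a) * deriv (deriv V) x / deriv V x ^ 2| ≤ C := by
    rw [abs_div, abs_mul, abs_of_nonneg h2, abs_of_pos (pow_pos h1 2), div_le_iff₀ (pow_pos h1 2),
      mul_comm]
    exact hS.curv x hx
  calc |slopeWeight V a x| ≤ |1| + |(V x - V a) * deriv (deriv V) x / deriv V x ^ 2| := abs_sub _ _
    _ ≤ 1 + C := by simpa using h3

theorem measurable_slopeWeight (hV : ContDiff ℝ 2 V) (a : ℝ) : Measurable (slopeWeight V a) := by
  have := hV.continuous.measurable
  have h1 := measurable_deriv V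
  have h2 := measurable_deriv (deriv V)
  unfold slopeWeight
  fun_prop

theorem IsSlope.hasDerivAt_ratio (hS : IsSlope V a b C) (hV : ContDiff ℝ 2 V) {x : ℝ}
    (hx : x ∈ Ioc a b) :
    HasDerivAt (fun y => (V y - V a) / deriv V y) (slopeWeight V a x) x := by
  have h1 := (hasDerivAt_potential hV x).sub_const (V a)
  have h2 : HasDerivAt (deriv V) (deriv (deriv V) x) x :=
    ((contDiff_deriv hV).differentiable (by norm_num) x).hasDerivAt
  have h0 := (hS.pos x hx).ne'
  convert! h1.div h2 h0 using 1
  unfold slopeWeight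
  field_simp

theorem IsSlope.continuousOn_ratio (hS : IsSlope V a b C) (hV : ContDiff ℝ 2 V) :
    ContinuousOn (fun y => (V y - V a) / deriv V y) (Icc a b) := by
  intro x hx
  rcases eq_or_lt_of_le hx.1 with h | h
  · subst h
    have h0 : Tendsto (fun y => C * (y - a)) (𝓝[Icc a b] a) (𝓝 0) := by
      have : Continuous fun y : ℝ => C * (y - a) := by fun_prop
      have := this.tendsto a
      rw [sub_self, mul_zero] at this
      exact this.mono_left nhdsWithin_le_nhds
    have : Tendsto (fun y => (V y - V a) / deriv V y) (𝓝[Icc a b] a) (𝓝 0) := by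
      refine squeeze_zero' ?_ ?_ h0
      · filter_upwards [self_mem_nhdsWithin] with y hy
        rcases eq_or_lt_of_le hy.1 with h | h
        · simp [← h]
        · exact div_nonneg (hS.sub_nonneg hV hy) (hS.pos y ⟨h, hy.2⟩).le
      · filter_upwards [self_mem_nhdsWithin] with y hy
        rcases eq_or_lt_of_le hy.1 with h | h
        · simp [← h]
        · rw [div_le_iff₀ (hS.pos y ⟨h, hy.2⟩)]
          have := hS.lin y ⟨h, hy.2⟩
          linarith
    simpa [ContinuousWithinAt] using this
  · exact (hS.hasDerivAt_ratio hV ⟨h, hx.2⟩).continuousAt.continuousWithinAt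

/-- A bounded measurable weight times a continuous function is integrable. -/
theorem integrableOn_weight_mul {w f : ℝ → ℝ} (hw : Measurable w) (hf : Continuous f) {M : ℝ}
    (hM : ∀ x ∈ Ioc a b, |w x| ≤ M) : IntegrableOn (fun x => w x * f x) (Ioc a b) := by
  obtain ⟨N, hN⟩ := (isCompact_Icc (a := a) (b := b)).exists_bound_of_continuousOn hf.continuousOn
  refine Measure.integrableOn_of_bounded (M := M * N) (by simp) (hw.mul hf.measurable).aestronglyMeasurable ?_
  filter_upwards [ae_restrict_mem measurableSet_Ioc] with x hx
  rw [norm_mul]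
  exact mul_le_mul (hM x hx) (hN x (Ioc_subset_Icc_self hx)) (norm_nonneg _)
    ((abs_nonneg _).trans (hM x hx))

theorem IsSlope.exists_turning (hS : IsSlope V a b C) (hV : ContDiff ℝ 2 V) {h : ℝ}
    (h1 : V a < h) (h2 : h ≤ V b) :
    ∃ r ∈ Ioc a b, V r = h ∧ (∀ x ∈ Ico a r, V x < h) ∧ ∀ x ∈ Icc r b, h ≤ V x := by
  obtain ⟨r, hr, hrh⟩ := intermediate_value_Icc hS.lt.le hV.continuous.continuousOn ⟨h1.le, h2⟩
  have har : a < r := by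
    rcases eq_or_lt_of_le hr.1 with h | h
    · subst h; exact absurd hrh h1.ne
    · exact h
  have hm := hS.strictMonoOn hV
  refine ⟨r, ⟨har, hr.2⟩, hrh, fun x hx => ?_, fun x hx => ?_⟩
  · rw [← hrh]; exact hm ⟨hx.1, hx.2.le.trans hr.2⟩ hr hx.2
  · rw [← hrh]; exact hm.monotoneOn hr ⟨hr.1.trans hx.1, hx.2⟩ hx.1

theorem integral_eq_integral_Ioo_of_zero {r : ℝ} {f : ℝ → ℝ} (har : a < r) (hrb : r ≤ b)
    (hf : ∀ x ∈ Icc r b, f x = 0) : ∫ x in a..b, f x = ∫ x in Ioo a r, f x := by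
  rw [intervalIntegral.integral_of_le (har.le.trans hrb)]
  refine setIntegral_eq_of_subset_of_forall_sdiff_eq_zero measurableSet_Ioc
    (fun x hx => ⟨hx.1, hx.2.le.trans hrb⟩) fun x hx => hf x ⟨?_, hx.1.2⟩
  by_contra hlt
  exact hx.2 ⟨hx.1.1, not_le.1 hlt⟩

/-- Integration by parts on a slope for the period and the action. -/
theorem IsSlope.identities (hS : IsSlope V a b C) (hV : ContDiff ℝ 2 V) {h : ℝ}
    (h1 : V a < h) (h2 : h ≤ V b) :
    IntervalIntegrable (fun x => 1 / mom V h x) volume a b ∧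
    (h - V a) * ∫ x in a..b, 1 / mom V h x
      = ∫ x in a..b, (1 / 2 + slopeWeight V a x) * mom V h x ∧
    (h - V a) * ∫ x in a..b, mom V h x
      = ∫ x in a..b, (1 / 2 + slopeWeight V a x / 3) * mom V h x ^ 3 := by
  obtain ⟨r, hr, hrh, hlt, hge⟩ := hS.exists_turning hV h1 h2
  have he : 0 < h - V a := by linarith
  have hmc := continuous_mom hV.continuous h
  have hsub : Icc a r ⊆ Icc a b := Icc_subset_Icc_right hr.2
  have hkc := (hS.continuousOn_ratio hV).mono hsub
  set k : ℝ → ℝ := fun y => (V y - V a) / deriv V y with hk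
  have hVp : ∀ x ∈ Ioo a r, 0 < deriv V x := fun x hx => hS.pos x ⟨hx.1, hx.2.le.trans hr.2⟩
  have hkd : ∀ x ∈ Ioo a r, HasDerivAt k (slopeWeight V a x) x := fun x hx =>
    hS.hasDerivAt_ratio hV ⟨hx.1, hx.2.le.trans hr.2⟩
  have hmd : ∀ x ∈ Ioo a r, HasDerivAt (mom V h) (-(deriv V x / mom V h x)) x := fun x hx =>
    hasDerivAt_mom hV (hlt x ⟨hx.1.le, hx.2⟩)
  have hmp : ∀ x ∈ Ioo a r, 0 < mom V h x := fun x hx => mom_pos (hlt x ⟨hx.1.le, hx.2⟩)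
  have hms : ∀ x ∈ Ioo a r, mom V h x ^ 2 = 2 * (h - V x) := fun x hx =>
    mom_sq (hlt x ⟨hx.1.le, hx.2⟩).le
  have hkV : ∀ x ∈ Ioo a r, k x * deriv V x = V x - V a := fun x hx => by
    have := (hVp x hx).ne'
    simp only [hk]; field_simp
  have hka : k a = 0 := by simp [hk]
  have hmr : mom V h r = 0 := mom_eq_zero hrh.ge
  -- integrability
  have i1 : IntegrableOn (fun x => deriv V x / mom V h x) (Ioc a r) := by
    refine intervalIntegral.integrableOn_deriv_of_nonneg (g := fun x => -mom V h x)
      hmc.neg.continuousOn (fun x hx => ?_) fun x hx => div_nonneg (hVp x hx).le (hmp x hx).le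
    simpa using (hmd x hx).fun_neg
  have i2 : IntegrableOn (fun x => k x * (deriv V x / mom V h x)) (Ioc a r) := by
    rw [← integrableOn_Icc_iff_integrableOn_Ioc] at i1 ⊢
    exact i1.continuousOn_mul hkc isCompact_Icc
  have i3 : IntegrableOn (fun x => mom V h x) (Ioc a r) := hmc.integrableOn_Ioc
  have hw : ∀ x ∈ Ioc a r, |slopeWeight V a x| ≤ 1 + C := fun x hx =>
    hS.abs_weight_le hV ⟨hx.1, hx.2.trans hr.2⟩
  have i4 : IntegrableOn (fun x => slopeWeight V a x * mom V h x) (Ioc a r) :=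
    integrableOn_weight_mul (measurable_slopeWeight hV a) hmc hw
  have i5 : IntegrableOn (fun x => slopeWeight V a x * mom V h x ^ 3) (Ioc a r) :=
    integrableOn_weight_mul (measurable_slopeWeight hV a) (hmc.pow 3) hw
  have i6 : IntegrableOn (fun x => mom V h x ^ 3) (Ioc a r) := (hmc.pow 3).integrableOn_Ioc
  have i7 : IntegrableOn (fun x => k x * deriv V x * mom V h x) (Ioc a r) := by
    rw [← integrableOn_Icc_iff_integrableOn_Ioc]
    refine ContinuousOn.integrableOn_compact isCompact_Icc ?_
    exact (hkc.mul (contDiff_deriv hV).continuous.continuousOn).mul hmc.continuousOn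
  have e1 : ∀ x ∈ Ioo a r, (h - V a) * (1 / mom V h x)
      = 1 / 2 * mom V h x + k x * (deriv V x / mom V h x) := fun x hx => by
    have h3 := (hmp x hx).ne'
    rw [← mul_div_assoc (k x), hkV x hx]
    field_simp
    linarith [hms x hx]
  have e2 : ∀ x ∈ Ioo a r, (h - V a) * mom V h x
      = 1 / 2 * mom V h x ^ 3 + k x * deriv V x * mom V h x := fun x hx => by
    rw [hkV x hx, pow_succ, hms x hx]; ring
  -- integration by parts
  have p1 : ∫ x in Ioo a r, k x * (deriv V x / mom V h x)
      = ∫ x in Ioo a r, slopeWeight V a x * mom V h x := by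
    have hd : ∀ x ∈ Ioo a r, HasDerivAt (fun x => k x * mom V h x)
        (slopeWeight V a x * mom V h x - k x * (deriv V x / mom V h x)) x := fun x hx => by
      convert! (hkd x hx).mul (hmd x hx) using 1
      ring
    have := intervalIntegral.integral_eq_sub_of_hasDerivAt_of_le hr.1.le
      (hkc.mul hmc.continuousOn) hd
      ((intervalIntegrable_iff_integrableOn_Ioc_of_le hr.1.le).2 (i4.sub i2))
    rw [intervalIntegral.integral_of_le hr.1.le, integral_Ioc_eq_integral_Ioo, integral_sub
      (i4.mono_set Ioo_subset_Ioc_self) (i2.mono_set Ioo_subset_Ioc_self)] at this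
    simp only [Pi.mul_apply, hka, hmr] at this
    linarith
  have p2 : ∫ x in Ioo a r, k x * deriv V x * mom V h x
      = 1 / 3 * ∫ x in Ioo a r, slopeWeight V a x * mom V h x ^ 3 := by
    have hd : ∀ x ∈ Ioo a r, HasDerivAt (fun x => k x * mom V h x ^ 3)
        (slopeWeight V a x * mom V h x ^ 3 - 3 * (k x * deriv V x * mom V h x)) x := fun x hx => by
      have h3 := (hmp x hx).ne'
      convert! (hkd x hx).mul ((hmd x hx).pow 3) using 1
      have h4 : (mom V h ^ 3) x = mom V h x ^ 3 := rfl
      rw [h4]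
      push_cast
      field_simp
      ring
    have := intervalIntegral.integral_eq_sub_of_hasDerivAt_of_le hr.1.le
      (hkc.mul (hmc.pow 3).continuousOn) hd
      ((intervalIntegrable_iff_integrableOn_Ioc_of_le hr.1.le).2 (i5.sub (i7.const_mul 3)))
    rw [intervalIntegral.integral_of_le hr.1.le, integral_Ioc_eq_integral_Ioo, integral_sub
      (i5.mono_set Ioo_subset_Ioc_self) ((i7.mono_set Ioo_subset_Ioc_self).const_mul 3),
      integral_const_mul] at this
    simp only [Pi.mul_apply, Pi.pow_apply, hka, hmr] at this
    linarith
  have hz : ∀ x ∈ Icc r b, mom V h x = 0 := fun x hx => mom_eq_zero (hge x hx)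
  have mo : Ioo a r ⊆ Ioc a r := Ioo_subset_Ioc_self
  refine ⟨?_, ?_, ?_⟩
  · rw [intervalIntegrable_iff_integrableOn_Ioc_of_le hS.lt.le]
    have : IntegrableOn (fun x => 1 / mom V h x) (Ioo a r) := by
      have h3 : IntegrableOn (fun x => (h - V a)⁻¹ *
          (1 / 2 * mom V h x + k x * (deriv V x / mom V h x))) (Ioo a r) :=
        (((i3.mono_set mo).const_mul _).add (i2.mono_set mo)).const_mul _
      refine (integrableOn_congr_fun (fun x hx => ?_) measurableSet_Ioo).1 h3
      rw [← e1 x hx]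
      field_simp
    have h4 : IntegrableOn (fun x => 1 / mom V h x) (Icc r b) := by
      refine (integrableOn_congr_fun (g := fun _ => (0 : ℝ)) (fun x hx => ?_) measurableSet_Icc).2
        integrableOn_zero
      simp [hz x hx]
    refine (this.union h4).mono_set fun x hx => ?_
    rcases lt_or_ge x r with h | h
    · exact Or.inl ⟨hx.1, h⟩
    · exact Or.inr ⟨h, hx.2⟩
  · rw [integral_eq_integral_Ioo_of_zero hr.1 hr.2 fun x hx => by simp [hz x hx],
      integral_eq_integral_Ioo_of_zero hr.1 hr.2 fun x hx => by simp [hz x hx],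
      ← integral_const_mul, setIntegral_congr_fun measurableSet_Ioo e1,
      integral_add ((i3.mono_set mo).const_mul _) (i2.mono_set mo), p1,
      ← integral_add ((i3.mono_set mo).const_mul _) (i4.mono_set mo)]
    congr 1; ext x; ring
  · rw [integral_eq_integral_Ioo_of_zero hr.1 hr.2 fun x hx => by simp [hz x hx],
      integral_eq_integral_Ioo_of_zero hr.1 hr.2 fun x hx => by simp [hz x hx],
      ← integral_const_mul, setIntegral_congr_fun measurableSet_Ioo e2,
      integral_add ((i6.mono_set mo).const_mul _) (i7.mono_set mo), p2, ← integral_const_mul,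
      ← integral_add ((i6.mono_set mo).const_mul _) ((i5.mono_set mo).const_mul _)]
    congr 1; ext x; ring

theorem abs_cube_sub_le {u v : ℝ} :
    |√v ^ 3 - √u ^ 3 - 3 / 2 * (v - u) * √u| ≤ 3 / 2 * (v - u) ^ 2 * (1 / √u + 1 / √v) := by
  rcases le_or_gt u 0 with hu | hu <;> rcases le_or_gt v 0 with hv | hv
  · simp [Real.sqrt_eq_zero_of_nonpos hu, Real.sqrt_eq_zero_of_nonpos hv]
  · have hs := Real.sqrt_pos.2 hv
    have hsq := Real.sq_sqrt hv.le
    simp only [Real.sqrt_eq_zero_of_nonpos hu]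
    set s := √v
    rw [div_zero, zero_add, mul_one_div, abs_of_nonneg (by ring_nf; positivity), le_div_iff₀ hs]
    have : v ^ 2 ≤ (v - u) ^ 2 := by nlinarith
    rw [← hsq] at this ⊢
    nlinarith
  · have hs := Real.sqrt_pos.2 hu
    have hsq := Real.sq_sqrt hu.le
    simp only [Real.sqrt_eq_zero_of_nonpos hv]
    set s := √u
    have h1 : 0 ^ 3 - s ^ 3 - 3 / 2 * (v - u) * s = s * (s ^ 2 / 2 - 3 / 2 * v) := by
      linear_combination (-3 / 2 * s) * hsq
    rw [h1, div_zero, add_zero, mul_one_div, abs_of_nonneg (by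
      have : 0 ≤ s ^ 2 / 2 - 3 / 2 * v := by nlinarith
      positivity), le_div_iff₀ hs]
    rw [← hsq] at hu ⊢
    nlinarith [mul_nonneg (sq_nonneg s) (neg_nonneg.2 hv), sq_nonneg v, sq_nonneg (s ^ 2)]
  · have hs := Real.sqrt_pos.2 hu
    have hsq := Real.sq_sqrt hu.le
    have ht := Real.sqrt_pos.2 hv
    have htq := Real.sq_sqrt hv.le
    set s := √u
    set t := √v
    rw [← hsq, ← htq]
    have h1 : t ^ 3 - s ^ 3 - 3 / 2 * (t ^ 2 - s ^ 2) * s = (t - s) ^ 2 * (t + s / 2) := by ring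
    rw [h1, abs_of_nonneg (by positivity)]
    have h2 : t + s / 2 ≤ 3 / 2 * ((t + s) ^ 2 * (1 / s + 1 / t)) := by
      have : 1 / t ≤ 1 / s + 1 / t := by have := one_div_pos.2 hs; linarith
      calc t + s / 2 ≤ 3 / 2 * ((t + s) ^ 2 * (1 / t)) := by
            rw [mul_one_div, ← mul_div_assoc, le_div_iff₀ ht]; nlinarith
        _ ≤ _ := by gcongr
    calc (t - s) ^ 2 * (t + s / 2)
        ≤ (t - s) ^ 2 * (3 / 2 * ((t + s) ^ 2 * (1 / s + 1 / t))) := by gcongr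
      _ = _ := by ring

/-- Second order expansion of the action integral over `[a, b]` in the energy, for energies in `J`,
with the loss `1 / (h - m)` at the bottom `m` of the well. -/
structure HasActionExpansion (V : ℝ → ℝ) (a b : ℝ) (J : Set ℝ) (m C : ℝ) : Prop where
  integrable : ∀ h ∈ J, IntervalIntegrable (fun x => 1 / mom V h x) volume a b
  inv_le : ∀ h ∈ J, ∫ x in a..b, 1 / mom V h x ≤ C
  act_le : ∀ h ∈ J, ∫ x in a..b, mom V h x ≤ C * (h - m)
  expand : ∀ h ∈ J, ∀ h' ∈ J, |(∫ x in a..b, mom V h' x) - (∫ x in a..b, mom V h x)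
    - (h' - h) * ∫ x in a..b, 1 / mom V h x| ≤ C * (h' - h) ^ 2 / (h' - m)

theorem IsSlope.integral_mom_le (hS : IsSlope V a b C) (hV : ContDiff ℝ 2 V) {h : ℝ}
    (h1 : V a < h) (h2 : h ≤ V b) : ∫ x in a..b, mom V h x ≤ √(2 * C) * (h - V a) := by
  obtain ⟨r, hr, hrh, hlt, hge⟩ := hS.exists_turning hV h1 h2
  have he : 0 < h - V a := by linarith
  have hmc := continuous_mom hV.continuous h
  rw [integral_eq_integral_Ioo_of_zero hr.1 hr.2 fun x hx => mom_eq_zero (hge x hx),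
    ← integral_Ioc_eq_integral_Ioo, ← intervalIntegral.integral_of_le hr.1.le]
  have hb : ∫ x in a..r, mom V h x ≤ √(2 * (h - V a)) * (r - a) := by
    have := intervalIntegral.integral_mono_on (μ := volume) hr.1.le (hmc.intervalIntegrable a r)
      (intervalIntegrable_const (c := √(2 * (h - V a)))) fun x hx => by
        apply Real.sqrt_le_sqrt
        have := hS.sub_nonneg hV ⟨hx.1, hx.2.trans hr.2⟩
        linarith
    rw [intervalIntegral.integral_const, smul_eq_mul] at this
    linarith
  refine hb.trans ?_
  have hq := hS.quad r hr
  rw [hrh] at hq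
  calc √(2 * (h - V a)) * (r - a) ≤ √(2 * (h - V a)) * √(C * (h - V a)) := by
        gcongr; exact Real.le_sqrt_of_sq_le hq
    _ = √(2 * C * (h - V a) ^ 2) := by rw [← Real.sqrt_mul (by linarith)]; ring_nf
    _ = √(2 * C) * (h - V a) := by
        rw [Real.sqrt_mul (by have := hS.nonneg; linarith), Real.sqrt_sq he.le]

theorem IsSlope.integral_inv_mom_le (hS : IsSlope V a b C) (hV : ContDiff ℝ 2 V) {h : ℝ}
    (h1 : V a < h) (h2 : h ≤ V b) :
    ∫ x in a..b, 1 / mom V h x ≤ (3 / 2 + C) * √(2 * C) := by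
  have he : 0 < h - V a := by linarith
  obtain ⟨-, hQ, -⟩ := hS.identities hV h1 h2
  have hmc := continuous_mom hV.continuous h
  have hw : ∀ x ∈ Ioc a b, |1 / 2 + slopeWeight V a x| ≤ 3 / 2 + C := fun x hx => by
    have := hS.abs_weight_le hV hx
    calc _ ≤ |(1 : ℝ) / 2| + |slopeWeight V a x| := abs_add_le _ _
      _ ≤ _ := by rw [abs_of_pos (by norm_num : (0 : ℝ) < 1 / 2)]; linarith
  have h3 : ∫ x in a..b, (1 / 2 + slopeWeight V a x) * mom V h x
      ≤ (3 / 2 + C) * ∫ x in a..b, mom V h x := by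
    rw [← intervalIntegral.integral_const_mul]
    rw [intervalIntegral.integral_of_le hS.lt.le, intervalIntegral.integral_of_le hS.lt.le]
    refine setIntegral_mono_on (integrableOn_weight_mul
      ((measurable_slopeWeight hV a).const_add _) hmc hw)
      ((hmc.integrableOn_Ioc).const_mul _) measurableSet_Ioc fun x hx => ?_
    exact mul_le_mul_of_nonneg_right ((le_abs_self _).trans (hw x hx)) (mom_nonneg _ _ _)
  have h4 := hS.integral_mom_le hV h1 h2
  have h5 : (h - V a) * ∫ x in a..b, 1 / mom V h x
      ≤ (h - V a) * ((3 / 2 + C) * √(2 * C)) := by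
    have := hS.nonneg
    calc _ ≤ (3 / 2 + C) * (√(2 * C) * (h - V a)) := by
          rw [hQ]; refine h3.trans ?_; gcongr
      _ = _ := by ring
  exact le_of_mul_le_mul_left h5 he

theorem IsSlope.hasActionExpansion (hS : IsSlope V a b C) (hV : ContDiff ℝ 2 V) :
    ∃ C', HasActionExpansion V a b (Ioc (V a) (V b)) (V a) C' := by
  have hC := hS.nonneg
  set W := 1 / 2 + (1 + C) / 3 with hW
  set B := (3 / 2 + C) * √(2 * C) with hB
  have hW0 : 0 ≤ W := by positivity
  have hB0 : 0 ≤ B := by positivity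
  have hCB : 0 ≤ 12 * W * B + B := by positivity
  refine ⟨12 * W * B + B + √(2 * C), fun h hh => (hS.identities hV hh.1 hh.2).1, fun h hh => ?_,
    fun h hh => ?_, fun h hh h' hh' => ?_⟩
  · refine (hS.integral_inv_mom_le hV hh.1 hh.2).trans ?_
    have : 0 ≤ 12 * W * B := by positivity
    have := Real.sqrt_nonneg (2 * C)
    linarith
  · refine (hS.integral_mom_le hV hh.1 hh.2).trans ?_
    have := hh.1
    gcongr
    linarith
  · obtain ⟨hi, hQ, hP⟩ := hS.identities hV hh.1 hh.2
    obtain ⟨hi', hQ', hP'⟩ := hS.identities hV hh'.1 hh'.2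
    have hQB := hS.integral_inv_mom_le hV hh.1 hh.2
    have hQB' := hS.integral_inv_mom_le hV hh'.1 hh'.2
    have hmc := continuous_mom hV.continuous h
    have hmc' := continuous_mom hV.continuous h'
    have he' : 0 < h' - V a := by linarith [hh'.1]
    have hw : ∀ x ∈ Ioc a b, |1 / 2 + slopeWeight V a x / 3| ≤ W := fun x hx => by
      have := hS.abs_weight_le hV hx
      calc _ ≤ |(1 : ℝ) / 2| + |slopeWeight V a x / 3| := abs_add_le _ _
        _ ≤ _ := by
          rw [abs_of_pos (by norm_num : (0 : ℝ) < 1 / 2), abs_div,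
            abs_of_pos (by norm_num : (0 : ℝ) < 3)]
          linarith
    have hw2 : ∀ x ∈ Ioc a b, |1 / 2 + slopeWeight V a x| ≤ 3 / 2 + C := fun x hx => by
      have := hS.abs_weight_le hV hx
      calc _ ≤ |(1 : ℝ) / 2| + |slopeWeight V a x| := abs_add_le _ _
        _ ≤ _ := by rw [abs_of_pos (by norm_num : (0 : ℝ) < 1 / 2)]; linarith
    have mw : Measurable fun x => 1 / 2 + slopeWeight V a x / 3 :=
      ((measurable_slopeWeight hV a).div_const _).const_add _
    have ii := fun (f : ℝ → ℝ) (hf : Continuous f) =>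
      (intervalIntegrable_iff_integrableOn_Ioc_of_le hS.lt.le).2 (integrableOn_weight_mul mw hf hw)
    have ii2 := (intervalIntegrable_iff_integrableOn_Ioc_of_le hS.lt.le).2
      (integrableOn_weight_mul ((measurable_slopeWeight hV a).const_add (1 / 2)) hmc hw2)
    set P := ∫ x in a..b, mom V h x
    set P' := ∫ x in a..b, mom V h' x
    set Q := ∫ x in a..b, 1 / mom V h x
    set Q' := ∫ x in a..b, 1 / mom V h' x
    have hD : (h' - V a) * P' - (h - V a) * P - (h' - h) * (P + (h - V a) * Q)
        = ∫ x in a..b, (1 / 2 + slopeWeight V a x / 3) *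
          (mom V h' x ^ 3 - mom V h x ^ 3 - 3 * (h' - h) * mom V h x) := by
      have : P + (h - V a) * Q
          = ∫ x in a..b, (1 / 2 + slopeWeight V a x / 3) * (3 * mom V h x) := by
        rw [hQ, ← intervalIntegral.integral_add (hmc.intervalIntegrable _ _) ii2]
        congr 1; ext x; ring
      rw [this, hP, hP', ← intervalIntegral.integral_const_mul,
        ← intervalIntegral.integral_sub (ii (fun x => mom V h' x ^ 3) (hmc'.pow 3)) (ii (fun x => mom V h x ^ 3) (hmc.pow 3)),
        ← intervalIntegral.integral_sub ((ii (fun x => mom V h' x ^ 3) (hmc'.pow 3)).sub (ii (fun x => mom V h x ^ 3) (hmc.pow 3)))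
          ((ii _ (hmc.const_mul 3)).const_mul _)]
      congr 1; ext x; ring
    have hDb : |(h' - V a) * P' - (h - V a) * P - (h' - h) * (P + (h - V a) * Q)|
        ≤ 12 * W * B * (h' - h) ^ 2 := by
      rw [hD, ← Real.norm_eq_abs]
      have := intervalIntegral.norm_integral_le_of_norm_le (μ := volume) hS.lt.le
        (f := fun x => (1 / 2 + slopeWeight V a x / 3) *
          (mom V h' x ^ 3 - mom V h x ^ 3 - 3 * (h' - h) * mom V h x))
        (g := fun x => 6 * W * (h' - h) ^ 2 * (1 / mom V h x + 1 / mom V h' x))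
        (ae_of_all _ fun x hx => ?_) ((hi.add hi').const_mul _)
      · refine this.trans ?_
        rw [intervalIntegral.integral_const_mul, intervalIntegral.integral_add hi hi']
        calc 6 * W * (h' - h) ^ 2 * (Q + Q') ≤ 6 * W * (h' - h) ^ 2 * (B + B) := by gcongr
          _ = _ := by ring
      · rw [norm_mul, Real.norm_eq_abs, Real.norm_eq_abs]
        have h3 := abs_cube_sub_le (u := 2 * (h - V x)) (v := 2 * (h' - V x))
        have h4 : |mom V h' x ^ 3 - mom V h x ^ 3 - 3 * (h' - h) * mom V h x|
            ≤ 6 * (h' - h) ^ 2 * (1 / mom V h x + 1 / mom V h' x) := by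
          unfold mom
          convert h3 using 2 <;> ring
        calc _ ≤ W * (6 * (h' - h) ^ 2 * (1 / mom V h x + 1 / mom V h' x)) :=
              mul_le_mul (hw x hx) h4 (abs_nonneg _) hW0
          _ = _ := by ring
    have hQ0 : 0 ≤ Q := intervalIntegral.integral_nonneg hS.lt.le fun x _ =>
      one_div_nonneg.2 (mom_nonneg _ _ _)
    rw [le_div_iff₀ he', ← abs_of_pos he', ← abs_mul]
    have hid : (P' - P - (h' - h) * Q) * (h' - V a)
        = ((h' - V a) * P' - (h - V a) * P - (h' - h) * (P + (h - V a) * Q))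
          - (h' - h) ^ 2 * Q := by ring
    rw [hid]
    calc _ ≤ 12 * W * B * (h' - h) ^ 2 + (h' - h) ^ 2 * Q := by
          refine (abs_sub _ _).trans (add_le_add hDb ?_)
          rw [abs_of_nonneg (by positivity)]
      _ ≤ 12 * W * B * (h' - h) ^ 2 + (h' - h) ^ 2 * B := by gcongr
      _ ≤ _ := by
          have : 0 ≤ √(2 * C) * (h' - h) ^ 2 := by positivity
          nlinarith

end ImpactSystem

namespace ImpactSystem

open MeasureTheory

variable {V : ℝ → ℝ} {a b C : ℝ}

theorem HasActionExpansion.mono {J J' : Set ℝ} {m : ℝ} (h : HasActionExpansion V a b J m C)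
    (hJ : J' ⊆ J) : HasActionExpansion V a b J' m C :=
  ⟨fun x hx => h.1 x (hJ hx), fun x hx => h.2 x (hJ hx), fun x hx => h.3 x (hJ hx),
    fun x hx y hy => h.4 x (hJ hx) y (hJ hy)⟩

theorem HasActionExpansion.concat {J : Set ℝ} {m c C' : ℝ} (hV : Continuous V)
    (h₁ : HasActionExpansion V a b J m C) (h₂ : HasActionExpansion V b c J m C') :
    HasActionExpansion V a c J m (C + C') := by
  have e1 : ∀ h, ∫ x in a..c, mom V h x = (∫ x in a..b, mom V h x) + ∫ x in b..c, mom V h x :=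
    fun h => (intervalIntegral.integral_add_adjacent_intervals
      ((continuous_mom hV h).intervalIntegrable _ _)
      ((continuous_mom hV h).intervalIntegrable _ _)).symm
  have e2 : ∀ h ∈ J, ∫ x in a..c, 1 / mom V h x
      = (∫ x in a..b, 1 / mom V h x) + ∫ x in b..c, 1 / mom V h x :=
    fun h hh => (intervalIntegral.integral_add_adjacent_intervals
      (h₁.integrable h hh) (h₂.integrable h hh)).symm
  refine ⟨fun h hh => (h₁.integrable h hh).trans (h₂.integrable h hh), fun h hh => ?_,
    fun h hh => ?_, fun h hh h' hh' => ?_⟩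
  · rw [e2 h hh]; exact add_le_add (h₁.inv_le h hh) (h₂.inv_le h hh)
  · rw [e1, add_mul]; exact add_le_add (h₁.act_le h hh) (h₂.act_le h hh)
  · rw [e1, e1, e2 h hh]
    have := (abs_add_le _ _).trans (add_le_add (h₁.expand h hh h' hh') (h₂.expand h hh h' hh'))
    rw [add_mul C, add_div]
    refine le_trans (le_of_eq ?_) this
    congr 1; ring

theorem HasActionExpansion.reflect {J : Set ℝ} {m : ℝ}
    (h : HasActionExpansion (fun x => V (-x)) (-b) (-a) J m C) :
    HasActionExpansion V a b J m C := by
  have e1 : ∀ h, ∫ x in a..b, mom V h x = ∫ x in (-b)..(-a), mom (fun x => V (-x)) h x := by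
    intro h
    rw [← intervalIntegral.integral_comp_neg]; simp only [mom, neg_neg]
  have e2 : ∀ h, ∫ x in a..b, 1 / mom V h x
      = ∫ x in (-b)..(-a), 1 / mom (fun x => V (-x)) h x := by
    intro h
    rw [← intervalIntegral.integral_comp_neg]; simp only [mom, neg_neg]
  refine ⟨fun x hx => ?_, fun x hx => ?_, fun x hx => ?_, fun x hx y hy => ?_⟩
  · rw [IntervalIntegrable.iff_comp_neg]; exact (h.integrable x hx).symm
  · rw [e2]; exact h.inv_le x hx
  · rw [e1]; exact h.act_le x hx
  · rw [e1, e1, e2]; exact h.expand x hx y hy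

theorem HasActionExpansion.change_bottom {J : Set ℝ} {m m' c D : ℝ} (hab : a ≤ b) (hc : 0 < c)
    (h : HasActionExpansion V a b J m C) (hm : ∀ x ∈ J, x - m ∈ Icc c D)
    (hm' : ∀ x ∈ J, x - m' ∈ Icc c D) : ∃ C', HasActionExpansion V a b J m' C' := by
  rcases J.eq_empty_or_nonempty with rfl | ⟨x₀, hx₀⟩
  · exact ⟨0, by constructor <;> simp⟩
  have hC : 0 ≤ C := by
    refine le_trans ?_ (h.inv_le x₀ hx₀)
    exact intervalIntegral.integral_nonneg hab fun x _ => one_div_nonneg.2 (mom_nonneg _ _ _)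
  have hD : 0 < D := hc.trans_le ((hm x₀ hx₀).1.trans (hm x₀ hx₀).2)
  have hcD : 1 ≤ D / c := by
    rw [one_le_div hc]; exact (hm x₀ hx₀).1.trans (hm x₀ hx₀).2
  refine ⟨C * (D / c), h.1, fun x hx => (h.2 x hx).trans ?_, fun x hx => (h.3 x hx).trans ?_,
    fun x hx y hy => (h.4 x hx y hy).trans ?_⟩
  · exact le_mul_of_one_le_right hC hcD
  · rw [mul_assoc]
    gcongr
    calc x - m ≤ D := (hm x hx).2
      _ = D / c * c := by field_simp
      _ ≤ _ := by gcongr; exact (hm' x hx).1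
  · have h1 := hm y hy
    have h2 := hm' y hy
    have h3 : 0 < y - m := hc.trans_le h1.1
    have h4 : 0 < y - m' := hc.trans_le h2.1
    rw [div_le_div_iff₀ h3 h4]
    have h5 : y - m' ≤ D / c * (y - m) := calc
      y - m' ≤ D := h2.2
      _ = D / c * c := by field_simp
      _ ≤ _ := by gcongr; exact h1.1
    calc C * (y - x) ^ 2 * (y - m') ≤ C * (y - x) ^ 2 * (D / c * (y - m)) := by gcongr
      _ = _ := by ring

theorem abs_sqrt_sub_le {u v k : ℝ} (hk : 0 < k) (hu : k ^ 2 ≤ u) (hv : k ^ 2 ≤ v) :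
    |√v - √u - (v - u) / 2 * (1 / √u)| ≤ (v - u) ^ 2 / (8 * k ^ 3) := by
  have h1 : k ≤ √u := Real.le_sqrt_of_sq_le hu
  have h2 : k ≤ √v := Real.le_sqrt_of_sq_le hv
  have hu' := Real.sq_sqrt ((sq_nonneg k).trans hu)
  have hv' := Real.sq_sqrt ((sq_nonneg k).trans hv)
  set s := √u
  set t := √v
  have hs : 0 < s := hk.trans_le h1
  rw [← hu', ← hv']
  have h3 : t - s - (t ^ 2 - s ^ 2) / 2 * (1 / s) = -((t - s) ^ 2 / (2 * s)) := by
    field_simp; ring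
  rw [h3, abs_neg, abs_of_nonneg (by positivity), div_le_div_iff₀ (by positivity) (by positivity)]
  have h4 : 8 * k ^ 3 ≤ (t + s) ^ 2 * (2 * s) := by
    have : (2 * k) ^ 2 * (2 * k) ≤ (t + s) ^ 2 * (2 * s) := by gcongr; linarith
    linarith
  calc (t - s) ^ 2 * (8 * k ^ 3) ≤ (t - s) ^ 2 * ((t + s) ^ 2 * (2 * s)) := by gcongr
    _ = _ := by ring

theorem hasActionExpansion_of_lt {J : Set ℝ} {m c D : ℝ} (hV : Continuous V) (hab : a ≤ b)
    (hc : 0 < c) (hJ : ∀ h ∈ J, ∀ x ∈ Icc a b, c ≤ h - V x) (hm : ∀ h ∈ J, h - m ∈ Icc c D) :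
    ∃ C, HasActionExpansion V a b J m C := by
  rcases J.eq_empty_or_nonempty with rfl | ⟨x₀, hx₀⟩
  · exact ⟨0, by constructor <;> simp⟩
  obtain ⟨M, hM⟩ := (isCompact_Icc (a := a) (b := b)).exists_bound_of_continuousOn hV.continuousOn
  have hD : 0 < D := hc.trans_le ((hm x₀ hx₀).1.trans (hm x₀ hx₀).2)
  have hM0 : 0 ≤ M := (norm_nonneg _).trans (hM a (left_mem_Icc.2 hab))
  set k := √(2 * c)
  have hk : 0 < k := Real.sqrt_pos.2 (by linarith)
  have hk2 : k ^ 2 = 2 * c := Real.sq_sqrt (by linarith)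
  have hmk : ∀ h ∈ J, ∀ x ∈ Icc a b, k ≤ mom V h x := fun h hh x hx =>
    Real.sqrt_le_sqrt (by linarith [hJ h hh x hx])
  have hint : ∀ h ∈ J, IntervalIntegrable (fun x => 1 / mom V h x) volume a b := by
    intro h hh
    apply ContinuousOn.intervalIntegrable
    rw [uIcc_of_le hab]
    exact continuousOn_const.div (continuous_mom hV h).continuousOn fun x hx =>
      (hk.trans_le (hmk h hh x hx)).ne'
  have hlen : 0 ≤ b - a := by linarith
  set S := √(2 * (D + |m| + M)) with hS
  refine ⟨1 / k * (b - a) + S * (b - a) / c + D * (4 / (8 * k ^ 3)) * (b - a), hint,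
    fun h hh => ?_, fun h hh => ?_, fun h hh h' hh' => ?_⟩
  · have := intervalIntegral.norm_integral_le_of_norm_le_const (a := a) (b := b) (C := 1 / k)
      (f := fun x => 1 / mom V h x) fun x hx => by
        rw [uIoc_of_le hab] at hx
        have := hmk h hh x (Ioc_subset_Icc_self hx)
        rw [Real.norm_of_nonneg (one_div_nonneg.2 (hk.le.trans this))]
        exact one_div_le_one_div_of_le hk this
    rw [abs_of_nonneg hlen] at this
    have h1 := (le_abs_self _).trans this
    have h2 : 0 ≤ S * (b - a) / c + D * (4 / (8 * k ^ 3)) * (b - a) := by positivity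
    linarith
  · have := intervalIntegral.norm_integral_le_of_norm_le_const (a := a) (b := b) (C := S)
      (f := fun x => mom V h x) fun x hx => by
        rw [uIoc_of_le hab] at hx
        rw [Real.norm_of_nonneg (mom_nonneg _ _ _)]
        apply Real.sqrt_le_sqrt
        have h1 := hM x (Ioc_subset_Icc_self hx)
        rw [Real.norm_eq_abs] at h1
        have h2 := (abs_le.1 h1).1
        have h3 := (hm h hh).2
        have h4 := le_abs_self m
        linarith
    rw [abs_of_nonneg hlen] at this
    have h1 := (le_abs_self _).trans this
    have h2 := (hm h hh).1
    have h3 : S * (b - a) ≤ S * (b - a) / c * (h - m) := by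
      calc S * (b - a) = S * (b - a) / c * c := by field_simp
        _ ≤ _ := by gcongr
    have h4 : 0 ≤ h - m := hc.le.trans h2
    have h5 : 0 ≤ (1 / k * (b - a) + D * (4 / (8 * k ^ 3)) * (b - a)) * (h - m) := by positivity
    linarith
  · have hmc := continuous_mom hV h
    have hmc' := continuous_mom hV h'
    rw [← intervalIntegral.integral_const_mul, ← intervalIntegral.integral_sub
      (hmc'.intervalIntegrable _ _) (hmc.intervalIntegrable _ _), ← intervalIntegral.integral_sub
      ((hmc'.intervalIntegrable _ _).sub (hmc.intervalIntegrable _ _)) ((hint h hh).const_mul _)]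
    have := intervalIntegral.norm_integral_le_of_norm_le_const (a := a) (b := b)
      (C := (4 / (8 * k ^ 3)) * (h' - h) ^ 2)
      (f := fun x => mom V h' x - mom V h x - (h' - h) * (1 / mom V h x)) fun x hx => by
        rw [uIoc_of_le hab] at hx
        have h1 := abs_sqrt_sub_le (u := 2 * (h - V x)) (v := 2 * (h' - V x)) hk
          (by linarith [hJ h hh x (Ioc_subset_Icc_self hx)])
          (by linarith [hJ h' hh' x (Ioc_subset_Icc_self hx)])
        rw [Real.norm_eq_abs]
        unfold mom
        convert h1 using 2 <;> ring
    rw [abs_of_nonneg hlen] at this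
    refine this.trans ?_
    have h2 := hm h' hh'
    have h0 : 0 < h' - m := hc.trans_le h2.1
    rw [le_div_iff₀ h0]
    calc 4 / (8 * k ^ 3) * (h' - h) ^ 2 * (b - a) * (h' - m)
        ≤ 4 / (8 * k ^ 3) * (h' - h) ^ 2 * (b - a) * D := by gcongr; exact h2.2
      _ = D * (4 / (8 * k ^ 3)) * (b - a) * (h' - h) ^ 2 := by ring
      _ ≤ _ := by
        have : 0 ≤ (1 / k * (b - a) + S * (b - a) / c) * (h' - h) ^ 2 := by positivity
        linarith

/-! ### Slopes at regular points and at well bottoms -/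

theorem isSlope_of_deriv_pos (hV : ContDiff ℝ 2 V) (hab : a < b)
    (hpos : ∀ x ∈ Icc a b, 0 < deriv V x) : ∃ C, IsSlope V a b C := by
  have hc1 : ContinuousOn (deriv V) (Icc a b) := (contDiff_deriv hV).continuous.continuousOn
  have hc2 : ContinuousOn (deriv (deriv V)) (Icc a b) :=
    ((contDiff_deriv hV).continuous_deriv le_rfl).continuousOn
  obtain ⟨M₁, hM₁⟩ := isCompact_Icc.exists_bound_of_continuousOn hc1
  obtain ⟨M₂, hM₂⟩ := isCompact_Icc.exists_bound_of_continuousOn hc2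
  obtain ⟨z, hz, hmin⟩ := isCompact_Icc.exists_isMinOn (nonempty_Icc.2 hab.le) hc1
  set μ := deriv V z
  have hμ : 0 < μ := hpos z hz
  have hM₁0 : 0 ≤ M₁ := (norm_nonneg _).trans (hM₁ z hz)
  have hM₂0 : 0 ≤ M₂ := (norm_nonneg _).trans (hM₂ z hz)
  have hlen : 0 < b - a := by linarith
  have hmv : ∀ x ∈ Ioc a b, μ * (x - a) ≤ V x - V a ∧ V x - V a ≤ M₁ * (x - a) := by
    intro x hx
    obtain ⟨ξ, hξ, he⟩ := exists_deriv_eq_slope V hx.1 hV.continuous.continuousOn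
      (hV.differentiable (by norm_num)).differentiableOn
    have hξ' : ξ ∈ Icc a b := ⟨hξ.1.le, hξ.2.le.trans hx.2⟩
    have hxa : 0 < x - a := by linarith [hx.1]
    have : V x - V a = deriv V ξ * (x - a) := by rw [he]; field_simp
    rw [this]
    exact ⟨mul_le_mul_of_nonneg_right (hmin hξ') hxa.le,
      mul_le_mul_of_nonneg_right ((le_abs_self _).trans (hM₁ ξ hξ')) hxa.le⟩
  set C₁ := M₂ * (M₁ * (b - a)) / μ ^ 2
  set C₂ := M₁ / μ
  set C₃ := (b - a) / μ
  have h1 : 0 ≤ C₁ := by positivity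
  have h2 : 0 ≤ C₂ := by positivity
  have h3 : 0 ≤ C₃ := by positivity
  refine ⟨C₁ + C₂ + C₃, hab, by positivity, fun x hx => hpos x (Ioc_subset_Icc_self hx),
    fun x hx => ?_, fun x hx => ?_, fun x hx => ?_⟩
  · have hd := hmin (Ioc_subset_Icc_self hx)
    have hxa : 0 < x - a := by linarith [hx.1]
    calc |deriv (deriv V) x| * (V x - V a) ≤ M₂ * (M₁ * (b - a)) := by
          gcongr
          · have := (hmv x hx).1; nlinarith
          · exact hM₂ x (Ioc_subset_Icc_self hx)
          · refine (hmv x hx).2.trans ?_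
            gcongr; exact hx.2
      _ = C₁ * μ ^ 2 := by simp only [C₁]; field_simp
      _ ≤ (C₁ + C₂ + C₃) * deriv V x ^ 2 := by gcongr; · linarith
                                               · exact hd
  · have hd := hmin (Ioc_subset_Icc_self hx)
    have hxa : 0 < x - a := by linarith [hx.1]
    calc V x - V a ≤ M₁ * (x - a) := (hmv x hx).2
      _ = C₂ * μ * (x - a) := by simp only [C₂]; field_simp
      _ ≤ _ := by gcongr; · linarith
                  · exact hd
  · have hxa : 0 < x - a := by linarith [hx.1]
    have hxb : x - a ≤ b - a := by linarith [hx.2]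
    calc (x - a) ^ 2 ≤ (b - a) * (x - a) := by nlinarith
      _ = C₃ * (μ * (x - a)) := by simp only [C₃]; field_simp
      _ ≤ C₃ * (V x - V a) := by gcongr; exact (hmv x hx).1
      _ ≤ _ := by
        have : 0 ≤ V x - V a := le_trans (by positivity) (hmv x hx).1
        gcongr; linarith

theorem isSlope_of_center (hV : ContDiff ℝ 2 V) (hab : a < b) (ha : deriv V a = 0)
    (hpos : ∀ x ∈ Icc a b, 0 < deriv (deriv V) x) : ∃ C, IsSlope V a b C := by
  have hd1 := contDiff_deriv hV
  have hc2 : ContinuousOn (deriv (deriv V)) (Icc a b) := (hd1.continuous_deriv le_rfl).continuousOn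
  obtain ⟨β, hβ⟩ := isCompact_Icc.exists_bound_of_continuousOn hc2
  obtain ⟨z, hz, hmin⟩ := isCompact_Icc.exists_isMinOn (nonempty_Icc.2 hab.le) hc2
  set α := deriv (deriv V) z
  have hα : 0 < α := hpos z hz
  have hβ0 : 0 ≤ β := (norm_nonneg _).trans (hβ z hz)
  have hmv : ∀ x ∈ Ioc a b, ∀ y ∈ Ico a x, α * (x - y) ≤ deriv V x - deriv V y := by
    intro x hx y hy
    obtain ⟨ξ, hξ, he⟩ := exists_deriv_eq_slope (deriv V) hy.2 hd1.continuous.continuousOn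
      (hd1.differentiable (by norm_num)).differentiableOn
    have hξ' : ξ ∈ Icc a b := ⟨hy.1.trans hξ.1.le, hξ.2.le.trans hx.2⟩
    have hxa : 0 < x - y := by linarith [hy.2]
    have : deriv V x - deriv V y = deriv (deriv V) ξ * (x - y) := by rw [he]; field_simp
    rw [this]
    exact mul_le_mul_of_nonneg_right (hmin hξ') hxa.le
  have hlow : ∀ x ∈ Ioc a b, α * (x - a) ≤ deriv V x := fun x hx => by
    have := hmv x hx a ⟨le_rfl, hx.1⟩
    rwa [ha, sub_zero] at this
  have hup : ∀ x ∈ Ioc a b, V x - V a ≤ deriv V x * (x - a) := by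
    intro x hx
    obtain ⟨ξ, hξ, he⟩ := exists_deriv_eq_slope V hx.1 hV.continuous.continuousOn
      (hV.differentiable (by norm_num)).differentiableOn
    have hxa : 0 < x - a := by linarith [hx.1]
    have h1 : V x - V a = deriv V ξ * (x - a) := by rw [he]; field_simp
    have h2 := hmv x hx ξ ⟨hξ.1.le, hξ.2⟩
    have h3 : 0 ≤ α * (x - ξ) := mul_nonneg hα.le (by linarith [hξ.2])
    rw [h1]; gcongr; linarith
  have hquad : ∀ x ∈ Ioc a b, α / 2 * (x - a) ^ 2 ≤ V x - V a := by
    intro x hx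
    have hmono : MonotoneOn (fun y => V y - α / 2 * (y - a) ^ 2) (Icc a b) := by
      have hder : ∀ y, HasDerivAt (fun y => V y - α / 2 * (y - a) ^ 2)
          (deriv V y - α * (y - a)) y := by
        intro y
        have h1 := ((((hasDerivAt_id y).sub_const a).pow 2).const_mul (α / 2))
        convert! (hasDerivAt_potential hV y).sub h1 using 1
        simp; ring
      refine monotoneOn_of_deriv_nonneg (convex_Icc a b)
        (fun y _ => (hder y).continuousAt.continuousWithinAt)
        (fun y _ => (hder y).differentiableAt.differentiableWithinAt) fun y hy => ?_
      rw [interior_Icc] at hy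
      rw [(hder y).deriv]
      linarith [hlow y (Ioo_subset_Ioc_self hy)]
    have := hmono (left_mem_Icc.2 hab.le) (Ioc_subset_Icc_self hx) hx.1.le
    simp only [sub_self] at this
    linarith
  have h1 : 0 ≤ β / α := by positivity
  have h2 : 0 ≤ 2 / α := by positivity
  refine ⟨β / α + 1 + 2 / α, hab, by positivity, fun x hx => ?_, fun x hx => ?_, fun x hx => ?_,
    fun x hx => ?_⟩
  · have : 0 < α * (x - a) := mul_pos hα (by linarith [hx.1])
    exact this.trans_le (hlow x hx)
  · have hxa : 0 < x - a := by linarith [hx.1]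
    have hd : 0 ≤ deriv V x := le_trans (by positivity) (hlow x hx)
    have hV0 : 0 ≤ V x - V a := le_trans (by positivity) (hquad x hx)
    calc |deriv (deriv V) x| * (V x - V a) ≤ β * (deriv V x * (x - a)) := by
          gcongr
          · exact hβ x (Ioc_subset_Icc_self hx)
          · exact hup x hx
      _ = β / α * (deriv V x * (α * (x - a))) := by field_simp
      _ ≤ β / α * (deriv V x * deriv V x) := by gcongr; exact hlow x hx
      _ ≤ _ := by rw [sq]; gcongr; linarith
  · have hxa : 0 < x - a := by linarith [hx.1]
    have hd : 0 ≤ deriv V x := le_trans (by positivity) (hlow x hx)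
    calc V x - V a ≤ 1 * deriv V x * (x - a) := by rw [one_mul]; exact hup x hx
      _ ≤ _ := by gcongr; linarith
  · have hV0 : 0 ≤ V x - V a := le_trans (by positivity) (hquad x hx)
    calc (x - a) ^ 2 = 2 / α * (α / 2 * (x - a) ^ 2) := by field_simp
      _ ≤ 2 / α * (V x - V a) := by gcongr; exact hquad x hx
      _ ≤ _ := by gcongr; linarith

end ImpactSystem

namespace ImpactSystem

open MeasureTheory

/-! ### Leaves over an interval -/

/-- `[l, r]` is a connected component of `{V ≤ h}`. -/
structure IsLeaf (V : ℝ → ℝ) (h l r : ℝ) : Prop where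
  le : l ≤ r
  below : ∀ x ∈ Icc l r, V x ≤ h
  right : ∀ y > r, ∃ x ∈ Ioc r y, h < V x
  left : ∀ y < l, ∃ x ∈ Ico y l, h < V x

/-- All critical points on the level `h` are nondegenerate minima. -/
def IsMinLevel (V : ℝ → ℝ) (h : ℝ) : Prop :=
  ∀ x, V x = h → deriv V x = 0 → 0 < deriv (deriv V) x

variable {V : ℝ → ℝ} {h l r : ℝ}

theorem IsLeaf.reflect (H : IsLeaf V h l r) : IsLeaf (fun x => V (-x)) h (-r) (-l) := by
  refine ⟨neg_le_neg H.le, fun x hx => H.below _ ⟨by linarith [hx.2], by linarith [hx.1]⟩,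
    fun y hy => ?_, fun y hy => ?_⟩
  · obtain ⟨x, hx, hVx⟩ := H.left (-y) (by linarith)
    exact ⟨-x, ⟨by linarith [hx.2], by linarith [hx.1]⟩, by simpa using hVx⟩
  · obtain ⟨x, hx, hVx⟩ := H.right (-y) (by linarith)
    exact ⟨-x, ⟨by linarith [hx.2], by linarith [hx.1]⟩, by simpa using hVx⟩

theorem deriv_reflect (V : ℝ → ℝ) (x : ℝ) : deriv (fun x => V (-x)) x = -deriv V (-x) :=
  deriv_comp_neg V x

theorem deriv_deriv_reflect (V : ℝ → ℝ) (x : ℝ) :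
    deriv (deriv fun x => V (-x)) x = deriv (deriv V) (-x) := by
  have : (deriv fun x => V (-x)) = fun x => -deriv V (-x) := funext (deriv_reflect V)
  rw [this, deriv.fun_neg, deriv_comp_neg, neg_neg]

theorem contDiff_reflect (hV : ContDiff ℝ 2 V) : ContDiff ℝ 2 fun x => V (-x) :=
  hV.comp contDiff_neg

theorem IsMinLevel.reflect (H : IsMinLevel V h) : IsMinLevel (fun x => V (-x)) h := by
  intro x hx hd
  rw [deriv_deriv_reflect]
  rw [deriv_reflect, neg_eq_zero] at hd
  exact H (-x) hx hd

theorem exists_pos_nhds_Icc {f : ℝ → ℝ} (hf : Continuous f) {c : ℝ} (hc : 0 < f c) :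
    ∃ d > 0, ∀ x ∈ Icc (c - d) (c + d), 0 < f x := by
  have : ∀ᶠ x in 𝓝 c, 0 < f x := hf.continuousAt.eventually (lt_mem_nhds hc)
  obtain ⟨d, hd, hb⟩ := Metric.eventually_nhds_iff_ball.1 this
  refine ⟨d / 2, half_pos hd, fun x hx => hb x ?_⟩
  rw [Metric.mem_ball, Real.dist_eq, abs_lt]
  constructor <;> linarith [hx.1, hx.2]

theorem le_of_mem_well {a x : ℝ} (hx : x ∈ well V h a) : V x ≤ h :=
  connectedComponentIn_subset {x | V x ≤ h} a hx

theorem IsLeaf.eq_of_preconnected (H : IsLeaf V h l r) {s : Set ℝ} (hs : IsPreconnected s)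
    (hsV : ∀ x ∈ s, V x ≤ h) {a : ℝ} (ha : a ∈ Icc l r) (has : a ∈ s) : s ⊆ Icc l r := by
  intro x hx
  by_contra hxn
  have ho := hs.ordConnected
  rcases lt_or_ge r x with h1 | h1
  · obtain ⟨y, hy, hVy⟩ := H.right x h1
    exact absurd (hsV y (ho.out has hx ⟨ha.2.trans hy.1.le, hy.2⟩)) (not_le.2 hVy)
  · have h2 : x < l := by by_contra h3; exact hxn ⟨not_lt.1 h3, h1⟩
    obtain ⟨y, hy, hVy⟩ := H.left x h2
    exact absurd (hsV y (ho.out hx has ⟨hy.1, hy.2.le.trans ha.1⟩)) (not_le.2 hVy)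

theorem IsLeaf.well_eq (H : IsLeaf V h l r) {a : ℝ} (ha : a ∈ Icc l r) :
    well V h a = Icc l r := by
  have haV : a ∈ {x | V x ≤ h} := H.below a ha
  refine subset_antisymm ?_ ?_
  · exact H.eq_of_preconnected isPreconnected_connectedComponentIn
      (fun x hx => le_of_mem_well hx) ha (mem_connectedComponentIn haV)
  · exact isPreconnected_Icc.subset_connectedComponentIn ha fun x hx => H.below x hx

theorem exists_isLeaf (hV : Continuous V) (hco : Tendsto V (cocompact ℝ) atTop) {a : ℝ}
    (ha : V a ≤ h) : ∃ l r, a ∈ Icc l r ∧ IsLeaf V h l r := by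
  have haV : a ∈ {x | V x ≤ h} := ha
  have hclosed : IsClosed {x | V x ≤ h} := isClosed_le hV continuous_const
  have hcompact : IsCompact {x | V x ≤ h} := by
    have : {x | V x ≤ h}ᶜ ∈ cocompact ℝ := by
      filter_upwards [hco.eventually_gt_atTop h] with x hx
      simpa using hx
    obtain ⟨t, ht, hts⟩ := mem_cocompact.1 this
    exact ht.of_isClosed_subset hclosed (compl_subset_compl.1 hts)
  set s := well V h a with hs
  have hsc : IsClosed s := by
    refine isClosed_of_closure_subset ?_
    refine isPreconnected_connectedComponentIn.closure.subset_connectedComponentIn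
      (subset_closure (mem_connectedComponentIn haV)) ?_
    exact closure_minimal (connectedComponentIn_subset _ _) hclosed
  have hsk : IsCompact s := hcompact.of_isClosed_subset hsc (connectedComponentIn_subset _ _)
  have hconn : IsConnected s := isConnected_connectedComponentIn_iff.2 haV
  have hIcc := eq_Icc_of_connected_compact hconn hsk
  have has : a ∈ s := mem_connectedComponentIn haV
  set l := sInf s
  set r := sSup s
  have hal : a ∈ Icc l r := hIcc ▸ has
  have hsV : ∀ x ∈ Icc l r, V x ≤ h := fun x hx =>
    le_of_mem_well (show x ∈ s by rw [hIcc]; exact hx)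
  refine ⟨l, r, hal, hal.1.trans hal.2, hsV, fun y hy => ?_, fun y hy => ?_⟩
  · by_contra hcon
    push Not at hcon
    have hsub : Icc l y ⊆ s := isPreconnected_Icc.subset_connectedComponentIn
      ⟨hal.1, hal.2.trans hy.le⟩ fun x hx => by
        rcases le_or_gt x r with h1 | h1
        · exact hsV x ⟨hx.1, h1⟩
        · exact hcon x ⟨h1, hx.2⟩
    have : y ∈ Icc l r := hIcc ▸ hsub ⟨(hal.1.trans hal.2).trans hy.le, le_rfl⟩
    exact absurd this.2 (not_le.2 hy)
  · by_contra hcon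
    push Not at hcon
    have hsub : Icc y r ⊆ s := isPreconnected_Icc.subset_connectedComponentIn
      ⟨hy.le.trans hal.1, hal.2⟩ fun x hx => by
        rcases le_or_gt l x with h1 | h1
        · exact hsV x ⟨h1, hx.2⟩
        · exact hcon x ⟨hx.1, h1⟩
    have : y ∈ Icc l r := hIcc ▸ hsub ⟨le_rfl, hy.le.trans (hal.1.trans hal.2)⟩
    exact absurd this.1 (not_le.2 hy)

theorem strictMonoOn_of_center (hV : ContDiff ℝ 2 V) {c b : ℝ} (hcb : c < b)
    (hd : deriv V c = 0) (hpos : ∀ x ∈ Icc c b, 0 < deriv (deriv V) x) :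
    StrictMonoOn V (Icc c b) := by
  obtain ⟨C, hS⟩ := isSlope_of_center hV hcb hd hpos
  exact hS.strictMonoOn hV

theorem strictAntiOn_of_center (hV : ContDiff ℝ 2 V) {c b : ℝ} (hcb : b < c)
    (hd : deriv V c = 0) (hpos : ∀ x ∈ Icc b c, 0 < deriv (deriv V) x) :
    StrictAntiOn V (Icc b c) := by
  have := strictMonoOn_of_center (contDiff_reflect hV) (neg_lt_neg hcb)
    (by rw [deriv_reflect, neg_neg, hd, neg_zero])
    (fun x hx => by
      rw [deriv_deriv_reflect]; exact hpos _ ⟨by linarith [hx.2], by linarith [hx.1]⟩)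
  intro x hx y hy hxy
  have h1 := this (a := -y) ⟨by linarith [hy.2], by linarith [hy.1]⟩ (b := -x)
    ⟨by linarith [hx.2], by linarith [hx.1]⟩ (neg_lt_neg hxy)
  simpa using h1

theorem exists_strict_min (hV : ContDiff ℝ 2 V) {c : ℝ} (hd : deriv V c = 0)
    (hpos : 0 < deriv (deriv V) c) :
    ∃ d > 0, ∀ x ∈ Icc (c - d) (c + d), x ≠ c → V c < V x := by
  obtain ⟨d, hd0, hdp⟩ := exists_pos_nhds_Icc ((contDiff_deriv hV).continuous_deriv le_rfl) hpos
  refine ⟨d, hd0, fun x hx hne => ?_⟩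
  rcases lt_or_gt_of_ne hne with h1 | h1
  · exact strictAntiOn_of_center hV (by linarith) hd
      (fun y hy => hdp y ⟨hy.1, by linarith [hy.2]⟩) ⟨hx.1, h1.le⟩
      (right_mem_Icc.2 (by linarith)) h1
  · exact strictMonoOn_of_center hV (by linarith) hd
      (fun y hy => hdp y ⟨by linarith [hy.1], hy.2⟩)
      (left_mem_Icc.2 (by linarith)) ⟨h1.le, hx.2⟩ h1

theorem IsLeaf.right_end (H : IsLeaf V h l r) (hV : ContDiff ℝ 2 V) (hm : IsMinLevel V h) :
    V r = h ∧ (0 < deriv V r ∨ (deriv V r = 0 ∧ 0 < deriv (deriv V) r ∧ l = r)) := by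
  have hr : V r ≤ h := H.below r (right_mem_Icc.2 H.le)
  have hev : (∀ᶠ x in 𝓝[>] r, V x ≤ h) → False := by
    intro hs
    obtain ⟨u, hu, hus⟩ := mem_nhdsGT_iff_exists_Ioc_subset.1 hs
    obtain ⟨x, hx, hVx⟩ := H.right u hu
    exact absurd (hus hx) (not_le.2 hVx)
  have hrh : V r = h := by
    refine le_antisymm hr (not_lt.1 fun hlt => hev ?_)
    have : ∀ᶠ x in 𝓝 r, V x < h := hV.continuous.continuousAt.eventually_lt continuousAt_const hlt
    exact (this.filter_mono nhdsWithin_le_nhds).mono fun x hx => hx.le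
  refine ⟨hrh, ?_⟩
  rcases lt_trichotomy (deriv V r) 0 with hneg | h0 | hp
  · exfalso
    refine hev ?_
    have : ∀ᶠ x in 𝓝[>] r, slope V r x < 0 :=
      ((hasDerivAt_iff_tendsto_slope.1 (hasDerivAt_potential hV r)).mono_left
        (nhdsWithin_mono _ fun x hx => ne_of_gt hx)).eventually_lt_const hneg
    filter_upwards [this, self_mem_nhdsWithin] with x hx hxr
    rw [slope_def_field, div_neg_iff] at hx
    have : (0 : ℝ) < x - r := sub_pos.2 hxr
    rcases hx with hx | hx <;> linarith
  · right
    have h2 := hm r hrh h0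
    refine ⟨h0, h2, ?_⟩
    obtain ⟨d, hd, hmin⟩ := exists_strict_min hV h0 h2
    by_contra hne
    have hlr : l < r := lt_of_le_of_ne H.le hne
    set x := max l (r - d)
    have hxr : x < r := max_lt hlr (by linarith)
    have := hmin x ⟨le_max_right _ _, by linarith⟩ hxr.ne
    have := H.below x ⟨le_max_left _ _, hxr.le⟩
    linarith
  · exact Or.inl hp

theorem IsLeaf.left_end (H : IsLeaf V h l r) (hV : ContDiff ℝ 2 V) (hm : IsMinLevel V h) :
    V l = h ∧ (deriv V l < 0 ∨ (deriv V l = 0 ∧ 0 < deriv (deriv V) l ∧ l = r)) := by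
  have := H.reflect.right_end (contDiff_reflect hV) hm.reflect
  simp only [deriv_reflect, deriv_deriv_reflect, neg_neg] at this
  obtain ⟨h1, h2⟩ := this
  refine ⟨h1, ?_⟩
  rcases h2 with h2 | ⟨h2, h3, h4⟩
  · left; linarith
  · right; exact ⟨by linarith, h3, by linarith⟩

theorem IsLeaf.lt_of_mem (H : IsLeaf V h l r) (hV : ContDiff ℝ 2 V) (hm : IsMinLevel V h) {x : ℝ}
    (hx : x ∈ Ioo l r) : V x < h := by
  refine lt_of_le_of_ne (H.below x (Ioo_subset_Icc_self hx)) fun hxh => ?_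
  have hmax : IsLocalMax V x := by
    filter_upwards [Icc_mem_nhds hx.1 hx.2] with y hy
    rw [hxh]; exact H.below y hy
  have h0 := hmax.deriv_eq_zero
  obtain ⟨d, hd, hmin⟩ := exists_strict_min hV h0 (hm x hxh h0)
  obtain ⟨y, hy⟩ := (hmax.filter_mono (nhdsWithin_le_nhds (s := Ioi x)) |>.and
    (Ioc_mem_nhdsGT (show x < x + d by linarith))).exists
  have := hmin y ⟨by linarith [hy.2.1], hy.2.2⟩ hy.2.1.ne'
  linarith [hy.1]

/-- Either the leaf is a centre point, or it is nondegenerate with regular ends. -/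
theorem IsLeaf.dichotomy (H : IsLeaf V h l r) (hV : ContDiff ℝ 2 V) (hm : IsMinLevel V h) :
    V l = h ∧ V r = h ∧ ((l = r ∧ deriv V l = 0 ∧ 0 < deriv (deriv V) l) ∨
      (l < r ∧ deriv V l < 0 ∧ 0 < deriv V r ∧ ∀ x ∈ Ioo l r, V x < h)) := by
  obtain ⟨h1, h2⟩ := H.right_end hV hm
  obtain ⟨h3, h4⟩ := H.left_end hV hm
  refine ⟨h3, h1, ?_⟩
  rcases h2 with h2 | ⟨h2, h2', h2''⟩
  · right
    rcases h4 with h4 | ⟨h4, -, h4'⟩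
    · refine ⟨lt_of_le_of_ne H.le ?_, h4, h2, fun x hx => H.lt_of_mem hV hm hx⟩
      rintro rfl; linarith
    · rw [h4'] at h4; linarith
  · left; subst h2''; exact ⟨rfl, h2, h2'⟩

end ImpactSystem

namespace ImpactSystem

open MeasureTheory

variable {V : ℝ → ℝ} {h l r : ℝ}

/-! ### Windows around leaves -/

/-- `[l - d, r + d]` is a window around the nondegenerate leaf `[l, r]` of energy `h`, good for the
energies `c`-close to `h`. -/
structure RegularWindow (V : ℝ → ℝ) (h l r d c : ℝ) : Prop where
  d_pos : 0 < d
  c_pos : 0 < c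
  sep : l + d < r - d
  neg : ∀ x ∈ Icc (l - d) (l + d), deriv V x < 0
  pos : ∀ x ∈ Icc (r - d) (r + d), 0 < deriv V x
  outL : h + c < V (l - d)
  outR : h + c < V (r + d)
  inner : ∀ x ∈ Icc (l + d) (r - d), V x < h - c

theorem strictMonoOn_of_pos (hV : ContDiff ℝ 2 V) {a b : ℝ}
    (hp : ∀ x ∈ Icc a b, 0 < deriv V x) : StrictMonoOn V (Icc a b) :=
  strictMonoOn_of_deriv_pos (convex_Icc a b) hV.continuous.continuousOn fun x hx =>
    hp x (interior_subset hx)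

theorem strictAntiOn_of_neg (hV : ContDiff ℝ 2 V) {a b : ℝ}
    (hp : ∀ x ∈ Icc a b, deriv V x < 0) : StrictAntiOn V (Icc a b) :=
  strictAntiOn_of_deriv_neg (convex_Icc a b) hV.continuous.continuousOn fun x hx =>
    hp x (interior_subset hx)

theorem exists_regularWindow (hV : ContDiff ℝ 2 V) (hlr : l < r) (hl : V l = h) (hr : V r = h)
    (hdl : deriv V l < 0) (hdr : 0 < deriv V r) (hin : ∀ x ∈ Ioo l r, V x < h) :
    ∃ d₀ > 0, ∀ d, 0 < d → d ≤ d₀ → ∃ c, RegularWindow V h l r d c := by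
  have hc := (contDiff_deriv hV).continuous
  obtain ⟨d₁, hd₁, h₁⟩ := exists_pos_nhds_Icc hc hdr
  obtain ⟨d₂, hd₂, h₂⟩ := exists_pos_nhds_Icc hc.neg (c := l) (by simpa using hdl)
  refine ⟨min (min d₁ d₂) ((r - l) / 3), lt_min (lt_min hd₁ hd₂) (by linarith), fun d hd hdd => ?_⟩
  have e1 : d ≤ d₁ := hdd.trans ((min_le_left _ _).trans (min_le_left _ _))
  have e2 : d ≤ d₂ := hdd.trans ((min_le_left _ _).trans (min_le_right _ _))
  have e3 : d ≤ (r - l) / 3 := hdd.trans (min_le_right _ _)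
  have hneg : ∀ x ∈ Icc (l - d) (l + d), deriv V x < 0 := fun x hx => by
    have := h₂ x ⟨by linarith [hx.1], by linarith [hx.2]⟩
    rw [Pi.neg_apply] at this
    linarith
  have hpos : ∀ x ∈ Icc (r - d) (r + d), 0 < deriv V x := fun x hx =>
    h₁ x ⟨by linarith [hx.1], by linarith [hx.2]⟩
  have o1 : h < V (l - d) := by
    rw [← hl]
    exact strictAntiOn_of_neg hV hneg ⟨le_rfl, by linarith⟩ ⟨by linarith, by linarith⟩
      (by linarith)
  have o2 : h < V (r + d) := by
    rw [← hr]
    exact strictMonoOn_of_pos hV hpos ⟨by linarith, by linarith⟩ ⟨by linarith, le_rfl⟩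
      (by linarith)
  have hsep : l + d < r - d := by linarith
  obtain ⟨z, hz, hmax⟩ := (isCompact_Icc (a := l + d) (b := r - d)).exists_isMaxOn
    (nonempty_Icc.2 hsep.le) hV.continuous.continuousOn
  have o3 : V z < h := hin z ⟨by linarith [hz.1], by linarith [hz.2]⟩
  set c := min (min (V (l - d) - h) (V (r + d) - h)) (h - V z)
  have hc0 : 0 < c := lt_min (lt_min (by linarith) (by linarith)) (by linarith)
  have c1 : c ≤ V (l - d) - h := (min_le_left _ _).trans (min_le_left _ _)
  have c2 : c ≤ V (r + d) - h := (min_le_left _ _).trans (min_le_right _ _)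
  have c3 : c ≤ h - V z := min_le_right _ _
  refine ⟨c / 2, hd, half_pos hc0, hsep, hneg, hpos, by linarith, by linarith, fun x hx => ?_⟩
  have : V x ≤ V z := hmax hx
  linarith

theorem RegularWindow.turning {d c : ℝ} (W : RegularWindow V h l r d c) (hV : ContDiff ℝ 2 V) {h' : ℝ} (hh : |h' - h| < c) :
    ∃ l' r', l' ∈ Ioo (l - d) (l + d) ∧ r' ∈ Ioo (r - d) (r + d) ∧ V l' = h' ∧ V r' = h' ∧
      (∀ x ∈ Icc (l - d) (r + d), V x ≤ h' ↔ x ∈ Icc l' r') ∧ ∀ x ∈ Ioo l' r', V x < h' := by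
  obtain ⟨hh1, hh2⟩ := abs_lt.1 hh
  have hd := W.d_pos
  have hs := W.sep
  have i1 := W.inner (l + d) ⟨le_rfl, hs.le⟩
  have i2 := W.inner (r - d) ⟨hs.le, le_rfl⟩
  have o1 := W.outL
  have o2 := W.outR
  have hanti := strictAntiOn_of_neg hV W.neg
  have hmono := strictMonoOn_of_pos hV W.pos
  obtain ⟨l', hl', hVl⟩ := intermediate_value_Ioo' (show l - d ≤ l + d by linarith)
    hV.continuous.continuousOn (show h' ∈ Ioo (V (l + d)) (V (l - d)) by constructor <;> linarith)
  obtain ⟨r', hr', hVr⟩ := intermediate_value_Ioo (show r - d ≤ r + d by linarith)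
    hV.continuous.continuousOn (show h' ∈ Ioo (V (r - d)) (V (r + d)) by constructor <;> linarith)
  have hl'' := Ioo_subset_Icc_self hl'
  have hr'' := Ioo_subset_Icc_self hr'
  have hlt : ∀ x ∈ Ioo l' r', V x < h' := by
    intro x hx
    rcases le_total x (l + d) with h1 | h1
    · rw [← hVl]; exact hanti hl'' ⟨hl'.1.le.trans hx.1.le, h1⟩ hx.1
    rcases le_total (r - d) x with h2 | h2
    · rw [← hVr]; exact hmono ⟨h2, hx.2.le.trans hr'.2.le⟩ hr'' hx.2
    · have := W.inner x ⟨h1, h2⟩; linarith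
  refine ⟨l', r', hl', hr', hVl, hVr, fun x hx => ⟨fun hVx => ?_, fun hxm => ?_⟩, hlt⟩
  · constructor
    · by_contra hcon
      have := hanti ⟨hx.1, by linarith [hl'.2]⟩ hl'' (not_le.1 hcon)
      linarith
    · by_contra hcon
      have := hmono hr'' ⟨by linarith [hr'.1], hx.2⟩ (not_le.1 hcon)
      linarith
  · rcases eq_or_lt_of_le hxm.1 with h1 | h1
    · rw [← h1, hVl]
    rcases eq_or_lt_of_le hxm.2 with h2 | h2
    · rw [h2, hVr]
    · exact (hlt x ⟨h1, h2⟩).le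

theorem RegularWindow.hasActionExpansion {d c : ℝ} (W : RegularWindow V h l r d c) (hV : ContDiff ℝ 2 V) {m : ℝ} (hm : m < h - c) :
    ∃ C, HasActionExpansion V (l - d) (r + d) (Ioo (h - c) (h + c)) m C := by
  have hd := W.d_pos
  have hc := W.c_pos
  have hs := W.sep
  have key : ∀ {V : ℝ → ℝ} {r : ℝ}, ContDiff ℝ 2 V → (∀ x ∈ Icc (r - d) (r + d), 0 < deriv V x) →
      V (r - d) < h - c → h + c < V (r + d) →
      ∃ C, HasActionExpansion V (r - d) (r + d) (Ioo (h - c) (h + c)) m C := by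
    intro V r hV hp h1 h2
    obtain ⟨C, hS⟩ := isSlope_of_deriv_pos hV (show r - d < r + d by linarith) hp
    obtain ⟨C', hE⟩ := hS.hasActionExpansion hV
    have hE' := hE.mono (J' := Ioo (h - c) (h + c)) fun x hx =>
      ⟨h1.trans hx.1, hx.2.le.trans h2.le⟩
    refine hE'.change_bottom (c := min (h - c - V (r - d)) (h - c - m))
      (D := max (h + c - V (r - d)) (h + c - m)) (by linarith)
      (lt_min (by linarith) (by linarith)) (fun x hx => ⟨?_, ?_⟩) (fun x hx => ⟨?_, ?_⟩)
    · exact (min_le_left _ _).trans (by linarith [hx.1])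
    · exact le_trans (by linarith [hx.2]) (le_max_left _ _)
    · exact (min_le_right _ _).trans (by linarith [hx.1])
    · exact le_trans (by linarith [hx.2]) (le_max_right _ _)
  obtain ⟨C₁, h₁⟩ := key hV W.pos (W.inner _ ⟨hs.le, le_rfl⟩) W.outR
  obtain ⟨C₂, h₂⟩ := key (V := fun x => V (-x)) (r := -l) (contDiff_reflect hV)
    (fun x hx => by
      rw [deriv_reflect]
      have := W.neg (-x) ⟨by linarith [hx.2], by linarith [hx.1]⟩
      linarith)
    (by have := W.inner _ ⟨le_rfl, hs.le⟩; simpa [add_comm] using this)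
    (by have := W.outL; simpa [sub_eq_neg_add] using this)
  have h₂' : HasActionExpansion V (l - d) (l + d) (Ioo (h - c) (h + c)) m C₂ := by
    apply HasActionExpansion.reflect
    convert! h₂ using 1 <;> ring
  obtain ⟨z, hz, hmax⟩ := (isCompact_Icc (a := l + d) (b := r - d)).exists_isMaxOn
    (nonempty_Icc.2 hs.le) hV.continuous.continuousOn
  have hVz := W.inner z hz
  obtain ⟨C₃, h₃⟩ := hasActionExpansion_of_lt (V := V) (a := l + d) (b := r - d)
    (J := Ioo (h - c) (h + c)) (m := m) (c := min (h - c - V z) (h - c - m)) (D := h + c - m)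
    hV.continuous hs.le (lt_min (by linarith) (by linarith))
    (fun x hx y hy => (min_le_left _ _).trans (by
      have : V y ≤ V z := hmax hy
      linarith [hx.1]))
    (fun x hx => ⟨(min_le_right _ _).trans (by linarith [hx.1]), by linarith [hx.2]⟩)
  exact ⟨_, (h₂'.concat hV.continuous h₃).concat hV.continuous h₁⟩

/-- `[A, B]` is a window around the leaf of energy `h₀` over `a₀`: for energies `c`-close to `h₀` it
contains exactly one leaf, and the action expansion holds there with bottom `m`. -/
structure WellWindow (V : ℝ → ℝ) (h₀ a₀ A B c m C : ℝ) : Prop where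
  mem : a₀ ∈ Ioo A B
  c_pos : 0 < c
  outA : h₀ + c < V A
  outB : h₀ + c < V B
  conn : ∀ h, |h - h₀| < c → IsPreconnected (Icc A B ∩ {x | V x ≤ h})
  bot : ∀ x ∈ Icc A B, m ≤ V x
  exp : HasActionExpansion V A B (Ioo (max m (h₀ - c)) (h₀ + c)) m C
  low : ∃ x₀ ∈ Ioo A B, ∀ h, h₀ - c < h → m < h → V x₀ < h
  freq : ∃ C', ∀ a ∈ Icc A B, V a ≤ m → |m - h₀| < c → |1 / frequency V m a| ≤ C'
  branch : ∀ h, |h - h₀| < c → (∃ a ∈ Icc A B, V a ≤ h) → ∀ x ∈ Icc A B, min h h₀ < V x →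
    V x ≤ max h h₀ → deriv V x ≠ 0

theorem RegularWindow.wellWindow {d c : ℝ} (W : RegularWindow V h l r d c)
    (hV : ContDiff ℝ 2 V) (hb : BddBelow (range V)) {a : ℝ} (ha : a ∈ Icc l r) :
    ∃ m C, WellWindow V h a (l - d) (r + d) c m C := by
  obtain ⟨m₀, hm₀⟩ := hb
  have hd := W.d_pos
  have hc := W.c_pos
  have hs := W.sep
  set m := min m₀ (h - c) - 1
  have hm1 : m < h - c := by have := min_le_right m₀ (h - c); simp only [m]; linarith
  have hm2 : ∀ x, m < V x := fun x => by
    have := min_le_left m₀ (h - c)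
    have := hm₀ (mem_range_self x)
    simp only [m]; linarith
  obtain ⟨C, hE⟩ := W.hasActionExpansion hV hm1
  refine ⟨m, C, ⟨by linarith [ha.1], by linarith [ha.2]⟩, hc, W.outL, W.outR, fun h' hh => ?_,
    fun x _ => (hm2 x).le, ?_, ⟨l + d, ⟨by linarith, by linarith⟩, fun h' hh _ => ?_⟩,
    ⟨0, fun a _ h1 _ => absurd h1 (not_le.2 (hm2 a))⟩, fun h' hh _ x hx h1 h2 => ?_⟩
  · obtain ⟨l', r', hl', hr', -, -, hiff, -⟩ := W.turning hV hh
    have : Icc (l - d) (r + d) ∩ {x | V x ≤ h'} = Icc l' r' := by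
      ext x
      refine ⟨fun hx => (hiff x hx.1).1 hx.2, fun hx => ?_⟩
      have hx' : x ∈ Icc (l - d) (r + d) := ⟨hl'.1.le.trans hx.1, hx.2.trans hr'.2.le⟩
      exact ⟨hx', (hiff x hx').2 hx⟩
    rw [this]; exact isPreconnected_Icc
  · rwa [max_eq_right hm1.le]
  · exact (W.inner _ ⟨le_rfl, hs.le⟩).trans hh
  · obtain ⟨hh1, hh2⟩ := abs_lt.1 hh
    have h3 : h - c < V x := lt_of_lt_of_le (lt_min (by linarith) (by linarith)) h1.le
    rcases lt_or_ge x (l + d) with h4 | h4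
    · exact (W.neg x ⟨hx.1, h4.le⟩).ne
    rcases lt_or_ge (r - d) x with h5 | h5
    · exact (W.pos x ⟨h5.le, hx.2⟩).ne'
    · exact absurd (W.inner x ⟨h4, h5⟩) (not_lt.2 h3.le)

theorem well_of_window {A B : ℝ} (hA : h < V A) (hB : h < V B)
    (hconn : IsPreconnected (Icc A B ∩ {x | V x ≤ h})) {a : ℝ} (ha : a ∈ Icc A B)
    (haV : V a ≤ h) : well V h a = Icc A B ∩ {x | V x ≤ h} := by
  have haV' : a ∈ {x | V x ≤ h} := haV
  refine subset_antisymm ?_ ?_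
  · intro x hx
    refine ⟨?_, le_of_mem_well hx⟩
    have ho := (isPreconnected_connectedComponentIn (F := {x | V x ≤ h}) (x := a)).ordConnected
    have ha' : a ∈ connectedComponentIn {x | V x ≤ h} a := mem_connectedComponentIn haV'
    constructor
    · by_contra hcon
      exact absurd (le_of_mem_well (ho.out hx ha' ⟨(not_le.1 hcon).le, ha.1⟩)) (not_le.2 hA)
    · by_contra hcon
      exact absurd (le_of_mem_well (ho.out ha' hx ⟨ha.2, (not_le.1 hcon).le⟩)) (not_le.2 hB)
  · exact hconn.subset_connectedComponentIn ⟨ha, haV⟩ fun x hx => hx.2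

theorem exists_center_wellWindow (hV : ContDiff ℝ 2 V) {z : ℝ} (hd : deriv V z = 0)
    (hpos : 0 < deriv (deriv V) z) :
    ∃ A B c m C, WellWindow V (V z) z A B c m C ∧ m = V z := by
  obtain ⟨d, hd0, hdp⟩ := exists_pos_nhds_Icc ((contDiff_deriv hV).continuous_deriv le_rfl) hpos
  have hR : ∀ x ∈ Icc z (z + d), 0 < deriv (deriv V) x := fun x hx =>
    hdp x ⟨by linarith [hx.1], hx.2⟩
  have hL : ∀ x ∈ Icc (z - d) z, 0 < deriv (deriv V) x := fun x hx =>
    hdp x ⟨hx.1, by linarith [hx.2]⟩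
  obtain ⟨C₁, S₁⟩ := isSlope_of_center hV (show z < z + d by linarith) hd hR
  obtain ⟨C₂, S₂⟩ := isSlope_of_center (contDiff_reflect hV) (show -z < -(z - d) by linarith)
    (by rw [deriv_reflect, neg_neg, hd, neg_zero])
    (fun x hx => by
      rw [deriv_deriv_reflect]; exact hL _ ⟨by linarith [hx.2], by linarith [hx.1]⟩)
  have hmono := S₁.strictMonoOn hV
  have hanti := strictAntiOn_of_center hV (show z - d < z by linarith) hd hL
  obtain ⟨D₁, E₁⟩ := S₁.hasActionExpansion hV
  obtain ⟨D₂, E₂⟩ := S₂.hasActionExpansion (contDiff_reflect hV)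
  simp only [neg_neg] at E₂
  have o1 : V z < V (z - d) :=
    hanti ⟨le_rfl, by linarith⟩ ⟨by linarith, le_rfl⟩ (by linarith)
  have o2 : V z < V (z + d) :=
    hmono ⟨le_rfl, by linarith⟩ ⟨by linarith, le_rfl⟩ (by linarith)
  set c := min (V (z - d) - V z) (V (z + d) - V z) / 2
  have hmin : 0 < min (V (z - d) - V z) (V (z + d) - V z) := lt_min (by linarith) (by linarith)
  have hc : 0 < c := half_pos hmin
  have c1 : V z + c < V (z - d) := by
    have : c < V (z - d) - V z := (half_lt_self hmin).trans_le (min_le_left _ _)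
    linarith
  have c2 : V z + c < V (z + d) := by
    have : c < V (z + d) - V z := (half_lt_self hmin).trans_le (min_le_right _ _)
    linarith
  have hbot : ∀ x ∈ Icc (z - d) (z + d), V z ≤ V x := by
    intro x hx
    rcases le_total x z with h1 | h1
    · exact hanti.antitoneOn ⟨hx.1, h1⟩ ⟨by linarith, le_rfl⟩ h1
    · exact hmono.monotoneOn ⟨le_rfl, by linarith⟩ ⟨h1, hx.2⟩ h1
  have hconn : ∀ h, IsPreconnected (Icc (z - d) (z + d) ∩ {x | V x ≤ h}) := by
    intro h
    rw [isPreconnected_iff_ordConnected]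
    refine ⟨fun x hx y hy w hw => ⟨⟨hx.1.1.trans hw.1, hw.2.trans hy.1.2⟩, ?_⟩⟩
    rcases le_total w z with h1 | h1
    · exact (hanti.antitoneOn ⟨hx.1.1, hw.1.trans h1⟩ ⟨hx.1.1.trans hw.1, h1⟩ hw.1).trans hx.2
    · exact (hmono.monotoneOn ⟨h1, hw.2.trans hy.1.2⟩ ⟨h1.trans hw.2, hy.1.2⟩ hw.2).trans hy.2
  have honly : ∀ x ∈ Icc (z - d) (z + d), V x ≤ V z → x = z := by
    intro x hx hVx
    by_contra hne
    rcases lt_or_gt_of_ne hne with h1 | h1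
    · exact absurd (hanti ⟨hx.1, h1.le⟩ ⟨by linarith, le_rfl⟩ h1) (not_lt.2 hVx)
    · exact absurd (hmono ⟨le_rfl, by linarith⟩ ⟨h1.le, hx.2⟩ h1) (not_lt.2 hVx)
  have hE : HasActionExpansion V (z - d) (z + d) (Ioo (V z) (V z + c)) (V z) (D₂ + D₁) := by
    refine HasActionExpansion.concat hV.continuous (b := z) ?_
      (E₁.mono fun x hx => ⟨hx.1, hx.2.le.trans c2.le⟩)
    apply HasActionExpansion.reflect
    exact E₂.mono fun x hx => ⟨hx.1, hx.2.le.trans c1.le⟩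
  refine ⟨z - d, z + d, c, V z, D₂ + D₁, ⟨⟨by linarith, by linarith⟩, hc, c1, c2,
    fun h _ => hconn h, hbot, ?_, ⟨z, ⟨by linarith, by linarith⟩, fun h _ h1 => h1⟩,
    ⟨|1 / frequency V (V z) z|, fun a ha hVa _ => ?_⟩, fun h hh ⟨a, ha, hVa⟩ x hx h1 h2 => ?_⟩, rfl⟩
  · rwa [max_eq_left (by linarith)]
  · rw [honly a ha hVa]
  · have hne : x ≠ z := by
      rintro rfl
      rw [min_eq_right ((hbot a ha).trans hVa)] at h1
      exact lt_irrefl _ h1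
    rcases lt_or_gt_of_ne hne with h3 | h3
    · have := S₂.pos (-x) ⟨by linarith, by linarith [hx.1]⟩
      rw [deriv_reflect, neg_neg] at this
      linarith
    · exact (S₁.pos x ⟨h3, hx.2⟩).ne'

end ImpactSystem

namespace ImpactSystem

open MeasureTheory

variable {V : ℝ → ℝ}

theorem exists_wellWindow (hV : ContDiff ℝ 2 V) (hb : BddBelow (range V))
    (hco : Tendsto V (cocompact ℝ) atTop) {h a : ℝ} (hm : IsMinLevel V h) (ha : V a ≤ h) :
    ∃ A B c m C, WellWindow V h a A B c m C := by
  obtain ⟨l, r, hal, H⟩ := exists_isLeaf hV.continuous hco ha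
  obtain ⟨hl, hr, ⟨hlr, hd, hp⟩ | ⟨hlr, hdl, hdr, hin⟩⟩ := H.dichotomy hV hm
  · have : a = l := le_antisymm (hal.2.trans hlr.ge) hal.1
    obtain ⟨A, B, c, m, C, W, -⟩ := exists_center_wellWindow hV hd hp
    rw [hl] at W
    rw [this]
    exact ⟨A, B, c, m, C, W⟩
  · obtain ⟨d₀, hd₀, H⟩ := exists_regularWindow hV hlr hl hr hdl hdr hin
    obtain ⟨c, W⟩ := H d₀ hd₀ le_rfl
    obtain ⟨m, C, W'⟩ := W.wellWindow hV hb hal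
    exact ⟨_, _, _, _, _, W'⟩

namespace WellWindow

variable {h₀ a₀ A B c m C h a : ℝ}

theorem lt (W : WellWindow V h₀ a₀ A B c m C) : A < B := W.mem.1.trans W.mem.2

theorem well_eq (W : WellWindow V h₀ a₀ A B c m C) (hh : |h - h₀| < c) (ha : a ∈ Icc A B)
    (hVa : V a ≤ h) : well V h a = Icc A B ∩ {x | V x ≤ h} := by
  have h1 := (abs_lt.1 hh).2
  exact well_of_window (by linarith [W.outA]) (by linarith [W.outB]) (W.conn h hh) ha hVa

theorem setIntegral_well (W : WellWindow V h₀ a₀ A B c m C)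
    (hh : |h - h₀| < c) (ha : a ∈ Icc A B) (hVa : V a ≤ h) {f : ℝ → ℝ}
    (hf : ∀ x, h < V x → f x = 0) : ∫ x in well V h a, f x = ∫ x in A..B, f x := by
  rw [W.well_eq hh ha hVa, intervalIntegral.integral_of_le W.lt.le, ← integral_Icc_eq_integral_Ioc]
  refine (setIntegral_eq_of_subset_of_forall_sdiff_eq_zero measurableSet_Icc inter_subset_left
    fun x hx => hf x ?_).symm
  by_contra hcon
  exact hx.2 ⟨hx.1, not_lt.1 hcon⟩

theorem action_eq (W : WellWindow V h₀ a₀ A B c m C)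
    (hh : |h - h₀| < c) (ha : a ∈ Icc A B) (hVa : V a ≤ h) :
    action V h a = 1 / Real.pi * ∫ x in A..B, mom V h x := by
  have := W.setIntegral_well hh ha hVa (f := mom V h) fun x hx => mom_eq_zero hx.le
  rw [← this, action]
  unfold mom
  have := Real.pi_pos.ne'
  field_simp

theorem period_eq (W : WellWindow V h₀ a₀ A B c m C)
    (hh : |h - h₀| < c) (ha : a ∈ Icc A B) (hVa : V a ≤ h) :
    period V h a = 2 * ∫ x in A..B, 1 / mom V h x := by
  have := W.setIntegral_well hh ha hVa (f := fun x => 1 / mom V h x)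
    fun x hx => by rw [mom_eq_zero hx.le, div_zero]
  rw [← this, period]
  rfl

theorem one_div_frequency (W : WellWindow V h₀ a₀ A B c m C) (hV : Continuous V)
    (hh : |h - h₀| < c) (ha : a ∈ Icc A B) (hVa : V a ≤ h) (hm : m < h) :
    1 / frequency V h a = 1 / Real.pi * ∫ x in A..B, 1 / mom V h x := by
  obtain ⟨x₀, hx₀, hlow⟩ := W.low
  have hx₀h := hlow h (by linarith [(abs_lt.1 hh).1]) hm
  have hne : leftEnd V h a ≠ rightEnd V h a := by
    have hw := W.well_eq hh ha hVa
    have hbd : BddBelow (well V h a) := by rw [hw]; exact bddBelow_Icc.mono inter_subset_left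
    have hba : BddAbove (well V h a) := by rw [hw]; exact bddAbove_Icc.mono inter_subset_left
    have hev : ∀ᶠ x in 𝓝[>] x₀, V x < h :=
      (hV.continuousAt.eventually_lt continuousAt_const hx₀h).filter_mono nhdsWithin_le_nhds
    obtain ⟨y, hy1, hy2⟩ := (hev.and (Ioo_mem_nhdsGT hx₀.2)).exists
    have m1 : x₀ ∈ well V h a := by rw [hw]; exact ⟨⟨hx₀.1.le, hx₀.2.le⟩, hx₀h.le⟩
    have m2 : y ∈ well V h a := by
      rw [hw]; exact ⟨⟨hx₀.1.le.trans hy2.1.le, hy2.2.le⟩, hy1.le⟩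
    exact ((csInf_le hbd m1).trans_lt (hy2.1.trans_le (le_csSup hba m2))).ne
  rw [frequency, if_neg hne, W.period_eq hh ha hVa, one_div_div]
  have := Real.pi_pos.ne'
  field_simp

theorem bottom_le (W : WellWindow V h₀ a₀ A B c m C) (ha : a ∈ Icc A B) (hVa : V a ≤ h) : m ≤ h :=
  (W.bot a ha).trans hVa

theorem mem_energies (W : WellWindow V h₀ a₀ A B c m C) (hh : |h - h₀| < c) (hm : m < h) :
    h ∈ Ioo (max m (h₀ - c)) (h₀ + c) := by
  obtain ⟨h1, h2⟩ := abs_lt.1 hh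
  have := W.c_pos
  exact ⟨max_lt hm (by linarith), by linarith⟩

theorem sameBranch (W : WellWindow V h₀ a₀ A B c m C) (hVa₀ : V a₀ ≤ h₀) (hh : |h - h₀| < c)
    (ha : a ∈ Icc A B) (hVa : V a ≤ h) : SameBranch V h a h₀ a₀ := by
  have h0 : |h₀ - h₀| < c := by simpa using W.c_pos
  have hbr := W.branch h hh ⟨a, ha, hVa⟩
  rw [SameBranch, W.well_eq hh ha hVa, W.well_eq h0 (Ioo_subset_Icc_self W.mem) hVa₀]
  rcases le_total h h₀ with h1 | h1
  · left
    refine ⟨fun x hx => ⟨hx.1, hx.2.trans h1⟩, fun x hx => hbr x hx.1.1 ?_ ?_⟩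
    · rw [min_eq_left h1]
      by_contra hcon
      exact hx.2 ⟨hx.1.1, not_lt.1 hcon⟩
    · rw [max_eq_right h1]; exact hx.1.2
  · right
    refine ⟨fun x hx => ⟨hx.1, hx.2.trans h1⟩, fun x hx => hbr x hx.1.1 ?_ ?_⟩
    · rw [min_eq_right h1]
      by_contra hcon
      exact hx.2 ⟨hx.1.1, not_lt.1 hcon⟩
    · rw [max_eq_left h1]; exact hx.1.2

theorem abs_action_sub_le (W : WellWindow V h₀ a₀ A B c m C) (hV : Continuous V)
    (hVa₀ : V a₀ ≤ h₀) (hh : |h - h₀| < c) (ha : a ∈ Icc A B) (hVa : V a ≤ h) :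
    |action V h a - action V h₀ a₀| ≤ 1 / Real.pi * (√(2 * |h - h₀|) * (B - A)) := by
  have h0 : |h₀ - h₀| < c := by simpa using W.c_pos
  rw [W.action_eq hh ha hVa, W.action_eq h0 (Ioo_subset_Icc_self W.mem) hVa₀, ← mul_sub,
    abs_mul, abs_of_pos (one_div_pos.2 Real.pi_pos), ← intervalIntegral.integral_sub
    ((continuous_mom hV h).intervalIntegrable _ _) ((continuous_mom hV h₀).intervalIntegrable _ _)]
  have key : ∀ x, ‖mom V h x - mom V h₀ x‖ ≤ √(2 * |h - h₀|) := by
    have aux : ∀ u v : ℝ, √u - √v ≤ √|u - v| := by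
      intro u v
      rcases le_total u 0 with hu | hu
      · rw [Real.sqrt_eq_zero_of_nonpos hu]
        linarith [Real.sqrt_nonneg v, Real.sqrt_nonneg |u - v|]
      rw [sub_le_iff_le_add]
      have h1 : u ≤ (√|u - v| + √v) ^ 2 := by
        rcases le_total v 0 with hv | hv
        · have h2 := Real.sq_sqrt (abs_nonneg (u - v))
          have h3 := le_abs_self (u - v)
          nlinarith [Real.sqrt_nonneg |u - v|, Real.sqrt_nonneg v]
        · have h2 := Real.sq_sqrt (abs_nonneg (u - v))
          have h3 := Real.sq_sqrt hv
          have h4 := le_abs_self (u - v)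
          nlinarith [Real.sqrt_nonneg |u - v|, Real.sqrt_nonneg v,
            mul_nonneg (Real.sqrt_nonneg |u - v|) (Real.sqrt_nonneg v)]
      exact Real.sqrt_le_iff.2 ⟨by positivity, h1⟩
    intro x
    rw [Real.norm_eq_abs, abs_le]
    have e1 := aux (2 * (h - V x)) (2 * (h₀ - V x))
    have e2 := aux (2 * (h₀ - V x)) (2 * (h - V x))
    have e3 : |2 * (h - V x) - 2 * (h₀ - V x)| = 2 * |h - h₀| := by
      rw [show 2 * (h - V x) - 2 * (h₀ - V x) = 2 * (h - h₀) by ring, abs_mul]; norm_num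
    have e4 : |2 * (h₀ - V x) - 2 * (h - V x)| = 2 * |h - h₀| := by
      rw [abs_sub_comm, e3]
    rw [e3] at e1
    rw [e4] at e2
    unfold mom
    constructor <;> linarith
  have := intervalIntegral.norm_integral_le_of_norm_le_const (a := A) (b := B)
    (f := fun x => mom V h x - mom V h₀ x) fun x _ => key x
  rw [abs_of_pos (sub_pos.2 W.lt)] at this
  exact mul_le_mul_of_nonneg_left this (one_div_pos.2 Real.pi_pos).le

theorem exists_abs_one_div_frequency_le (W : WellWindow V h₀ a₀ A B c m C) (hV : Continuous V) :
    ∃ E, 0 ≤ E ∧ ∀ h a, |h - h₀| < c → a ∈ Icc A B → V a ≤ h → |1 / frequency V h a| ≤ E := by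
  obtain ⟨D, hD⟩ := W.freq
  have hp0 : 0 < 1 / Real.pi := one_div_pos.2 Real.pi_pos
  refine ⟨max (1 / Real.pi * |C|) D, le_trans (by positivity) (le_max_left _ _),
    fun h a hh ha hVa => ?_⟩
  rcases eq_or_lt_of_le (W.bottom_le ha hVa) with h1 | h1
  · subst h1
    exact (hD a ha hVa hh).trans (le_max_right _ _)
  · refine le_trans ?_ (le_max_left _ _)
    rw [W.one_div_frequency hV hh ha hVa h1, abs_mul, abs_of_pos hp0]
    have h2 : 0 ≤ ∫ x in A..B, 1 / mom V h x := intervalIntegral.integral_nonneg W.lt.le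
      fun x _ => one_div_nonneg.2 (mom_nonneg _ _ _)
    rw [abs_of_nonneg h2]
    have := (W.exp.inv_le h (W.mem_energies hh h1)).trans (le_abs_self C)
    gcongr

/-- The action is differentiable in the energy with derivative `1 / ω`, with a quadratic error for
energy changes that are controlled, near a centre, by the momentum. -/
theorem action_expansion (W : WellWindow V h₀ a₀ A B c m C) (hV : Continuous V) (K : ℝ) :
    ∃ C' : ℝ, ∀ h h' a a' ε : ℝ, |h - h₀| < c → |h' - h₀| < c → a ∈ Icc A B → a' ∈ Icc A B →
      V a ≤ h → V a' ≤ h' → |h' - h| ≤ K * (|ε| * √(h - m) + ε ^ 2) →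
      |action V h' a' - action V h a - (h' - h) * (1 / frequency V h a)| ≤ C' * ε ^ 2 := by
  wlog hK : 1 ≤ K generalizing K
  · obtain ⟨C', hC'⟩ := this (max K 1) (le_max_right _ _)
    refine ⟨C', fun h h' a a' ε h1 h2 h3 h4 h5 h6 h7 => hC' h h' a a' ε h1 h2 h3 h4 h5 h6
      (h7.trans ?_)⟩
    gcongr
    exact le_max_left _ _
  obtain ⟨E, hE0, hfreq⟩ := W.exists_abs_one_div_frequency_le hV
  have hpi := Real.pi_pos
  set p := 1 / Real.pi with hp
  have hp0 : 0 < p := one_div_pos.2 hpi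
  have hact : ∀ h a, |h - h₀| < c → a ∈ Icc A B → V a ≤ h →
      0 ≤ action V h a ∧ action V h a ≤ p * |C| * (h - m) := by
    intro h a hh ha hVa
    have hmh := W.bottom_le ha hVa
    rw [W.action_eq hh ha hVa]
    refine ⟨mul_nonneg hp0.le (intervalIntegral.integral_nonneg W.lt.le
      fun x _ => mom_nonneg _ _ _), ?_⟩
    rw [mul_assoc]
    refine mul_le_mul_of_nonneg_left ?_ hp0.le
    rcases eq_or_lt_of_le hmh with h1 | h1
    · rw [← h1, sub_self, mul_zero]
      refine le_of_eq ?_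
      rw [intervalIntegral.integral_congr (g := fun _ => (0 : ℝ)) fun x hx => ?_]
      · simp
      · rw [uIcc_of_le W.lt.le] at hx
        exact mom_eq_zero (W.bot x hx)
    · refine (W.exp.act_le h (W.mem_energies hh h1)).trans ?_
      have := le_abs_self C
      have : 0 ≤ h - m := by linarith
      gcongr
  refine ⟨6 * p * |C| * K ^ 2 + 37 * p * |C| * K ^ 2 + 5 * K ^ 2 * E,
    fun h h' a a' ε hh hh' ha ha' hVa hVa' hΔ => ?_⟩
  have hm := W.bottom_le ha hVa
  have hm' := W.bottom_le ha' hVa'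
  set s := √(h - m) with hs
  have hs0 : 0 ≤ s := Real.sqrt_nonneg _
  have hs2 : s ^ 2 = h - m := Real.sq_sqrt (by linarith)
  have hε2 : |ε| ^ 2 = ε ^ 2 := sq_abs ε
  have hε0 := abs_nonneg ε
  rw [← hε2] at hΔ ⊢
  set t := |ε|
  rcases lt_or_ge (4 * K * t) s with hcase | hcase
  · have hs1 : 0 < s := lt_of_le_of_lt (by positivity) hcase
    have hKt : K * t ≤ s / 4 := by linarith
    have ht4 : t ≤ s / 4 := by nlinarith
    have hKts : K * t * t ≤ K * t * (s / 4) := by gcongr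
    have hKts0 : 0 ≤ K * t * s := by positivity
    have hΔ2 : |h' - h| ≤ 2 * K * t * s := by linarith
    have hKt2 : K * t * s ≤ s / 4 * s := by gcongr
    have hΔ3 : |h' - h| ≤ s ^ 2 / 2 := by linarith
    have he : 0 < h - m := by rw [← hs2]; positivity
    have he' : (h - m) / 2 ≤ h' - m := by
      have := (abs_le.1 hΔ3).1
      rw [hs2] at this
      linarith
    have he'0 : 0 < h' - m := by linarith
    rw [W.action_eq hh ha hVa, W.action_eq hh' ha' hVa',
      W.one_div_frequency hV hh ha hVa (by linarith)]
    have hexp := W.exp.expand h (W.mem_energies hh (by linarith)) h'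
      (W.mem_energies hh' (by linarith))
    have h3 : (h' - h) ^ 2 ≤ 2 * (2 * K * t) ^ 2 * (h' - m) := by
      calc (h' - h) ^ 2 = |h' - h| ^ 2 := (sq_abs _).symm
        _ ≤ (2 * K * t * s) ^ 2 := by gcongr
        _ = (2 * K * t) ^ 2 * (h - m) := by rw [← hs2]; ring
        _ ≤ (2 * K * t) ^ 2 * (2 * (h' - m)) := by gcongr; linarith
        _ = _ := by ring
    have h4 : C * (h' - h) ^ 2 / (h' - m) ≤ |C| * (8 * K ^ 2 * t ^ 2) := by
      rw [div_le_iff₀ he'0]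
      calc C * (h' - h) ^ 2 ≤ |C| * (2 * (2 * K * t) ^ 2 * (h' - m)) := by
            gcongr; exact le_abs_self C
        _ = _ := by ring
    have h5 : p * (∫ x in A..B, mom V h' x) - p * (∫ x in A..B, mom V h x)
        - (h' - h) * (p * ∫ x in A..B, 1 / mom V h x) = p * ((∫ x in A..B, mom V h' x)
        - (∫ x in A..B, mom V h x) - (h' - h) * ∫ x in A..B, 1 / mom V h x) := by ring
    rw [h5, abs_mul, abs_of_pos hp0]
    calc _ ≤ p * (|C| * (8 * K ^ 2 * t ^ 2)) := by gcongr; exact hexp.trans h4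
      _ ≤ _ := by
        have : 0 ≤ 35 * p * |C| * K ^ 2 * t ^ 2 + 5 * K ^ 2 * E * t ^ 2 := by positivity
        linarith
  · have he : h - m ≤ 16 * K ^ 2 * t ^ 2 := by rw [← hs2]; nlinarith
    have hΔ2 : |h' - h| ≤ 5 * K ^ 2 * t ^ 2 := by
      calc |h' - h| ≤ K * (t * s + t ^ 2) := hΔ
        _ ≤ K * (t * (4 * K * t) + t ^ 2) := by gcongr
        _ = 4 * K ^ 2 * t ^ 2 + K * t ^ 2 := by ring
        _ ≤ 4 * K ^ 2 * t ^ 2 + K ^ 2 * t ^ 2 := by gcongr; nlinarith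
        _ = _ := by ring
    have he' : h' - m ≤ 21 * K ^ 2 * t ^ 2 := by
      have := (abs_le.1 hΔ2).2
      linarith
    obtain ⟨a1, a2⟩ := hact h a hh ha hVa
    obtain ⟨a3, a4⟩ := hact h' a' hh' ha' hVa'
    have b1 : p * |C| * (h - m) ≤ p * |C| * (16 * K ^ 2 * t ^ 2) := by gcongr
    have b2 : p * |C| * (h' - m) ≤ p * |C| * (21 * K ^ 2 * t ^ 2) := by gcongr
    have b3 : |(h' - h) * (1 / frequency V h a)| ≤ 5 * K ^ 2 * t ^ 2 * E := by
      rw [abs_mul]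
      exact mul_le_mul hΔ2 (hfreq h a hh ha hVa) (abs_nonneg _) (by positivity)
    have b4 : |action V h' a' - action V h a| ≤ 37 * p * |C| * K ^ 2 * t ^ 2 := by
      have : 0 ≤ p * |C| * K ^ 2 * t ^ 2 := by positivity
      rw [abs_le]
      constructor <;> linarith
    refine (abs_sub _ _).trans ((add_le_add b4 b3).trans ?_)
    have : 0 ≤ 6 * p * |C| * K ^ 2 * t ^ 2 := by positivity
    linarith

end WellWindow

end ImpactSystem

namespace ImpactSystem

open MeasureTheory

/-! ### Quadrature for the orbits of `p²/2 + V(q)` -/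

theorem eventually_neg_of_hasDerivAt {f : ℝ → ℝ} {f' a : ℝ} (hf : HasDerivAt f f' a)
    (h0 : f a = 0) (hf' : f' < 0) : ∀ᶠ t in 𝓝[>] a, f t < 0 := by
  have : ∀ᶠ x in 𝓝[>] a, slope f a x < 0 :=
    ((hasDerivAt_iff_tendsto_slope.1 hf).mono_left
      (nhdsWithin_mono _ fun x hx => ne_of_gt hx)).eventually_lt_const hf'
  filter_upwards [this, self_mem_nhdsWithin] with x hx hxr
  rw [slope_def_field, h0, sub_zero, div_neg_iff] at hx
  have : (0 : ℝ) < x - a := sub_pos.2 hxr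
  rcases hx with hx | hx <;> linarith

theorem neg_of_ne_zero_of_eventually {f : ℝ → ℝ} (hf : Continuous f) {a b : ℝ}
    (h0 : ∀ᶠ t in 𝓝[>] a, f t < 0) (hne : ∀ t ∈ Ioo a b, f t ≠ 0) : ∀ t ∈ Ioo a b, f t < 0 := by
  intro t ht
  by_contra hcon
  have hpos : 0 < f t := lt_of_le_of_ne (not_lt.1 hcon) (hne t ht).symm
  obtain ⟨u, hu1, hu2⟩ := (h0.and (Ioo_mem_nhdsGT ht.1)).exists
  obtain ⟨v, hv, hfv⟩ := intermediate_value_Ioo hu2.2.le hf.continuousOn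
    (show (0 : ℝ) ∈ Ioo (f u) (f t) from ⟨hu1, hpos⟩)
  exact hne v ⟨hu2.1.trans hv.1, hv.2.trans ht.2⟩ hfv

variable {V : ℝ → ℝ} {Φ : ℝ → ℝ × ℝ} {h l r : ℝ}

theorem IsOrbit.energy_eq' (hV : ContDiff ℝ 2 V) (hΦ : IsOrbit V Φ) (h0 : Φ 0 = (r, 0))
    (hr : V r = h) (t : ℝ) : (Φ t).2 ^ 2 / 2 + V (Φ t).1 = h := by
  have := hΦ.energy_eq hV t 0
  rw [h0] at this
  simpa [planeEnergy, hr] using this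

theorem IsOrbit.continuous_q (hΦ : IsOrbit V Φ) : Continuous fun t => (Φ t).1 :=
  continuous_fst.comp hΦ.continuous

theorem IsOrbit.continuous_p (hΦ : IsOrbit V Φ) : Continuous fun t => (Φ t).2 :=
  continuous_snd.comp hΦ.continuous

/-- As long as the momentum is negative, the time is the integral of the inverse momentum. -/
theorem IsOrbit.time_eq_integral (hV : ContDiff ℝ 2 V) (hΦ : IsOrbit V Φ) (h0 : Φ 0 = (r, 0))
    (hr : V r = h) (hl : V l = h) (hlr : l < r) {s : ℝ} (hs : 0 < s)
    (hneg : ∀ t ∈ Ioo 0 s, (Φ t).2 < 0) :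
    (Φ s).1 ∈ Ico l r ∧ ∫ x in Ioo (Φ s).1 r, 1 / mom V h x = s := by
  have hen := hΦ.energy_eq' hV h0 hr
  have hanti : StrictAntiOn (fun t => (Φ t).1) (Icc 0 s) :=
    strictAntiOn_of_deriv_neg (convex_Icc 0 s) hΦ.continuous_q.continuousOn fun t ht => by
      rw [interior_Icc] at ht
      rw [(hΦ.hasDerivAt_q t).deriv]; exact hneg t ht
  have hq0 : (Φ 0).1 = r := by rw [h0]
  have hqs : (Φ s).1 < r := by
    rw [← hq0]; exact hanti (left_mem_Icc.2 hs.le) (right_mem_Icc.2 hs.le) hs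
  have himage : (fun t => (Φ t).1) '' Ioo 0 s = Ioo (Φ s).1 r := by
    apply subset_antisymm
    · rintro _ ⟨t, ht, rfl⟩
      exact ⟨hanti (Ioo_subset_Icc_self ht) (right_mem_Icc.2 hs.le) ht.2, by
        rw [← hq0]; exact hanti (left_mem_Icc.2 hs.le) (Ioo_subset_Icc_self ht) ht.1⟩
    · rw [← hq0]
      exact intermediate_value_Ioo' hs.le hΦ.continuous_q.continuousOn
  refine ⟨⟨?_, hqs⟩, ?_⟩
  · by_contra hcon
    have : l ∈ (fun t => (Φ t).1) '' Ioo 0 s := by rw [himage]; exact ⟨not_le.1 hcon, hlr⟩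
    obtain ⟨t, ht, htl⟩ := this
    have h1 := hen t
    simp only at htl
    rw [htl, hl] at h1
    have := hneg t ht
    nlinarith
  · rw [← himage, integral_image_eq_integral_abs_deriv_smul measurableSet_Ioo
      (fun t _ => (hΦ.hasDerivAt_q t).hasDerivWithinAt) (hanti.injOn.mono Ioo_subset_Icc_self)]
    rw [setIntegral_congr_fun (g := fun _ => (1 : ℝ)) measurableSet_Ioo fun t ht => ?_]
    · simp [hs.le]
    · have h1 : mom V h (Φ t).1 = |(Φ t).2| := by
        rw [mom, ← Real.sqrt_sq_eq_abs]
        congr 1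
        linarith [hen t]
      have h2 : |(Φ t).2| ≠ 0 := abs_ne_zero.2 (hneg t ht).ne
      simp only [h1, smul_eq_mul]
      field_simp

/-- The orbit through the right end of a nondegenerate leaf: it reaches the left end at a time `t₁`,
and is symmetric under time reversal at `t₁`. -/
theorem IsOrbit.exists_half_period (hV : ContDiff ℝ 2 V) (hΦ : IsOrbit V Φ) (h0 : Φ 0 = (r, 0))
    (hr : V r = h) (hl : V l = h) (hlr : l < r) (hin : ∀ x ∈ Ioo l r, V x < h)
    (hd : 0 < deriv V r) (hint : IntegrableOn (fun x => 1 / mom V h x) (Ioo l r)) :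
    ∃ t₁ > 0, (∀ t ∈ Ioo 0 t₁, (Φ t).2 < 0) ∧ Φ t₁ = (l, 0) ∧
      ∀ t, Φ (2 * t₁ - t) = ((Φ t).1, -(Φ t).2) := by
  have hp0 : (Φ 0).2 = 0 := by rw [h0]
  have hev : ∀ᶠ t in 𝓝[>] (0 : ℝ), (Φ t).2 < 0 := by
    refine eventually_neg_of_hasDerivAt (hΦ.hasDerivAt_p 0) hp0 ?_
    rw [h0]; linarith
  have hex : ∃ t > 0, (Φ t).2 = 0 := by
    by_contra hcon
    push Not at hcon
    set I := ∫ x in Ioo l r, 1 / mom V h x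
    have hI : 0 ≤ I := integral_nonneg fun x => one_div_nonneg.2 (mom_nonneg _ _ _)
    have hneg := neg_of_ne_zero_of_eventually (b := I + 1) hΦ.continuous_p hev
      fun t ht => hcon t ht.1
    obtain ⟨h1, h2⟩ := hΦ.time_eq_integral hV h0 hr hl hlr (by linarith) hneg
    have h3 : ∫ x in Ioo (Φ (I + 1)).1 r, 1 / mom V h x ≤ I :=
      setIntegral_mono_set hint (ae_of_all _ fun x => one_div_nonneg.2 (mom_nonneg _ _ _))
        (Ioo_subset_Ioo_left h1.1).eventuallyLE
    linarith
  obtain ⟨η, hη, hηneg⟩ := mem_nhdsGT_iff_exists_Ioc_subset.1 hev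
  set Z := {t | η ≤ t ∧ (Φ t).2 = 0} with hZ
  have hZc : IsClosed Z := isClosed_Ici.inter (isClosed_eq hΦ.continuous_p continuous_const)
  have hlow : ∀ t > 0, (Φ t).2 = 0 → t ∈ Z := by
    intro t ht htz
    refine ⟨?_, htz⟩
    by_contra hcon
    have : (Φ t).2 < 0 := hηneg ⟨ht, (not_le.1 hcon).le⟩
    linarith
  have hZne : Z.Nonempty := by
    obtain ⟨t, ht, htz⟩ := hex
    exact ⟨t, hlow t ht htz⟩
  have hZb : BddBelow Z := ⟨η, fun t ht => ht.1⟩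
  have hmem : sInf Z ∈ Z := hZc.csInf_mem hZne hZb
  set t₁ := sInf Z
  have ht₁ : 0 < t₁ := lt_of_lt_of_le hη hmem.1
  have hneg := neg_of_ne_zero_of_eventually (b := t₁) hΦ.continuous_p hev fun t ht htz =>
    absurd (csInf_le hZb (hlow t ht.1 htz)) (not_le.2 ht.2)
  obtain ⟨h1, -⟩ := hΦ.time_eq_integral hV h0 hr hl hlr ht₁ hneg
  have hen := hΦ.energy_eq' hV h0 hr t₁
  rw [hmem.2] at hen
  have hq : (Φ t₁).1 = l := by
    rcases eq_or_lt_of_le h1.1 with h2 | h2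
    · exact h2.symm
    · have := hin _ ⟨h2, h1.2⟩; linarith
  have hΦt : Φ t₁ = (l, 0) := Prod.ext hq hmem.2
  refine ⟨t₁, ht₁, hneg, hΦt, fun t => ?_⟩
  have := (hΦ.reverse (2 * t₁)).eq hV hΦ (a := t₁) (by
    simp only [two_mul, add_sub_cancel_right]
    rw [hΦt]; simp)
  have h2 := congrFun this (2 * t₁ - t)
  simp only [sub_sub_cancel] at h2
  exact h2.symm

end ImpactSystem

namespace ImpactSystem

/-! ### Stability of turning points and wall hits -/

/-- `q' = p`, `p' = -f` on `s`. -/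
def IsMotion (s : Set ℝ) (q p f : ℝ → ℝ) : Prop :=
  ∀ t ∈ s, HasDerivAt q (p t) t ∧ HasDerivAt p (-f t) t

/-- Uniform closeness of two motions on `[0, N]`. -/
def NearMotion (N ξ : ℝ) (q p f q' p' f' : ℝ → ℝ) : Prop :=
  ∀ t ∈ Icc 0 N, |q' t - q t| ≤ ξ ∧ |p' t - p t| ≤ ξ ∧ |f' t - f t| ≤ ξ

theorem NearMotion.mono {N N' ξ ξ' : ℝ} {q p f q' p' f' : ℝ → ℝ}
    (h : NearMotion N ξ q p f q' p' f') (hN : N' ≤ N) (hξ : ξ ≤ ξ') :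
    NearMotion N' ξ' q p f q' p' f' := fun t ht => by
  obtain ⟨h1, h2, h3⟩ := h t ⟨ht.1, ht.2.trans hN⟩
  exact ⟨h1.trans hξ, h2.trans hξ, h3.trans hξ⟩

theorem strictMonoOn_of_hasDerivAt_pos {u u' : ℝ → ℝ} {a b : ℝ}
    (hu : ∀ t ∈ Icc a b, HasDerivAt u (u' t) t) (hpos : ∀ t ∈ Ioo a b, 0 < u' t) :
    StrictMonoOn u (Icc a b) :=
  strictMonoOn_of_deriv_pos (convex_Icc a b)
    (fun t ht => (hu t ht).continuousAt.continuousWithinAt) fun t ht => by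
      rw [interior_Icc] at ht
      rw [(hu t (Ioo_subset_Icc_self ht)).deriv]; exact hpos t ht

theorem mul_abs_sub_le_of_hasDerivAt {u u' : ℝ → ℝ} {a b m : ℝ}
    (hu : ∀ t ∈ Icc a b, HasDerivAt u (u' t) t) (hm : ∀ t ∈ Icc a b, m ≤ u' t) {x y : ℝ}
    (hx : x ∈ Icc a b) (hy : y ∈ Icc a b) : m * |x - y| ≤ |u x - u y| := by
  wlog hxy : y ≤ x generalizing x y
  · rw [abs_sub_comm, abs_sub_comm (u x)]
    exact this hy hx (not_le.1 hxy).le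
  have := (convex_Icc a b).mul_sub_le_image_sub_of_le_deriv (f := u) (C := m)
    (fun t ht => (hu t ht).continuousAt.continuousWithinAt)
    (fun t ht => (hu t (interior_subset ht)).differentiableAt.differentiableWithinAt)
    (fun t ht => by rw [(hu t (interior_subset ht)).deriv]; exact hm t (interior_subset ht))
    y hy x hx hxy
  rw [abs_of_nonneg (sub_nonneg.2 hxy)]
  exact this.trans (le_abs_self _)

/-- A simple zero persists under small perturbations. -/
theorem exists_stable_zero {u f : ℝ → ℝ} (hu : ∀ t, HasDerivAt u (f t) t) (hf : Continuous f)
    {τ σ : ℝ} (hτ : 0 < τ) (hσ : 0 < σ) (h0 : u τ = 0) (hpos : 0 < f τ) :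
    ∃ s > 0, s < τ ∧ s < σ ∧ ∃ m > 0, ∃ ξ > 0, ∀ u' f' : ℝ → ℝ,
      (∀ t ∈ Icc 0 (τ + s), HasDerivAt u' (f' t) t ∧ |u' t - u t| ≤ ξ ∧ |f' t - f t| ≤ ξ) →
      (∀ t ∈ Icc (τ - s) (τ + s), m ≤ f' t) ∧ ∃ t ∈ Ioo (τ - s) (τ + s), u' t = 0 := by
  obtain ⟨d, hd, hball⟩ := Metric.eventually_nhds_iff_ball.1
    (hf.continuousAt.eventually_const_lt (show f τ / 2 < f τ by linarith))
  set s := min (min (d / 2) (τ / 2)) (σ / 2)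
  have hs : 0 < s := by positivity
  have hsd : s ≤ d / 2 := (min_le_left _ _).trans (min_le_left _ _)
  have hsτ : s ≤ τ / 2 := (min_le_left _ _).trans (min_le_right _ _)
  have hsσ : s ≤ σ / 2 := min_le_right _ _
  have hf2 : ∀ t ∈ Icc (τ - s) (τ + s), f τ / 2 ≤ f t := fun t ht => (hball t (by
    rw [Metric.mem_ball, Real.dist_eq, abs_lt]; constructor <;> linarith [ht.1, ht.2])).le
  have hmono := strictMonoOn_of_hasDerivAt_pos (fun t _ => hu t) (a := τ - s) (b := τ + s)
    fun t ht => by linarith [hf2 t (Ioo_subset_Icc_self ht)]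
  have h1 : u (τ - s) < 0 := h0 ▸ hmono ⟨le_rfl, by linarith⟩ ⟨by linarith, by linarith⟩
    (by linarith)
  have h2 : 0 < u (τ + s) := h0 ▸ hmono ⟨by linarith, by linarith⟩ ⟨by linarith, le_rfl⟩
    (by linarith)
  refine ⟨s, hs, by linarith, by linarith, f τ / 4, by linarith,
    min (f τ / 4) (min (-u (τ - s) / 2) (u (τ + s) / 2)), ?_, fun u' f' h => ?_⟩
  · exact lt_min (by linarith) (lt_min (by linarith) (by linarith))
  have hξ1 := min_le_left (f τ / 4) (min (-u (τ - s) / 2) (u (τ + s) / 2))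
  have hξ2 := (min_le_right (f τ / 4) (min (-u (τ - s) / 2) (u (τ + s) / 2))).trans
    (min_le_left _ _)
  have hξ3 := (min_le_right (f τ / 4) (min (-u (τ - s) / 2) (u (τ + s) / 2))).trans
    (min_le_right _ _)
  refine ⟨fun t ht => ?_, ?_⟩
  · have := (abs_le.1 (h t ⟨by linarith [ht.1], ht.2⟩).2.2).1
    linarith [hf2 t ht]
  · refine intermediate_value_Ioo (by linarith) (fun t ht =>
      (h t ⟨by linarith [ht.1], ht.2⟩).1.continuousAt.continuousWithinAt) ⟨?_, ?_⟩
    · have := (abs_le.1 (h (τ - s) ⟨by linarith, by linarith⟩).2.1).2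
      linarith
    · have := (abs_le.1 (h (τ + s) ⟨by linarith, by linarith⟩).2.1).1
      linarith

/-- A positive continuous function on a compact interval stays positive under small
perturbations. -/
theorem exists_stable_pos {g : ℝ → ℝ} (hg : Continuous g) {a b : ℝ} (h : ∀ t ∈ Icc a b, 0 < g t) :
    ∃ ξ > 0, ∀ t ∈ Icc a b, ∀ x, |x - g t| ≤ ξ → 0 < x := by
  obtain ⟨c, hc, hcg⟩ := isCompact_Icc.exists_forall_le' hg.continuousOn h
  refine ⟨c / 2, by linarith, fun t ht x hx => ?_⟩
  linarith [(abs_le.1 hx).1, hcg t ht]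

variable {q p f : ℝ → ℝ}

theorem exists_stable_departure (hf : Continuous f) (h0 : 0 < f 0) :
    ∃ s > 0, ∃ ξ > 0, ∀ q' p' f' : ℝ → ℝ, ∀ N, IsMotion (Icc 0 N) q' p' f' → p' 0 = 0 →
      NearMotion N ξ q p f q' p' f' → ∀ t ∈ Ioc 0 s, t ≤ N → p' t < 0 := by
  obtain ⟨d, hd, hball⟩ := Metric.eventually_nhds_iff_ball.1
    (hf.continuousAt.eventually_const_lt (show f 0 / 2 < f 0 by linarith))
  refine ⟨d / 2, by positivity, f 0 / 4, by positivity, fun q' p' f' N hm hp hnear t ht hN => ?_⟩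
  have hmono := strictMonoOn_of_hasDerivAt_pos (u := fun t => -p' t) (u' := f') (a := 0) (b := t)
    (fun x hx => by
      simpa using (hm x ⟨hx.1, hx.2.trans hN⟩).2.fun_neg)
    (fun x hx => by
      have h1 := (abs_le.1 (hnear x ⟨hx.1.le, hx.2.le.trans hN⟩).2.2).1
      have h2 := hball x (by
        rw [Metric.mem_ball, Real.dist_eq, sub_zero, abs_of_pos hx.1]; linarith [hx.2, ht.2])
      linarith)
  have := hmono (left_mem_Icc.2 ht.1.le) (right_mem_Icc.2 ht.1.le) ht.1
  simp only [hp] at this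
  linarith

/-- Persistence of the hitting of the wall `q = 0` by a motion which starts at rest. -/
theorem exists_stable_hit (hm : IsMotion univ q p f) (hf : Continuous f) {τ : ℝ} (hτ : 0 < τ)
    (hf0 : 0 < f 0) (hneg : ∀ t ∈ Ioc 0 τ, p t < 0) (hq : q τ = 0) :
    ∃ s > 0, s < τ ∧ ∃ m > 0, ∃ ξ > 0, ∀ q' p' f' : ℝ → ℝ, IsMotion (Icc 0 (τ + s)) q' p' f' →
      p' 0 = 0 → NearMotion (τ + s) ξ q p f q' p' f' →
      (∀ t ∈ Icc (τ - s) (τ + s), p' t ≤ -m) ∧ ∃ t ∈ Ioo (τ - s) (τ + s), q' t = 0 ∧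
        (∀ x ∈ Ico 0 t, 0 < q' x) ∧ ∀ x ∈ Ioc 0 t, p' x < 0 := by
  have hpc : Continuous p := continuous_iff_continuousAt.2 fun t => (hm t trivial).2.continuousAt
  obtain ⟨s, hs, hsτ, -, m, hmpos, ξ₁, hξ₁, H⟩ := exists_stable_zero (u := fun t => -q t)
    (f := fun t => -p t) (fun t => (hm t trivial).1.fun_neg) hpc.neg hτ one_pos (by simp [hq])
    (by linarith [hneg τ ⟨hτ, le_rfl⟩])
  obtain ⟨s₁, hs₁, ξ₂, hξ₂, H₂⟩ := exists_stable_departure (q := q) (p := p) hf hf0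
  obtain ⟨ξ₃, hξ₃, H₃⟩ := exists_stable_pos (g := fun t => -p t) hpc.neg (a := min s₁ τ)
    (b := τ)
    fun t ht => by linarith [hneg t ⟨(lt_min hs₁ hτ).trans_le ht.1, ht.2⟩]
  refine ⟨s, hs, hsτ, m, hmpos, min ξ₁ (min ξ₂ ξ₃), by positivity, fun q' p' f' hm' hp' hn => ?_⟩
  have hn₁ := hn.mono le_rfl (min_le_left _ _)
  have hn₂ := hn.mono le_rfl ((min_le_right _ _).trans (min_le_left ξ₂ ξ₃))
  have hn₃ := hn.mono le_rfl ((min_le_right _ _).trans (min_le_right ξ₂ ξ₃))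
  obtain ⟨hwin, t, ht, hqt⟩ := H (fun t => -q' t) (fun t => -p' t) fun t ht =>
    ⟨(hm' t ht).1.fun_neg, by
      rw [neg_sub_neg, abs_sub_comm]; exact (hn₁ t ht).1, by
      rw [neg_sub_neg, abs_sub_comm]; exact (hn₁ t ht).2.1⟩
  have hneg' : ∀ x ∈ Ioc 0 t, p' x < 0 := by
    intro x hx
    rcases le_total x (min s₁ τ) with h1 | h1
    · exact H₂ q' p' f' (τ + s) hm' hp' hn₂ x ⟨hx.1, h1.trans (min_le_left _ _)⟩
        (hx.2.trans ht.2.le)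
    · rcases le_total x τ with h2 | h2
      · have := H₃ x ⟨h1, h2⟩ (-p' x) (by
          rw [neg_sub_neg, abs_sub_comm]
          exact (hn₃ x ⟨hx.1.le, by linarith⟩).2.1)
        linarith
      · have := hwin x ⟨by linarith, by linarith [hx.2, ht.2]⟩
        linarith
  refine ⟨fun t ht => by linarith [hwin t ht], t, ht, by simpa using hqt, fun x hx => ?_, hneg'⟩
  have hanti := strictMonoOn_of_hasDerivAt_pos (u := fun t => -q' t) (a := x) (b := t)
    (fun y hy => (hm' y ⟨hx.1.trans hy.1, hy.2.trans ht.2.le⟩).1.fun_neg)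
    (fun y hy => neg_pos.2 (hneg' y ⟨hx.1.trans_lt hy.1, hy.2.le⟩))
  have := hanti (left_mem_Icc.2 hx.2.le) (right_mem_Icc.2 hx.2.le) hx.2
  simp only at this hqt
  linarith

/-- Persistence of the next turning point of a motion which starts with positive momentum. -/
theorem exists_stable_turn (hm : IsMotion univ q p f) (hf : Continuous f) {τ : ℝ} (hτ : 0 < τ)
    (hpos : ∀ t ∈ Ico 0 τ, 0 < p t) (hp : p τ = 0) (hfτ : 0 < f τ) :
    ∃ s > 0, s < τ ∧ ∃ m > 0, ∃ ξ > 0, ∀ q' p' f' : ℝ → ℝ, IsMotion (Icc 0 (τ + s)) q' p' f' →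
      NearMotion (τ + s) ξ q p f q' p' f' →
      (∀ t ∈ Icc (τ - s) (τ + s), m ≤ f' t) ∧ ∃ t ∈ Ioo (τ - s) (τ + s), p' t = 0 ∧
        ∀ x ∈ Ico 0 t, 0 < p' x := by
  have hpc : Continuous p := continuous_iff_continuousAt.2 fun t => (hm t trivial).2.continuousAt
  obtain ⟨s, hs, hsτ, -, m, hmpos, ξ₁, hξ₁, H⟩ := exists_stable_zero (u := fun t => -p t)
    (f := f) (fun t => by simpa using (hm t trivial).2.fun_neg) hf hτ one_pos (by simp [hp]) hfτ
  obtain ⟨ξ₃, hξ₃, H₃⟩ := exists_stable_pos hpc (a := 0) (b := τ - s)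
    fun t ht => hpos t ⟨ht.1, by linarith [ht.2]⟩
  refine ⟨s, hs, hsτ, m, hmpos, min ξ₁ ξ₃, by positivity, fun q' p' f' hm' hn => ?_⟩
  have hn₁ := hn.mono le_rfl (min_le_left _ _)
  have hn₃ := hn.mono le_rfl (min_le_right _ _)
  have hd : ∀ t ∈ Icc 0 (τ + s), HasDerivAt (fun t => -p' t) (f' t) t := fun t ht => by
    simpa using (hm' t ht).2.fun_neg
  obtain ⟨hwin, t, ht, hpt⟩ := H (fun t => -p' t) f' fun t ht =>
    ⟨hd t ht, by rw [neg_sub_neg, abs_sub_comm]; exact (hn₁ t ht).2.1, (hn₁ t ht).2.2⟩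
  refine ⟨hwin, t, ht, by simpa using hpt, fun x hx => ?_⟩
  rcases le_total x (τ - s) with h1 | h1
  · exact H₃ x ⟨hx.1, h1⟩ _ (hn₃ x ⟨hx.1, by linarith⟩).2.1
  · have hmono := strictMonoOn_of_hasDerivAt_pos (a := x) (b := t)
      (fun y hy => hd y ⟨hx.1.trans hy.1, hy.2.trans ht.2.le⟩)
      (fun y hy => hmpos.trans_le (hwin y ⟨h1.trans hy.1.le, hy.2.le.trans ht.2.le⟩))
    have := hmono (left_mem_Icc.2 hx.2.le) (right_mem_Icc.2 hx.2.le) hx.2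
    simp only at this hpt
    linarith

/-- Persistence of the return to the section `p = 0 < f` in the region `0 < q`. -/
theorem exists_stable_return (hm : IsMotion univ q p f) (hf : Continuous f) {τ : ℝ} (hτ : 0 < τ)
    (hf0 : 0 < f 0) (hp : p τ = 0) (hfτ : 0 < f τ) (hno : ∀ t ∈ Ioo 0 τ, p t ≠ 0 ∨ f t < 0)
    (hq : ∀ t, 0 < q t) :
    ∃ s > 0, s < τ ∧ ∃ m > 0, ∃ ξ > 0, ∀ q' p' f' : ℝ → ℝ, IsMotion (Icc 0 (τ + s)) q' p' f' →
      p' 0 = 0 → NearMotion (τ + s) ξ q p f q' p' f' →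
      (∀ t ∈ Icc (τ - s) (τ + s), m ≤ f' t) ∧ ∃ t ∈ Ioo (τ - s) (τ + s), p' t = 0 ∧
        (∀ x ∈ Ioo 0 t, p' x ≠ 0 ∨ f' x < 0) ∧ ∀ x ∈ Icc 0 t, 0 < q' x := by
  have hpc : Continuous p := continuous_iff_continuousAt.2 fun t => (hm t trivial).2.continuousAt
  have hqc : Continuous q := continuous_iff_continuousAt.2 fun t => (hm t trivial).1.continuousAt
  obtain ⟨s₁, hs₁, ξ₂, hξ₂, H₂⟩ := exists_stable_departure (q := q) (p := p) hf hf0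
  obtain ⟨s, hs, hsτ, -, m, hmpos, ξ₁, hξ₁, H⟩ := exists_stable_zero (u := fun t => -p t)
    (f := f) (fun t => by simpa using (hm t trivial).2.fun_neg) hf hτ one_pos (by simp [hp]) hfτ
  obtain ⟨ξ₃, hξ₃, H₃⟩ := exists_stable_pos hqc (a := 0) (b := τ + s) fun t _ => hq t
  obtain ⟨ξ₄, hξ₄, H₄⟩ := exists_stable_pos (g := fun t => max |p t| (-f t))
    (hpc.abs.max hf.neg) (a := s₁) (b := τ - s) fun t ht => by
      rcases hno t ⟨hs₁.trans_le ht.1, by linarith [ht.2]⟩ with h | h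
      · exact lt_max_of_lt_left (abs_pos.2 h)
      · exact lt_max_of_lt_right (by linarith)
  refine ⟨s, hs, hsτ, m, hmpos, min (min ξ₁ ξ₂) (min ξ₃ ξ₄), by positivity,
    fun q' p' f' hm' hp' hn => ?_⟩
  have hn₁ := hn.mono le_rfl ((min_le_left _ _).trans (min_le_left ξ₁ ξ₂))
  have hn₂ := hn.mono le_rfl ((min_le_left _ _).trans (min_le_right ξ₁ ξ₂))
  have hn₃ := hn.mono le_rfl ((min_le_right _ _).trans (min_le_left ξ₃ ξ₄))
  have hn₄ := hn.mono le_rfl ((min_le_right _ _).trans (min_le_right ξ₃ ξ₄))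
  have hd : ∀ t ∈ Icc 0 (τ + s), HasDerivAt (fun t => -p' t) (f' t) t := fun t ht => by
    simpa using (hm' t ht).2.fun_neg
  obtain ⟨hwin, t, ht, hpt⟩ := H (fun t => -p' t) f' fun t ht =>
    ⟨hd t ht, by rw [neg_sub_neg, abs_sub_comm]; exact (hn₁ t ht).2.1, (hn₁ t ht).2.2⟩
  refine ⟨hwin, t, ht, by simpa using hpt, fun x hx => ?_, fun x hx =>
    H₃ x ⟨hx.1, hx.2.trans ht.2.le⟩ _ (hn₃ x ⟨hx.1, hx.2.trans ht.2.le⟩).1⟩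
  have hxN : x ∈ Icc 0 (τ + s) := ⟨hx.1.le, hx.2.le.trans ht.2.le⟩
  rcases le_total x s₁ with h0 | h0
  · exact Or.inl (H₂ q' p' f' (τ + s) hm' hp' hn₂ x ⟨hx.1, h0⟩ hxN.2).ne
  rcases le_total x (τ - s) with h1 | h1
  · have h2 := (abs_max_sub_max_le_max |p' x| (-f' x) |p x| (-f x)).trans (max_le
      ((abs_abs_sub_abs_le _ _).trans (hn₄ x hxN).2.1)
      (show |(-f' x) - (-f x)| ≤ ξ₄ by
        rw [neg_sub_neg, abs_sub_comm]; exact (hn₄ x hxN).2.2))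
    rcases lt_max_iff.1 (H₄ x ⟨h0, h1⟩ _ h2) with h3 | h3
    · exact Or.inl (abs_pos.1 h3)
    · exact Or.inr (by linarith)
  · have hmono := strictMonoOn_of_hasDerivAt_pos (a := x) (b := t)
      (fun y hy => hd y ⟨hx.1.le.trans hy.1, hy.2.trans ht.2.le⟩)
      (fun y hy => hmpos.trans_le (hwin y ⟨h1.trans hy.1.le, hy.2.le.trans ht.2.le⟩))
    have := hmono (left_mem_Icc.2 hx.2.le) (right_mem_Icc.2 hx.2.le) hx.2
    simp only at this hpt
    exact Or.inl (by linarith : 0 < p' x).ne'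

end ImpactSystem

namespace ImpactSystem

open Metric NNReal MeasureTheory

/-! ### The perturbed vector field -/

section Field

variable {V₁ V₂ : ℝ → ℝ} {Vr : ℝ × ℝ → ℝ}

theorem partial₁_eq_fderiv (h : ContDiff ℝ 2 Vr) (a b : ℝ) :
    partial₁ Vr a b = fderiv ℝ Vr (a, b) (1, 0) := by
  have h1 := (h.differentiable (by norm_num) (a, b)).hasFDerivAt
  have h2 : HasDerivAt (fun x : ℝ => (x, b)) ((1 : ℝ), (0 : ℝ)) a :=
    (hasDerivAt_id a).prodMk (hasDerivAt_const a b)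
  exact (h1.comp_hasDerivAt a h2).deriv

theorem partial₂_eq_fderiv (h : ContDiff ℝ 2 Vr) (a b : ℝ) :
    partial₂ Vr a b = fderiv ℝ Vr (a, b) (0, 1) := by
  have h1 := (h.differentiable (by norm_num) (a, b)).hasFDerivAt
  have h2 : HasDerivAt (fun y : ℝ => (a, y)) ((0 : ℝ), (1 : ℝ)) b :=
    (hasDerivAt_const b a).prodMk (hasDerivAt_id b)
  exact (h1.comp_hasDerivAt b h2).deriv

theorem contDiff_partial₁ (h : ContDiff ℝ 2 Vr) :
    ContDiff ℝ 1 fun x : ℝ × ℝ => partial₁ Vr x.1 x.2 := by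
  simp only [partial₁_eq_fderiv h]
  exact (h.fderiv_right (m := 1) (by rw [one_add_one_eq_two])).clm_apply contDiff_const

theorem contDiff_partial₂ (h : ContDiff ℝ 2 Vr) :
    ContDiff ℝ 1 fun x : ℝ × ℝ => partial₂ Vr x.1 x.2 := by
  simp only [partial₂_eq_fderiv h]
  exact (h.fderiv_right (m := 1) (by rw [one_add_one_eq_two])).clm_apply contDiff_const

/-- The force in the first plane, up to sign. -/
noncomputable def force₁ (V₁ : ℝ → ℝ) (Vr : ℝ × ℝ → ℝ) (ε : ℝ) (x : (ℝ × ℝ) × (ℝ × ℝ)) : ℝ :=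
  deriv V₁ x.1.1 + ε * partial₁ Vr x.1.1 x.2.1

/-- The Hamiltonian vector field at `((q₁, p₁), (q₂, p₂))`. -/
noncomputable def hamField (V₁ V₂ : ℝ → ℝ) (Vr : ℝ × ℝ → ℝ) (ε : ℝ) (x : (ℝ × ℝ) × (ℝ × ℝ)) :
    (ℝ × ℝ) × (ℝ × ℝ) :=
  ((x.1.2, -force₁ V₁ Vr ε x), (x.2.2, -(deriv V₂ x.2.1 + ε * partial₂ Vr x.1.1 x.2.1)))

/-- The rate of change of the energy of the second plane, divided by `-ε`. -/
noncomputable def workRate (Vr : ℝ × ℝ → ℝ) (x : (ℝ × ℝ) × (ℝ × ℝ)) : ℝ :=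
  partial₂ Vr x.1.1 x.2.1 * x.2.2

theorem contDiff_force₁ (h₁ : ContDiff ℝ 2 V₁) (h : ContDiff ℝ 2 Vr) (ε : ℝ) :
    ContDiff ℝ 1 (force₁ V₁ Vr ε) := by
  have h3 := (contDiff_partial₁ h).comp (g := fun x : ℝ × ℝ => partial₁ Vr x.1 x.2)
    (f := fun x : (ℝ × ℝ) × (ℝ × ℝ) => (x.1.1, x.2.1)) (by fun_prop)
  have h4 := (contDiff_deriv h₁).comp (f := fun x : (ℝ × ℝ) × (ℝ × ℝ) => x.1.1) (by fun_prop)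
  exact h4.add (contDiff_const.mul h3)

theorem contDiff_hamField (h₁ : ContDiff ℝ 2 V₁) (h₂ : ContDiff ℝ 2 V₂) (h : ContDiff ℝ 2 Vr)
    (ε : ℝ) : ContDiff ℝ 1 (hamField V₁ V₂ Vr ε) := by
  have h3 := (contDiff_partial₂ h).comp (g := fun x : ℝ × ℝ => partial₂ Vr x.1 x.2)
    (f := fun x : (ℝ × ℝ) × (ℝ × ℝ) => (x.1.1, x.2.1)) (by fun_prop)
  have h4 := (contDiff_deriv h₂).comp (f := fun x : (ℝ × ℝ) × (ℝ × ℝ) => x.2.1) (by fun_prop)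
  have h5 : ContDiff ℝ 1 fun x : (ℝ × ℝ) × (ℝ × ℝ) => x.1.2 := by fun_prop
  have h6 : ContDiff ℝ 1 fun x : (ℝ × ℝ) × (ℝ × ℝ) => x.2.2 := by fun_prop
  exact (h5.prodMk (contDiff_force₁ h₁ h ε).neg).prodMk
    (h6.prodMk (h4.add (contDiff_const.mul h3)).neg)

theorem contDiff_workRate (h : ContDiff ℝ 2 Vr) : ContDiff ℝ 1 (workRate Vr) := by
  have h3 := (contDiff_partial₂ h).comp (g := fun x : ℝ × ℝ => partial₂ Vr x.1 x.2)
    (f := fun x : (ℝ × ℝ) × (ℝ × ℝ) => (x.1.1, x.2.1)) (by fun_prop)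
  have h6 : ContDiff ℝ 1 fun x : (ℝ × ℝ) × (ℝ × ℝ) => x.2.2 := by fun_prop
  exact h3.mul h6

theorem hamField_prod (x y : ℝ × ℝ) :
    hamField V₁ V₂ Vr 0 (x, y) = (planeField V₁ x, planeField V₂ y) := by
  simp [hamField, force₁, planeField]

/-- Solutions of the vector field which is frozen outside of a box. -/
def IsClampedSolution (V₁ V₂ : ℝ → ℝ) (Vr : ℝ × ℝ → ℝ) (R ε : ℝ) (y : ℝ → (ℝ × ℝ) × (ℝ × ℝ)) :
    Prop := ∀ t, HasDerivAt y (hamField V₁ V₂ Vr ε (clamp₄ R (y t))) t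

theorem IsOrbit.isClampedSolution {Φ₁ Φ₂ : ℝ → ℝ × ℝ} (h₁ : IsOrbit V₁ Φ₁) (h₂ : IsOrbit V₂ Φ₂)
    {R : ℝ} (hR₁ : ∀ t, ‖Φ₁ t‖ ≤ R) (hR₂ : ∀ t, ‖Φ₂ t‖ ≤ R) :
    IsClampedSolution V₁ V₂ Vr R 0 fun t => (Φ₁ t, Φ₂ t) := fun t => by
  rw [clamp₄_of_mem (by rw [Prod.norm_def]; exact max_le (hR₁ t) (hR₂ t)), hamField_prod]
  exact (h₁ t).prodMk (h₂ t)

theorem exists_isClampedSolution (h₁ : ContDiff ℝ 2 V₁) (h₂ : ContDiff ℝ 2 V₂)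
    (h : ContDiff ℝ 2 Vr) {R : ℝ} (hR : 0 ≤ R) (ε : ℝ) (x : (ℝ × ℝ) × (ℝ × ℝ)) :
    ∃ y, IsClampedSolution V₁ V₂ Vr R ε y ∧ y 0 = x := by
  obtain ⟨y, h0, hy⟩ := exists_clamped_solution (contDiff_hamField h₁ h₂ h ε)
    (lipschitzWith_clamp₄ R) (clamp₄_mem hR) x
  exact ⟨y, hy, h0⟩

/-- Constants for the comparison of perturbed and unperturbed solutions in a box. -/
structure ComparisonBound (V₁ V₂ : ℝ → ℝ) (Vr : ℝ × ℝ → ℝ) (R N C : ℝ) : Prop where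
  nonneg : 0 ≤ C
  dist_le : ∀ ε y z, IsClampedSolution V₁ V₂ Vr R ε y → IsClampedSolution V₁ V₂ Vr R 0 z →
    ∀ t ∈ Icc 0 N, dist (y t) (z t) ≤ C * (dist (y 0) (z 0) + |ε|)
  force : ∀ ε x x', ‖x‖ ≤ R → ‖x'‖ ≤ R →
    |force₁ V₁ Vr ε x - force₁ V₁ Vr 0 x'| ≤ C * (dist x x' + |ε|)
  work : ∀ x x', ‖x‖ ≤ R → ‖x'‖ ≤ R → |workRate Vr x - workRate Vr x'| ≤ C * dist x x'
  work_le : ∀ x, ‖x‖ ≤ R → |workRate Vr x| ≤ C * |x.2.2|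
  speed : ∀ z, IsClampedSolution V₁ V₂ Vr R 0 z → ∀ s t, dist (z s) (z t) ≤ C * |s - t|

theorem exists_comparisonBound (h₁ : ContDiff ℝ 2 V₁) (h₂ : ContDiff ℝ 2 V₂)
    (h : ContDiff ℝ 2 Vr) {R : ℝ} (hR : 0 ≤ R) (N : ℝ) :
    ∃ C, ComparisonBound V₁ V₂ Vr R N C := by
  have hF := contDiff_hamField h₁ h₂ h 0
  obtain ⟨K, hK⟩ := exists_lipschitzWith_comp_retraction hF (lipschitzWith_clamp₄ R) (clamp₄_mem hR)
  obtain ⟨M, hM⟩ := exists_bound_closedBall hF.continuous R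
  obtain ⟨C₁, hC₁, H₁⟩ := exists_dist_le_mul_of_approx (E := (ℝ × ℝ) × (ℝ × ℝ)) (K := K) N
  obtain ⟨M₁, hM₁⟩ := exists_bound_closedBall (contDiff_partial₁ h).continuous R
  obtain ⟨M₂, hM₂⟩ := exists_bound_closedBall (contDiff_partial₂ h).continuous R
  obtain ⟨K₂, hK₂⟩ := exists_lipschitzOnWith_closedBall (contDiff_force₁ h₁ h 0) R
  obtain ⟨K₃, hK₃⟩ := exists_lipschitzOnWith_closedBall (contDiff_workRate h) R
  have hpair : ∀ x : (ℝ × ℝ) × (ℝ × ℝ), ‖x‖ ≤ R → (x.1.1, x.2.1) ∈ closedBall (0 : ℝ × ℝ) R := by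
    intro x hx
    simp only [Prod.norm_def, sup_le_iff] at hx
    exact mem_closedBall_zero_iff.2 (max_le hx.1.1 hx.2.1)
  have hk : ∀ ε x, ‖x‖ ≤ R →
      dist (hamField V₁ V₂ Vr ε x) (hamField V₁ V₂ Vr 0 x) ≤ (M₁ + M₂) * |ε| := by
    intro ε x hx
    have e1 := hM₁ _ (hpair x hx)
    have e2 := hM₂ _ (hpair x hx)
    simp only [Real.norm_eq_abs] at e1 e2
    simp only [hamField, force₁, Prod.dist_eq, dist_self, Real.dist_eq, zero_mul, add_zero,
      neg_add_rev, sub_neg_eq_add, neg_add_cancel_right, abs_neg, abs_mul, sup_le_iff]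
    have hM1 := M₁.2
    have hM2 := M₂.2
    have := abs_nonneg ε
    refine ⟨⟨by positivity, ?_⟩, by positivity, ?_⟩ <;>
    · rw [mul_comm]
      gcongr
      linarith
  set C := C₁ * (1 + (M₁ + M₂)) + K₂ + K₃ + M₁ + M₂ + M
  have hM0 : (0 : ℝ) ≤ M := M.2
  have hM1 : (0 : ℝ) ≤ M₁ := M₁.2
  have hM2 : (0 : ℝ) ≤ M₂ := M₂.2
  have hK2 : (0 : ℝ) ≤ K₂ := K₂.2
  have hK3 : (0 : ℝ) ≤ K₃ := K₃.2
  have hC' : 0 ≤ C₁ * (1 + (M₁ + M₂)) := by positivity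
  refine ⟨C, by positivity, ?_, ?_, ?_, ?_, ?_⟩
  · intro ε y z hy hz t ht
    have hcl : ∀ x, ‖clamp₄ R x‖ ≤ R := fun x => mem_closedBall_zero_iff.1 (clamp₄_mem hR x)
    have := H₁ _ hK y _ z (dist (y 0) (z 0)) ((M₁ + M₂) * |ε|) hy
      (fun t => hk ε _ (hcl (y t))) hz le_rfl t ht
    refine this.trans ?_
    have hd := dist_nonneg (x := y 0) (y := z 0)
    have he := abs_nonneg ε
    calc C₁ * (dist (y 0) (z 0) + (M₁ + M₂) * |ε|)
        ≤ C₁ * (1 + (M₁ + M₂)) * (dist (y 0) (z 0) + |ε|) := by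
          have : 0 ≤ C₁ * |ε| := by positivity
          have : 0 ≤ C₁ * (M₁ + M₂) * dist (y 0) (z 0) := by positivity
          nlinarith
      _ ≤ C * (dist (y 0) (z 0) + |ε|) := by
          gcongr
          simp only [C]; linarith
  · intro ε x x' hx hx'
    have e1 := hK₂.dist_le_mul x (by simpa using hx) x' (by simpa using hx')
    rw [Real.dist_eq] at e1
    have e2 := hM₁ _ (hpair x hx)
    rw [Real.norm_eq_abs] at e2
    have e3 : force₁ V₁ Vr ε x - force₁ V₁ Vr 0 x'
        = (force₁ V₁ Vr 0 x - force₁ V₁ Vr 0 x') + ε * partial₁ Vr x.1.1 x.2.1 := by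
      simp only [force₁]; ring
    rw [e3]
    refine (abs_add_le _ _).trans ?_
    rw [abs_mul]
    have hd := dist_nonneg (x := x) (y := x')
    calc _ ≤ (K₂ : ℝ) * dist x x' + |ε| * M₁ := by gcongr
      _ ≤ C * dist x x' + |ε| * C := by
        gcongr <;> · simp only [C]; linarith
      _ = _ := by ring
  · intro x x' hx hx'
    have e1 := hK₃.dist_le_mul x (by simpa using hx) x' (by simpa using hx')
    rw [Real.dist_eq] at e1
    refine e1.trans ?_
    gcongr
    simp only [C]; linarith
  · intro x hx
    have e2 := hM₂ _ (hpair x hx)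
    rw [Real.norm_eq_abs] at e2
    rw [workRate, abs_mul]
    gcongr
    refine e2.trans ?_
    simp only [C]; linarith
  · intro z hz s t
    have := convex_univ.norm_image_sub_le_of_norm_hasDerivWithin_le (f := z) (C := M)
      (fun t _ => (hz t).hasDerivWithinAt) (fun t _ => hM _ (clamp₄_mem hR _))
      (mem_univ t) (mem_univ s)
    rw [dist_eq_norm]
    refine this.trans ?_
    rw [Real.norm_eq_abs]
    gcongr
    simp only [C]; linarith

end Field

end ImpactSystem

namespace ImpactSystem

open Metric NNReal MeasureTheory

/-! ### Comparison on a smooth segment -/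

section Segment

variable {V₁ V₂ : ℝ → ℝ} {Vr : ℝ × ℝ → ℝ} {R N C ε : ℝ} {y z : ℝ → (ℝ × ℝ) × (ℝ × ℝ)}

/-- Solutions of Hamilton's equations on a set of times. -/
def IsSolutionOn (V₁ V₂ : ℝ → ℝ) (Vr : ℝ × ℝ → ℝ) (ε : ℝ) (y : ℝ → (ℝ × ℝ) × (ℝ × ℝ))
    (s : Set ℝ) : Prop := ∀ t ∈ s, HasDerivAt y (hamField V₁ V₂ Vr ε (y t)) t

theorem IsSolutionOn.mono {s s' : Set ℝ} (h : IsSolutionOn V₁ V₂ Vr ε y s) (hs : s' ⊆ s) :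
    IsSolutionOn V₁ V₂ Vr ε y s' := fun t ht => h t (hs ht)

theorem IsSolutionOn.isMotion {s : Set ℝ} (h : IsSolutionOn V₁ V₂ Vr ε y s) :
    IsMotion s (fun t => (y t).1.1) (fun t => (y t).1.2) (fun t => force₁ V₁ Vr ε (y t)) :=
  fun t ht => ⟨hasDerivAt_fst (ContinuousLinearMap.fst ℝ (ℝ × ℝ) (ℝ × ℝ)
      |>.hasFDerivAt.comp_hasDerivAt t (h t ht)),
    hasDerivAt_snd (ContinuousLinearMap.fst ℝ (ℝ × ℝ) (ℝ × ℝ)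
      |>.hasFDerivAt.comp_hasDerivAt t (h t ht))⟩

theorem IsSolutionOn.hasDerivAt_plane₂ {s : Set ℝ} (h : IsSolutionOn V₁ V₂ Vr ε y s) :
    ∀ t ∈ s, HasDerivAt (fun t => (y t).2)
      ((y t).2.2, -(deriv V₂ (y t).2.1 + ε * partial₂ Vr (y t).1.1 (y t).2.1)) t :=
  fun t ht => ContinuousLinearMap.snd ℝ (ℝ × ℝ) (ℝ × ℝ)
      |>.hasFDerivAt.comp_hasDerivAt t (h t ht)

theorem IsClampedSolution.isSolutionOn {s : Set ℝ} (h : IsClampedSolution V₁ V₂ Vr R ε y)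
    (hR : ∀ t ∈ s, ‖y t‖ ≤ R) : IsSolutionOn V₁ V₂ Vr ε y s := fun t ht => by
  have := h t
  rwa [clamp₄_of_mem (hR t ht)] at this

theorem abs_fst_fst_sub_le (x x' : (ℝ × ℝ) × (ℝ × ℝ)) : |x.1.1 - x'.1.1| ≤ dist x x' := by
  rw [← Real.dist_eq, Prod.dist_eq, Prod.dist_eq]
  exact (le_max_left _ _).trans (le_max_left _ _)

theorem abs_fst_snd_sub_le (x x' : (ℝ × ℝ) × (ℝ × ℝ)) : |x.1.2 - x'.1.2| ≤ dist x x' := by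
  rw [← Real.dist_eq, Prod.dist_eq, Prod.dist_eq]
  exact (le_max_right _ _).trans (le_max_left _ _)

theorem abs_snd_fst_sub_le (x x' : (ℝ × ℝ) × (ℝ × ℝ)) : |x.2.1 - x'.2.1| ≤ dist x x' := by
  rw [← Real.dist_eq, Prod.dist_eq, Prod.dist_eq]
  exact (le_max_left _ _).trans (le_max_right _ _)

theorem ComparisonBound.norm_le (B : ComparisonBound V₁ V₂ Vr R N C)
    (hy : IsClampedSolution V₁ V₂ Vr R ε y) (hz : IsClampedSolution V₁ V₂ Vr R 0 z)
    (hzR : ∀ t, ‖z t‖ ≤ R - 1) (hD : C * (dist (y 0) (z 0) + |ε|) ≤ 1) :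
    ∀ t ∈ Icc 0 N, ‖y t‖ ≤ R := fun t ht => by
  have h1 := (B.dist_le ε y z hy hz t ht).trans hD
  rw [dist_eq_norm] at h1
  have h2 := norm_le_norm_add_norm_sub' (y t) (z t)
  linarith [hzR t]

theorem ComparisonBound.nearMotion (B : ComparisonBound V₁ V₂ Vr R N C)
    (hy : IsClampedSolution V₁ V₂ Vr R ε y) (hz : IsClampedSolution V₁ V₂ Vr R 0 z)
    (hyR : ∀ t ∈ Icc 0 N, ‖y t‖ ≤ R) (hzR : ∀ t, ‖z t‖ ≤ R) :
    NearMotion N ((C ^ 2 + 2 * C) * (dist (y 0) (z 0) + |ε|))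
      (fun t => (z t).1.1) (fun t => (z t).1.2) (fun t => force₁ V₁ Vr 0 (z t))
      (fun t => (y t).1.1) (fun t => (y t).1.2) (fun t => force₁ V₁ Vr ε (y t)) := by
  intro t ht
  have h1 := B.dist_le ε y z hy hz t ht
  have h2 := B.force ε (y t) (z t) (hyR t ht) (hzR t)
  have hC := B.nonneg
  have hd := dist_nonneg (x := y 0) (y := z 0)
  have he := abs_nonneg ε
  have h3 : C * (dist (y 0) (z 0) + |ε|) ≤ (C ^ 2 + 2 * C) * (dist (y 0) (z 0) + |ε|) := by
    gcongr
    nlinarith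
  refine ⟨(abs_fst_fst_sub_le _ _).trans (h1.trans h3), (abs_fst_snd_sub_le _ _).trans
    (h1.trans h3), h2.trans ?_⟩
  calc C * (dist (y t) (z t) + |ε|) ≤ C * (C * (dist (y 0) (z 0) + |ε|) + |ε|) := by gcongr
    _ ≤ _ := by nlinarith [mul_nonneg hC hd, mul_nonneg hC he]

/-- The work of the perturbation on a segment, compared with the unperturbed integral. -/
theorem ComparisonBound.work_segment (B : ComparisonBound V₁ V₂ Vr R N C) (hV₂ : ContDiff ℝ 2 V₂)
    (hVr : ContDiff ℝ 2 Vr)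
    (hy : IsClampedSolution V₁ V₂ Vr R ε y) (hz : IsClampedSolution V₁ V₂ Vr R 0 z)
    (hyR : ∀ t ∈ Icc 0 N, ‖y t‖ ≤ R) (hzR : ∀ t, ‖z t‖ ≤ R) {T T' L : ℝ} (hT : T ∈ Icc 0 N)
    (hTT' : |T - T'| ≤ L * (dist (y 0) (z 0) + |ε|)) :
    dist (y T) (z T') ≤ (C + C * L) * (dist (y 0) (z 0) + |ε|) ∧
    |planeEnergy V₂ (y T).2 - planeEnergy V₂ (y 0).2 + ε * ∫ t in (0 : ℝ)..T', workRate Vr (z t)|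
      ≤ (N * C ^ 2 + C * R * L) * (|ε| * (dist (y 0) (z 0) + |ε|)) := by
  have hC := B.nonneg
  set D := dist (y 0) (z 0) + |ε|
  have hD : 0 ≤ D := add_nonneg dist_nonneg (abs_nonneg _)
  have hR : 0 ≤ R := (norm_nonneg _).trans (hzR 0)
  constructor
  · calc dist (y T) (z T') ≤ dist (y T) (z T) + dist (z T) (z T') := dist_triangle _ _ _
      _ ≤ C * D + C * (L * D) := by
        gcongr
        · exact B.dist_le ε y z hy hz T hT
        · exact (B.speed z hz _ _).trans (by gcongr)
      _ = _ := by ring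
  have hyc : Continuous y := continuous_iff_continuousAt.2 fun t => (hy t).continuousAt
  have hzc : Continuous z := continuous_iff_continuousAt.2 fun t => (hz t).continuousAt
  have hgc := (contDiff_workRate hVr).continuous
  have hys := hy.isSolutionOn hyR
  have hint : ∀ a b, IntervalIntegrable (fun t => workRate Vr (y t)) volume a b :=
    fun a b => (hgc.comp hyc).intervalIntegrable a b
  have hintz : ∀ a b, IntervalIntegrable (fun t => workRate Vr (z t)) volume a b :=
    fun a b => (hgc.comp hzc).intervalIntegrable a b
  have h1 : ∫ t in (0 : ℝ)..T, -ε * workRate Vr (y t)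
      = planeEnergy V₂ (y T).2 - planeEnergy V₂ (y 0).2 := by
    refine intervalIntegral.integral_eq_sub_of_hasDerivAt (f := fun t => planeEnergy V₂ (y t).2)
      (fun t ht => ?_) ((hint _ _).const_mul _)
    rw [uIcc_of_le hT.1] at ht
    convert! hasDerivAt_planeEnergy hV₂ (hys.hasDerivAt_plane₂ t ⟨ht.1, ht.2.trans hT.2⟩) using 1
    simp only [workRate]; ring
  have h2 : ‖∫ t in (0 : ℝ)..T, (workRate Vr (y t) - workRate Vr (z t))‖
      ≤ C * (C * D) * |T - 0| := by
    refine intervalIntegral.norm_integral_le_of_norm_le_const fun t ht => ?_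
    rw [uIoc_of_le hT.1] at ht
    have ht' : t ∈ Icc 0 N := ⟨ht.1.le, ht.2.trans hT.2⟩
    refine (B.work _ _ (hyR t ht') (hzR t)).trans ?_
    gcongr
    exact B.dist_le ε y z hy hz t ht'
  have h3 : ‖∫ t in T'..T, workRate Vr (z t)‖ ≤ C * R * |T - T'| := by
    refine intervalIntegral.norm_integral_le_of_norm_le_const fun t ht => ?_
    refine (B.work_le _ (hzR t)).trans ?_
    gcongr
    exact (norm_snd_le _).trans ((norm_snd_le _).trans (hzR t))
  have h4 : planeEnergy V₂ (y T).2 - planeEnergy V₂ (y 0).2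
        + ε * ∫ t in (0 : ℝ)..T', workRate Vr (z t)
      = -ε * ((∫ t in (0 : ℝ)..T, (workRate Vr (y t) - workRate Vr (z t)))
        + ∫ t in T'..T, workRate Vr (z t)) := by
    rw [← h1, intervalIntegral.integral_const_mul, intervalIntegral.integral_sub (hint _ _)
      (hintz _ _), ← intervalIntegral.integral_add_adjacent_intervals (hintz 0 T') (hintz T' T)]
    ring
  rw [h4, abs_mul, abs_neg]
  rw [Real.norm_eq_abs] at h2 h3
  have h5 : |T - 0| ≤ N := by rw [sub_zero, abs_of_nonneg hT.1]; exact hT.2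
  calc |ε| * |(∫ t in (0 : ℝ)..T, (workRate Vr (y t) - workRate Vr (z t)))
        + ∫ t in T'..T, workRate Vr (z t)|
      ≤ |ε| * (C * (C * D) * N + C * R * (L * D)) := by
        gcongr
        refine (abs_add_le _ _).trans (add_le_add (h2.trans ?_) (h3.trans ?_))
        · gcongr
        · gcongr
    _ = _ := by ring

end Segment

end ImpactSystem

namespace ImpactSystem

/-! ### Impact trajectories and first returns -/

section Impact

variable {V₁ V₂ : ℝ → ℝ} {Vr : ℝ × ℝ → ℝ} {ε : ℝ}

/-- The phase point with coordinates `((q₁, p₁), (q₂, p₂))`. -/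
def toPhase (x : (ℝ × ℝ) × (ℝ × ℝ)) : Phase := ⟨x.1.1, x.1.2, x.2.1, x.2.2⟩

/-- The coordinates `((q₁, p₁), (q₂, p₂))` of a phase point. -/
def ofPhase (x : Phase) : (ℝ × ℝ) × (ℝ × ℝ) := ((x.q₁, x.p₁), (x.q₂, x.p₂))

theorem toPhase_ofPhase (x : Phase) : toPhase (ofPhase x) = x := rfl

/-- Elastic reflection. -/
def reflectWall (x : (ℝ × ℝ) × (ℝ × ℝ)) : (ℝ × ℝ) × (ℝ × ℝ) := ((x.1.1, -x.1.2), x.2)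

theorem mem_section₀_toPhase {x : (ℝ × ℝ) × (ℝ × ℝ)} :
    toPhase x ∈ section₀ V₁ Vr ε ↔ x.1.2 = 0 ∧ 0 < force₁ V₁ Vr ε x := by
  simp only [section₀, toPhase, force₁, mem_ofPred_eq, Left.neg_neg_iff]

theorem IsSolutionOn.isImpactTrajectory {y : ℝ → (ℝ × ℝ) × (ℝ × ℝ)} {T : ℝ}
    (hy : IsSolutionOn V₁ V₂ Vr ε y (Icc 0 T)) (hq : ∀ t ∈ Icc 0 T, 0 ≤ (y t).1.1) :
    IsImpactTrajectory V₁ V₂ Vr ε T fun t => toPhase (y t) where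
  domain := hq
  continuous_q₁ t ht := (hy.isMotion t ht).1.continuousAt.continuousWithinAt
  deriv_q₂ t ht := (hasDerivAt_fst (hy.hasDerivAt_plane₂ t ht)).hasDerivWithinAt
  deriv_p₂ t ht := (hasDerivAt_snd (hy.hasDerivAt_plane₂ t ht)).hasDerivWithinAt
  impacts := ⟨∅, by simp, by simp, fun t ht _ =>
    ⟨(hy.isMotion t ht).1.hasDerivWithinAt, (hy.isMotion t ht).2.hasDerivWithinAt⟩⟩

theorem continuousAt_glue {f g : ℝ → ℝ} {τ : ℝ} (hf : ContinuousAt f τ) (hg : ContinuousAt g 0)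
    (h : f τ = g 0) : ContinuousAt (fun s => if s < τ then f s else g (s - τ)) τ := by
  have hg' : ContinuousAt (fun s => g (s - τ)) τ :=
    ContinuousAt.comp (f := fun s => s - τ) (by simpa using hg) (by fun_prop)
  rw [continuousAt_iff_continuous_left'_right']
  constructor
  · refine (hf.continuousWithinAt (s := Iio τ)).congr_of_eventuallyEq ?_ (by simp [h])
    filter_upwards [self_mem_nhdsWithin] with s hs
    exact if_pos hs
  · refine (hg'.continuousWithinAt (s := Ioi τ)).congr_of_eventuallyEq ?_ (by simp)
    filter_upwards [self_mem_nhdsWithin] with s hs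
    exact if_neg (not_lt.2 (le_of_lt hs))

theorem hasDerivAt_glue {f g f' g' : ℝ → ℝ} {τ T : ℝ}
    (hf : ∀ t ∈ Icc 0 τ, HasDerivAt f (f' t) t) (hg : ∀ t ∈ Icc 0 T, HasDerivAt g (g' t) t)
    {t : ℝ} (ht : t ∈ Icc 0 (τ + T)) (h : t = τ → f τ = g 0 ∧ f' τ = g' 0) :
    HasDerivAt (fun s => if s < τ then f s else g (s - τ))
      (if t < τ then f' t else g' (t - τ)) t := by
  rcases lt_trichotomy t τ with htτ | htτ | htτ
  · rw [if_pos htτ]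
    refine (hf t ⟨ht.1, htτ.le⟩).congr_of_eventuallyEq ?_
    filter_upwards [Iio_mem_nhds htτ] with s hs
    exact if_pos hs
  · obtain ⟨h1, h2⟩ := h htτ
    subst htτ
    have hT : 0 ≤ T := by linarith [ht.2]
    have hfd := hf t ⟨ht.1, le_rfl⟩
    have hgd : HasDerivAt (fun s => g (s - t)) (g' 0) t := by
      have := hg 0 ⟨le_rfl, hT⟩
      rw [← sub_self t] at this
      simpa using this.comp_sub_const t t
    rw [if_neg (lt_irrefl _), sub_self]
    have hl : HasDerivWithinAt (fun s => if s < t then f s else g (s - t)) (g' 0) (Iic t) t := by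
      rw [← h2]
      refine hfd.hasDerivWithinAt.congr_of_eventuallyEq ?_ (by simp [h1])
      filter_upwards [self_mem_nhdsWithin] with s hs
      rcases eq_or_lt_of_le (show s ≤ t from hs) with h3 | h3
      · simp [h3, h1]
      · exact if_pos h3
    have hr : HasDerivWithinAt (fun s => if s < t then f s else g (s - t)) (g' 0) (Ici t) t := by
      refine hgd.hasDerivWithinAt.congr_of_eventuallyEq ?_ (by simp)
      filter_upwards [self_mem_nhdsWithin] with s hs
      exact if_neg (not_lt.2 hs)
    simpa using hl.union hr
  · rw [if_neg htτ.le.not_gt]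
    refine ((hg (t - τ) ⟨by linarith, by linarith [ht.2]⟩).comp_sub_const t τ).congr_of_eventuallyEq ?_
    filter_upwards [Ioi_mem_nhds htτ] with s hs
    exact if_neg (not_lt.2 (le_of_lt hs))

/-- Two smooth segments joined by an elastic reflection form an impact trajectory. -/
theorem isImpactTrajectory_glue {y w : ℝ → (ℝ × ℝ) × (ℝ × ℝ)} {τ T : ℝ} (hτ : 0 < τ) (hT : 0 ≤ T)
    (hy : IsSolutionOn V₁ V₂ Vr ε y (Icc 0 τ)) (hw : IsSolutionOn V₁ V₂ Vr ε w (Icc 0 T))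
    (hyq : ∀ t ∈ Icc 0 τ, 0 ≤ (y t).1.1) (hwq : ∀ t ∈ Icc 0 T, 0 ≤ (w t).1.1)
    (hq : (y τ).1.1 = 0) (hp : (y τ).1.2 < 0) (h0 : w 0 = reflectWall (y τ)) :
    IsImpactTrajectory V₁ V₂ Vr ε (τ + T)
      fun t => toPhase (if t < τ then y t else w (t - τ)) := by
  have hτm : τ ∈ Icc 0 τ := ⟨hτ.le, le_rfl⟩
  have h0m : (0 : ℝ) ∈ Icc 0 T := ⟨le_rfl, hT⟩
  have e1 : ∀ t, (toPhase (if t < τ then y t else w (t - τ))).q₁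
      = if t < τ then (y t).1.1 else (w (t - τ)).1.1 := fun t => by split_ifs <;> rfl
  have e2 : ∀ t, (toPhase (if t < τ then y t else w (t - τ))).p₁
      = if t < τ then (y t).1.2 else (w (t - τ)).1.2 := fun t => by split_ifs <;> rfl
  have e3 : ∀ t, (toPhase (if t < τ then y t else w (t - τ))).q₂
      = if t < τ then (y t).2.1 else (w (t - τ)).2.1 := fun t => by split_ifs <;> rfl
  have e4 : ∀ t, (toPhase (if t < τ then y t else w (t - τ))).p₂
      = if t < τ then (y t).2.2 else (w (t - τ)).2.2 := fun t => by split_ifs <;> rfl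
  have c1 : (y τ).1.1 = (w 0).1.1 := by rw [h0]; rfl
  have c2 : (y τ).2 = (w 0).2 := by rw [h0]; rfl
  have hmem : ∀ t ∈ Icc 0 (τ + T), ¬ t < τ → t - τ ∈ Icc 0 T := fun t ht h =>
    ⟨by linarith, by linarith [ht.2]⟩
  have hcont : ContinuousAt (fun s => if s < τ then (y s).1.1 else (w (s - τ)).1.1) τ :=
    continuousAt_glue (f := fun s => (y s).1.1) (g := fun s => (w s).1.1)
      (hy.isMotion τ hτm).1.continuousAt (hw.isMotion 0 h0m).1.continuousAt c1
  have hd1 : ∀ t ∈ Icc 0 (τ + T), t ≠ τ →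
      HasDerivAt (fun s => if s < τ then (y s).1.1 else (w (s - τ)).1.1)
        (if t < τ then (y t).1.2 else (w (t - τ)).1.2) t := fun t ht hne =>
    hasDerivAt_glue (f := fun s => (y s).1.1) (g := fun s => (w s).1.1) (f' := fun s => (y s).1.2)
      (g' := fun s => (w s).1.2) (fun t ht => (hy.isMotion t ht).1)
      (fun t ht => (hw.isMotion t ht).1) ht fun h => absurd h hne
  refine ⟨fun t ht => ?_, ?_, fun t ht => ?_, fun t ht => ?_, {τ}, ?_, ?_, ?_⟩
  · rw [e1]
    split_ifs with h
    · exact hyq t ⟨ht.1, h.le⟩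
    · exact hwq _ (hmem t ht h)
  · simp only [e1]
    intro t ht
    rcases eq_or_ne t τ with h | h
    · rw [h]; exact hcont.continuousWithinAt
    · exact (hd1 t ht h).continuousAt.continuousWithinAt
  · simp only [e3, e4]
    exact (hasDerivAt_glue (f := fun s => (y s).2.1) (g := fun s => (w s).2.1)
      (f' := fun s => (y s).2.2) (g' := fun s => (w s).2.2)
      (fun t ht => hasDerivAt_fst (hy.hasDerivAt_plane₂ t ht))
      (fun t ht => hasDerivAt_fst (hw.hasDerivAt_plane₂ t ht)) ht
      fun _ => by simp [c2]).hasDerivWithinAt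
  · simp only [e1, e3, e4]
    have := (hasDerivAt_glue (f := fun s => (y s).2.2) (g := fun s => (w s).2.2)
      (f' := fun t => -(deriv V₂ (y t).2.1 + ε * partial₂ Vr (y t).1.1 (y t).2.1))
      (g' := fun t => -(deriv V₂ (w t).2.1 + ε * partial₂ Vr (w t).1.1 (w t).2.1))
      (fun t ht => hasDerivAt_snd (hy.hasDerivAt_plane₂ t ht))
      (fun t ht => hasDerivAt_snd (hw.hasDerivAt_plane₂ t ht)) ht
      fun _ => by simp [c2, c1]).hasDerivWithinAt (s := Icc 0 (τ + T))
    convert! this using 1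
    split_ifs <;> rfl
  · simp [hτ, hT]
  · intro t ht
    obtain rfl : t = τ := by simpa using ht
    refine ⟨?_, ?_, ?_, ?_⟩
    · rw [e1]; simp only [lt_irrefl, if_false, sub_self, ← c1, hq]
    · rw [e2]; simp only [lt_irrefl, if_false, sub_self, h0, reflectWall]
      linarith
    · simp only [e2]; simp only [lt_irrefl, if_false, sub_self, h0, reflectWall, neg_neg]
      refine ((hy.isMotion t hτm).2.continuousAt.tendsto.mono_left nhdsWithin_le_nhds).congr' ?_
      filter_upwards [self_mem_nhdsWithin] with s hs
      exact (if_pos hs).symm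
    · simp only [e2]
      have : ContinuousAt (fun s => (w (s - t)).1.2) t :=
        ContinuousAt.comp (f := fun s => s - t) (g := fun s => (w s).1.2)
          (by simpa using (hw.isMotion 0 h0m).2.continuousAt) (by fun_prop)
      refine this.continuousWithinAt.congr (fun s hs => if_neg (not_lt.2 hs.1)) (by simp)
  · intro t ht hne
    have hne : t ≠ τ := by simpa using hne
    simp only [e1, e2, e3]
    refine ⟨(hd1 t ht hne).hasDerivWithinAt, ?_⟩
    have := (hasDerivAt_glue (f := fun s => (y s).1.2) (g := fun s => (w s).1.2)
      (f' := fun t => -force₁ V₁ Vr ε (y t)) (g' := fun t => -force₁ V₁ Vr ε (w t))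
      (fun t ht => (hy.isMotion t ht).2) (fun t ht => (hw.isMotion t ht).2) ht
      fun h => absurd h hne).hasDerivWithinAt (s := Icc 0 (τ + T))
    convert! this using 1
    split_ifs <;> rfl

theorem IsImpactTrajectory.eqOn_of_no_impact (hV₁ : ContDiff ℝ 2 V₁) (hV₂ : ContDiff ℝ 2 V₂)
    (hVr : ContDiff ℝ 2 Vr) {T : ℝ} {z : ℝ → Phase} (hz : IsImpactTrajectory V₁ V₂ Vr ε T z)
    {S : Finset ℝ} (hS : ∀ t ∈ S, (z t).q₁ = 0 ∧ 0 < (z t).p₁ ∧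
      Tendsto (fun s => (z s).p₁) (𝓝[<] t) (𝓝 (-(z t).p₁)) ∧
      ContinuousWithinAt (fun s => (z s).p₁) (Icc t T) t)
    (hS' : ∀ t ∈ Icc 0 T, t ∉ S →
      HasDerivWithinAt (fun s => (z s).q₁) (z t).p₁ (Icc 0 T) t ∧
      HasDerivWithinAt (fun s => (z s).p₁)
        (-(deriv V₁ (z t).q₁ + ε * partial₁ Vr (z t).q₁ (z t).q₂)) (Icc 0 T) t)
    {a b : ℝ} (ha : 0 ≤ a) (hb : b ≤ T) {y : ℝ → (ℝ × ℝ) × (ℝ × ℝ)}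
    (hy : IsSolutionOn V₁ V₂ Vr ε y (Icc a b)) (hya : z a = toPhase (y a))
    (hno : ∀ t ∈ Ioc a b, t ∉ S) : ∀ t ∈ Icc a b, z t = toPhase (y t) := by
  have hsub : Icc a b ⊆ Icc 0 T := Icc_subset_Icc ha hb
  have hF := contDiff_hamField hV₁ hV₂ hVr ε
  have := eqOn_of_hasDerivAt_Ioo hF.continuous (exists_lipschitzOnWith_closedBall hF)
    (f := fun t => ofPhase (z t)) (g := y) (a := a) (b := b) ?_ ?_
    (fun t ht => (hy t ht).continuousAt.continuousWithinAt)
    (fun t ht => hy t (Ioo_subset_Icc_self ht)) (by rw [hya]; rfl)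
  · intro t ht
    rw [← this ht]; rfl
  · intro t ht
    have h1 := (hz.continuous_q₁ t (hsub ht)).mono hsub
    have h3 := ((hz.deriv_q₂ t (hsub ht)).continuousWithinAt).mono hsub
    have h4 := ((hz.deriv_p₂ t (hsub ht)).continuousWithinAt).mono hsub
    have h2 : ContinuousWithinAt (fun s => (z s).p₁) (Icc a b) t := by
      by_cases h : t ∈ S
      · have hta : t = a := by
          by_contra hne
          exact hno t ⟨lt_of_le_of_ne ht.1 (Ne.symm hne), ht.2⟩ h
        subst hta
        exact (hS t h).2.2.2.mono (Icc_subset_Icc_right hb)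
      · exact (hS' t (hsub ht) h).2.continuousWithinAt.mono hsub
    exact (h1.prodMk h2).prodMk (h3.prodMk h4)
  · intro t ht
    have hn : Icc 0 T ∈ 𝓝 t := Icc_mem_nhds (ha.trans_lt ht.1) (ht.2.trans_le hb)
    have htm := hsub (Ioo_subset_Icc_self ht)
    obtain ⟨h1, h2⟩ := hS' t htm (hno t (Ioo_subset_Ioc_self ht))
    exact ((h1.hasDerivAt hn).prodMk (h2.hasDerivAt hn)).prodMk
      (((hz.deriv_q₂ t htm).hasDerivAt hn).prodMk ((hz.deriv_p₂ t htm).hasDerivAt hn))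

/-- Two functions which agree to the left of a point and are left-continuous agree at the point. -/
theorem eq_of_eqOn_Ico {α : Type*} [TopologicalSpace α] [T2Space α] {f g : ℝ → α} {a b : ℝ}
    (hab : a < b) (hf : ContinuousWithinAt f (Icc a b) b) (hg : ContinuousWithinAt g (Icc a b) b)
    (h : ∀ t ∈ Ico a b, f t = g t) : f b = g b := by
  have hl : 𝓝[Ico a b] b ≤ 𝓝[Icc a b] b := nhdsWithin_mono _ Ico_subset_Icc_self
  have hne : (𝓝[Ico a b] b).NeBot := by
    rw [nhdsWithin_Ico_eq_nhdsLT hab]; infer_instance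
  refine tendsto_nhds_unique ((hf.tendsto.mono_left hl).congr' ?_) (hg.tendsto.mono_left hl)
  filter_upwards [self_mem_nhdsWithin] with t ht using h t ht

/-- An impact trajectory follows a solution as long as the latter stays in `0 < q₁`. -/
theorem IsImpactTrajectory.eqOn_of_pos (hV₁ : ContDiff ℝ 2 V₁) (hV₂ : ContDiff ℝ 2 V₂)
    (hVr : ContDiff ℝ 2 Vr) {T : ℝ} {z : ℝ → Phase} (hz : IsImpactTrajectory V₁ V₂ Vr ε T z)
    {S : Finset ℝ} (hS : ∀ t ∈ S, (z t).q₁ = 0 ∧ 0 < (z t).p₁ ∧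
      Tendsto (fun s => (z s).p₁) (𝓝[<] t) (𝓝 (-(z t).p₁)) ∧
      ContinuousWithinAt (fun s => (z s).p₁) (Icc t T) t)
    (hS' : ∀ t ∈ Icc 0 T, t ∉ S →
      HasDerivWithinAt (fun s => (z s).q₁) (z t).p₁ (Icc 0 T) t ∧
      HasDerivWithinAt (fun s => (z s).p₁)
        (-(deriv V₁ (z t).q₁ + ε * partial₁ Vr (z t).q₁ (z t).q₂)) (Icc 0 T) t)
    {a b : ℝ} (ha : 0 ≤ a) (hb : b ≤ T) {y : ℝ → (ℝ × ℝ) × (ℝ × ℝ)}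
    (hy : IsSolutionOn V₁ V₂ Vr ε y (Icc a b)) (hya : z a = toPhase (y a))
    (hpos : ∀ t ∈ Ioc a b, 0 < (y t).1.1) :
    (∀ t ∈ Ioc a b, t ∉ S) ∧ ∀ t ∈ Icc a b, z t = toPhase (y t) := by
  have hno : ∀ t ∈ Ioc a b, t ∉ S := by
    by_contra! hcon
    obtain ⟨t₀, ht₀, ht₀S⟩ := hcon
    set S' := S.filter (· ∈ Ioc a b)
    have hne : S'.Nonempty := ⟨t₀, Finset.mem_filter.2 ⟨ht₀S, ht₀⟩⟩
    obtain ⟨hsS, hsm⟩ := Finset.mem_filter.1 (S'.min'_mem hne)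
    set s := S'.min' hne
    have hbefore : ∀ t ∈ Ico a s, (z t).q₁ = (y t).1.1 := by
      intro t ht
      have := hz.eqOn_of_no_impact hV₁ hV₂ hVr hS hS' ha (ht.2.le.trans (hsm.2.trans hb))
        (hy.mono (Icc_subset_Icc_right (ht.2.le.trans hsm.2))) hya
        (fun u hu huS => absurd (S'.min'_le u (Finset.mem_filter.2
          ⟨huS, hu.1, hu.2.trans (ht.2.le.trans hsm.2)⟩)) (not_le.2 (hu.2.trans_lt ht.2)))
        t ⟨ht.1, le_rfl⟩
      rw [this]; rfl
    have := eq_of_eqOn_Ico hsm.1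
      ((hz.continuous_q₁ s ⟨ha.trans hsm.1.le, hsm.2.trans hb⟩).mono
        (Icc_subset_Icc ha (hsm.2.trans hb)))
      (hy.isMotion s (Ioc_subset_Icc_self hsm)).1.continuousAt.continuousWithinAt hbefore
    have h1 := (hS s hsS).1
    have h2 := hpos s hsm
    linarith
  exact ⟨hno, hz.eqOn_of_no_impact hV₁ hV₂ hVr hS hS' ha hb hy hya hno⟩

/-- An impact trajectory is reflected where the solution hits the wall transversally. -/
theorem IsImpactTrajectory.reflect_of_hit (hV₁ : ContDiff ℝ 2 V₁) (hV₂ : ContDiff ℝ 2 V₂)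
    (hVr : ContDiff ℝ 2 Vr) {T : ℝ} {z : ℝ → Phase} (hz : IsImpactTrajectory V₁ V₂ Vr ε T z)
    {S : Finset ℝ} (hS : ∀ t ∈ S, (z t).q₁ = 0 ∧ 0 < (z t).p₁ ∧
      Tendsto (fun s => (z s).p₁) (𝓝[<] t) (𝓝 (-(z t).p₁)) ∧
      ContinuousWithinAt (fun s => (z s).p₁) (Icc t T) t)
    (hS' : ∀ t ∈ Icc 0 T, t ∉ S →
      HasDerivWithinAt (fun s => (z s).q₁) (z t).p₁ (Icc 0 T) t ∧
      HasDerivWithinAt (fun s => (z s).p₁)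
        (-(deriv V₁ (z t).q₁ + ε * partial₁ Vr (z t).q₁ (z t).q₂)) (Icc 0 T) t)
    {τ : ℝ} (hτ : 0 < τ) (hτT : τ ≤ T) {y : ℝ → (ℝ × ℝ) × (ℝ × ℝ)}
    (hy : IsSolutionOn V₁ V₂ Vr ε y (Icc 0 τ)) (hya : z 0 = toPhase (y 0))
    (hpos : ∀ t ∈ Ico 0 τ, 0 < (y t).1.1) (hq : (y τ).1.1 = 0) (hp : (y τ).1.2 < 0)
    (hT : (z T).p₁ = 0) : τ < T ∧ z τ = toPhase (reflectWall (y τ)) := by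
  have hτm : τ ∈ Icc 0 T := ⟨hτ.le, hτT⟩
  have hτm' : τ ∈ Icc 0 τ := ⟨hτ.le, le_rfl⟩
  have hsub : Icc 0 τ ⊆ Icc 0 T := Icc_subset_Icc_right hτT
  have hb : ∀ t ∈ Ico 0 τ, t ∉ S ∨ t = 0 := by
    intro t ht
    rcases eq_or_lt_of_le ht.1 with h | h
    · exact Or.inr h.symm
    · exact Or.inl ((hz.eqOn_of_pos hV₁ hV₂ hVr hS hS' le_rfl (ht.2.le.trans hτT)
        (hy.mono (Icc_subset_Icc_right ht.2.le)) hya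
        fun u hu => hpos u ⟨hu.1.le, hu.2.trans_lt ht.2⟩).1 t ⟨h, le_rfl⟩)
  have heq : ∀ t ∈ Ico 0 τ, z t = toPhase (y t) := fun t ht =>
    (hz.eqOn_of_pos hV₁ hV₂ hVr hS hS' le_rfl (ht.2.le.trans hτT)
      (hy.mono (Icc_subset_Icc_right ht.2.le)) hya
      fun u hu => hpos u ⟨hu.1.le, hu.2.trans_lt ht.2⟩).2 t ⟨ht.1, le_rfl⟩
  have hyc := (hy τ hτm').continuousAt
  have e1 : (z τ).q₁ = (y τ).1.1 := eq_of_eqOn_Ico (f := fun t => (z t).q₁)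
    (g := fun t => (y t).1.1) hτ ((hz.continuous_q₁ τ hτm).mono hsub)
    hyc.fst.fst.continuousWithinAt fun t ht => by simp only [heq t ht]; rfl
  have e3 : (z τ).q₂ = (y τ).2.1 := eq_of_eqOn_Ico (f := fun t => (z t).q₂)
    (g := fun t => (y t).2.1) hτ ((hz.deriv_q₂ τ hτm).continuousWithinAt.mono hsub)
    hyc.snd.fst.continuousWithinAt fun t ht => by simp only [heq t ht]; rfl
  have e4 : (z τ).p₂ = (y τ).2.2 := eq_of_eqOn_Ico (f := fun t => (z t).p₂)
    (g := fun t => (y t).2.2) hτ ((hz.deriv_p₂ τ hτm).continuousWithinAt.mono hsub)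
    hyc.snd.snd.continuousWithinAt fun t ht => by simp only [heq t ht]; rfl
  have hτS : τ ∈ S := by
    by_contra hcon
    have hpτ : (z τ).p₁ = (y τ).1.2 := by
      have := hz.eqOn_of_no_impact hV₁ hV₂ hVr hS hS' le_rfl hτT hy hya (fun t ht => by
        rcases eq_or_lt_of_le ht.2 with h | h
        · rwa [h]
        · exact (hb t ⟨ht.1.le, h⟩).resolve_right ht.1.ne') τ hτm'
      rw [this]; rfl
    rcases eq_or_lt_of_le hτT with h | h
    · rw [← h, hpτ] at hT
      linarith
    · have h1 := ((hS' τ hτm hcon).1).hasDerivAt (Icc_mem_nhds hτ h)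
      obtain ⟨t, ht, htm⟩ := ((eventually_neg_of_hasDerivAt h1 (by rw [e1, hq])
        (by rw [hpτ]; exact hp)).and (Ioo_mem_nhdsGT h)).exists
      exact absurd (hz.domain t ⟨hτ.le.trans htm.1.le, htm.2.le⟩) (not_le.2 ht)
  obtain ⟨-, hpz, hlim, -⟩ := hS τ hτS
  have hlt : τ < T := lt_of_le_of_ne hτT fun h => by rw [h] at hpz; linarith
  have e2 : -(z τ).p₁ = (y τ).1.2 := by
    have h1 : Tendsto (fun t => (y t).1.2) (𝓝[<] τ) (𝓝 (y τ).1.2) :=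
      hyc.fst.snd.tendsto.mono_left nhdsWithin_le_nhds
    refine tendsto_nhds_unique hlim (h1.congr' ?_)
    filter_upwards [Ioo_mem_nhdsLT hτ] with t ht
    rw [heq t ⟨ht.1.le, ht.2⟩]; rfl
  refine ⟨hlt, ?_⟩
  rw [← toPhase_ofPhase (z τ)]
  congr 1
  simp only [ofPhase, reflectWall, e1, e3, e4, ← e2, neg_neg]

end Impact

end ImpactSystem

namespace ImpactSystem

section Return

variable {V₁ V₂ : ℝ → ℝ} {Vr : ℝ × ℝ → ℝ} {ε : ℝ}

/-- The first return along a solution which stays in `0 < q₁`. -/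
theorem isFirstReturn_iff_of_smooth (hV₁ : ContDiff ℝ 2 V₁) (hV₂ : ContDiff ℝ 2 V₂)
    (hVr : ContDiff ℝ 2 Vr) {T : ℝ} (hT : 0 < T) {y : ℝ → (ℝ × ℝ) × (ℝ × ℝ)}
    (hy : IsSolutionOn V₁ V₂ Vr ε y (Icc 0 T)) (hpos : ∀ t ∈ Icc 0 T, 0 < (y t).1.1)
    (h0 : toPhase (y 0) ∈ section₀ V₁ Vr ε) (h1 : toPhase (y T) ∈ section₀ V₁ Vr ε)
    (hno : ∀ t ∈ Ioo 0 T, toPhase (y t) ∉ section₀ V₁ Vr ε) (x' : Phase) :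
    IsFirstReturn V₁ V₂ Vr ε (toPhase (y 0)) x' ↔ x' = toPhase (y T) := by
  constructor
  · rintro ⟨-, hx', T', hT', z, hz, hz0, rfl, hzno⟩
    obtain ⟨S, -, hS, hS'⟩ := hz.impacts
    rcases lt_trichotomy T' T with h | h | h
    · have := (hz.eqOn_of_pos hV₁ hV₂ hVr hS hS' le_rfl le_rfl
        (hy.mono (Icc_subset_Icc_right h.le)) hz0
        fun t ht => hpos t ⟨ht.1.le, ht.2.trans h.le⟩).2 T' ⟨hT'.le, le_rfl⟩
      rw [this] at hx'
      exact absurd hx' (hno T' ⟨hT', h⟩)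
    · subst h
      exact (hz.eqOn_of_pos hV₁ hV₂ hVr hS hS' le_rfl le_rfl hy hz0
        fun t ht => hpos t ⟨ht.1.le, ht.2⟩).2 T' ⟨hT'.le, le_rfl⟩
    · have := (hz.eqOn_of_pos hV₁ hV₂ hVr hS hS' le_rfl h.le hy hz0
        fun t ht => hpos t ⟨ht.1.le, ht.2⟩).2 T ⟨hT.le, le_rfl⟩
      rw [← this] at h1
      exact absurd h1 (hzno T ⟨hT, h⟩)
  · rintro rfl
    exact ⟨h0, h1, T, hT, _, hy.isImpactTrajectory fun t ht => (hpos t ht).le, rfl, rfl, hno⟩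

/-- The first return along two solutions joined by a reflection. -/
theorem isFirstReturn_iff_of_impact (hV₁ : ContDiff ℝ 2 V₁) (hV₂ : ContDiff ℝ 2 V₂)
    (hVr : ContDiff ℝ 2 Vr) {τ T : ℝ} (hτ : 0 < τ) (hT : 0 < T) {y w : ℝ → (ℝ × ℝ) × (ℝ × ℝ)}
    (hy : IsSolutionOn V₁ V₂ Vr ε y (Icc 0 τ)) (hw : IsSolutionOn V₁ V₂ Vr ε w (Icc 0 T))
    (hyq : ∀ t ∈ Ico 0 τ, 0 < (y t).1.1) (hwq : ∀ t ∈ Ioc 0 T, 0 < (w t).1.1)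
    (hyp : ∀ t ∈ Ioc 0 τ, (y t).1.2 < 0) (hwp : ∀ t ∈ Ico 0 T, 0 < (w t).1.2)
    (hq : (y τ).1.1 = 0) (hw0 : w 0 = reflectWall (y τ))
    (h0 : toPhase (y 0) ∈ section₀ V₁ Vr ε) (h1 : toPhase (w T) ∈ section₀ V₁ Vr ε) (x' : Phase) :
    IsFirstReturn V₁ V₂ Vr ε (toPhase (y 0)) x' ↔ x' = toPhase (w T) := by
  have hpτ := hyp τ ⟨hτ, le_rfl⟩
  have hny : ∀ t ∈ Ioc 0 τ, toPhase (y t) ∉ section₀ V₁ Vr ε := fun t ht h =>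
    (hyp t ht).ne h.1
  have hnw : ∀ t ∈ Ico 0 T, toPhase (w t) ∉ section₀ V₁ Vr ε := fun t ht h =>
    (hwp t ht).ne' h.1
  constructor
  · rintro ⟨-, hx', T', hT', z, hz, hz0, rfl, hzno⟩
    obtain ⟨S, -, hS, hS'⟩ := hz.impacts
    rcases lt_or_ge T' τ with h | h
    · have := (hz.eqOn_of_pos hV₁ hV₂ hVr hS hS' le_rfl le_rfl
        (hy.mono (Icc_subset_Icc_right h.le)) hz0
        fun t ht => hyq t ⟨ht.1.le, ht.2.trans_lt h⟩).2 T' ⟨hT'.le, le_rfl⟩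
      rw [this] at hx'
      exact absurd hx' (hny T' ⟨hT', h.le⟩)
    obtain ⟨hlt, hzτ⟩ := hz.reflect_of_hit hV₁ hV₂ hVr hS hS' hτ h hy hz0 hyq hq hpτ hx'.1
    have hws : IsSolutionOn V₁ V₂ Vr ε (fun t => w (t - τ)) (Icc τ (τ + T)) := fun t ht =>
      (hw (t - τ) ⟨by linarith [ht.1], by linarith [ht.2]⟩).comp_sub_const t τ
    have hzτ' : z τ = toPhase (w (τ - τ)) := by rw [sub_self, hw0, hzτ]
    have hwpos : ∀ t ∈ Ioc τ (τ + T), 0 < (w (t - τ)).1.1 := fun t ht =>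
      hwq _ ⟨by linarith [ht.1], by linarith [ht.2]⟩
    rcases lt_trichotomy T' (τ + T) with h2 | h2 | h2
    · have := (hz.eqOn_of_pos hV₁ hV₂ hVr hS hS' hτ.le le_rfl
        (hws.mono (Icc_subset_Icc_right h2.le)) hzτ'
        fun t ht => hwpos t ⟨ht.1, ht.2.trans h2.le⟩).2 T' ⟨h, le_rfl⟩
      rw [this] at hx'
      exact absurd hx' (hnw _ ⟨by linarith, by linarith⟩)
    · have := (hz.eqOn_of_pos hV₁ hV₂ hVr hS hS' hτ.le h2.ge hws hzτ' hwpos).2 (τ + T)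
        ⟨by linarith, le_rfl⟩
      rw [h2, this, add_sub_cancel_left]
    · have := (hz.eqOn_of_pos hV₁ hV₂ hVr hS hS' hτ.le h2.le hws hzτ' hwpos).2 (τ + T)
        ⟨by linarith, le_rfl⟩
      rw [add_sub_cancel_left] at this
      rw [← this] at h1
      exact absurd h1 (hzno _ ⟨by linarith, h2⟩)
  · rintro rfl
    have hglue := isImpactTrajectory_glue hτ hT.le hy hw (fun t ht => by
        rcases eq_or_lt_of_le ht.2 with h | h
        · rw [h, hq]
        · exact (hyq t ⟨ht.1, h⟩).le) (fun t ht => by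
        rcases eq_or_lt_of_le ht.1 with h | h
        · rw [← h, hw0, reflectWall, hq]
        · exact (hwq t ⟨h, ht.2⟩).le) hq hpτ hw0
    refine ⟨h0, h1, τ + T, by linarith, _, hglue, ?_, ?_, fun t ht => ?_⟩
    · simp [hτ]
    · simp [hT.le.not_gt]
    · split_ifs with h
      · exact hny t ⟨ht.1, h.le⟩
      · exact hnw _ ⟨by linarith, by linarith [ht.2]⟩

end Return

end ImpactSystem

namespace ImpactSystem

open MeasureTheory

/-! ### The return map near the unperturbed one -/

section Estimate

variable {V₁ V₂ : ℝ → ℝ} {Vr : ℝ × ℝ → ℝ}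

/-- The unperturbed trajectory exists up to its return time `T₀`, and nearby perturbed trajectories
return close to it, with the first-order change of the energy of the second plane. -/
def ReturnEstimate (V₁ V₂ : ℝ → ℝ) (Vr : ℝ × ℝ → ℝ) (K ε₀ C r T₀ : ℝ) (Φ₂ : ℝ → ℝ × ℝ) : Prop :=
  ∃ z₀ : ℝ → Phase, IsImpactTrajectory V₁ V₂ Vr 0 T₀ z₀ ∧ z₀ 0 = ⟨r, 0, (Φ₂ 0).1, (Φ₂ 0).2⟩ ∧
    ∀ ε q₁, |ε| < ε₀ → |q₁ - r| ≤ K * |ε| →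
      (⟨q₁, 0, (Φ₂ 0).1, (Φ₂ 0).2⟩ : Phase) ∈ section₀ V₁ Vr ε →
      ∃ x₁, (∀ x', IsFirstReturn V₁ V₂ Vr ε ⟨q₁, 0, (Φ₂ 0).1, (Φ₂ 0).2⟩ x' ↔ x' = x₁) ∧
        |x₁.q₂ - (Φ₂ T₀).1| ≤ C * |ε| ∧
        |x₁.p₂ ^ 2 / 2 + V₂ x₁.q₂ - planeEnergy V₂ (Φ₂ 0)
          + ε * ∫ t in (0 : ℝ)..T₀, workRate Vr (ofPhase (z₀ t))| ≤ C * ε ^ 2 ∧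
        ∀ P, (∀ t, |(Φ₂ t).2| ≤ P) →
          |x₁.p₂ ^ 2 / 2 + V₂ x₁.q₂ - planeEnergy V₂ (Φ₂ 0)| ≤ C * (|ε| * P + ε ^ 2)

theorem force₁_zero (x : (ℝ × ℝ) × (ℝ × ℝ)) : force₁ V₁ Vr 0 x = deriv V₁ x.1.1 := by
  simp [force₁]

theorem IsOrbit.isMotion {V : ℝ → ℝ} {Φ : ℝ → ℝ × ℝ} (h : IsOrbit V Φ) (s : Set ℝ) :
    IsMotion s (fun t => (Φ t).1) (fun t => (Φ t).2) (fun t => deriv V (Φ t).1) :=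
  fun t _ => ⟨h.hasDerivAt_q t, h.hasDerivAt_p t⟩

theorem ComparisonBound.nearMotion_orbit {R N C ε : ℝ} (B : ComparisonBound V₁ V₂ Vr (R + 1) N C)
    {y : ℝ → (ℝ × ℝ) × (ℝ × ℝ)} {Φ₁ Φ₂ : ℝ → ℝ × ℝ}
    (hy : IsClampedSolution V₁ V₂ Vr (R + 1) ε y) (hΦ₁ : IsOrbit V₁ Φ₁) (hΦ₂ : IsOrbit V₂ Φ₂)
    (hR₁ : ∀ t, ‖Φ₁ t‖ ≤ R) (hR₂ : ∀ t, ‖Φ₂ t‖ ≤ R) {D ξ : ℝ}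
    (hD : dist (y 0) (Φ₁ 0, Φ₂ 0) + |ε| ≤ D) (hDξ : (C ^ 2 + 2 * C + 1) * D ≤ min 1 ξ) :
    (∀ t ∈ Icc 0 N, ‖y t‖ ≤ R + 1) ∧
    NearMotion N ξ (fun t => (Φ₁ t).1) (fun t => (Φ₁ t).2) (fun t => deriv V₁ (Φ₁ t).1)
      (fun t => (y t).1.1) (fun t => (y t).1.2) (fun t => force₁ V₁ Vr ε (y t)) := by
  have hC := B.nonneg
  have hz : IsClampedSolution V₁ V₂ Vr (R + 1) 0 fun t => (Φ₁ t, Φ₂ t) :=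
    hΦ₁.isClampedSolution hΦ₂ (fun t => (hR₁ t).trans (by linarith))
      (fun t => (hR₂ t).trans (by linarith))
  have hzR : ∀ t, ‖(Φ₁ t, Φ₂ t)‖ ≤ R := fun t => by
    rw [Prod.norm_def]; exact max_le (hR₁ t) (hR₂ t)
  have hd : 0 ≤ dist (y 0) (Φ₁ 0, Φ₂ 0) + |ε| := add_nonneg dist_nonneg (abs_nonneg _)
  have h1 : (C ^ 2 + 2 * C) * (dist (y 0) (Φ₁ 0, Φ₂ 0) + |ε|) ≤ min 1 ξ := by
    exact (mul_le_mul (by linarith) hD hd (by positivity)).trans hDξ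
  have h2 : C * (dist (y 0) (Φ₁ 0, Φ₂ 0) + |ε|) ≤ 1 := by
    refine le_trans ?_ (h1.trans (min_le_left _ _))
    gcongr
    nlinarith
  have hyR := B.norm_le hy hz (fun t => by simpa using hzR t) h2
  refine ⟨hyR, ?_⟩
  have := B.nearMotion hy hz hyR fun t => (hzR t).trans (by linarith)
  simp only [force₁_zero (V₁ := V₁) (Vr := Vr) (_, _)] at this
  exact this.mono le_rfl (h1.trans (min_le_right _ _))

theorem abs_integral_workRate_le {R N C T P : ℝ} (B : ComparisonBound V₁ V₂ Vr R N C)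
    (hT : T ∈ Icc 0 N) {z : ℝ → (ℝ × ℝ) × (ℝ × ℝ)} (hz : ∀ t, ‖z t‖ ≤ R)
    (hP : ∀ t, |(z t).2.2| ≤ P) : |∫ t in (0 : ℝ)..T, workRate Vr (z t)| ≤ N * C * P := by
  have hC := B.nonneg
  have hP0 : 0 ≤ P := (abs_nonneg _).trans (hP 0)
  have := intervalIntegral.norm_integral_le_of_norm_le_const (a := 0) (b := T) (C := C * P)
    (f := fun t => workRate Vr (z t)) fun t _ => (B.work_le _ (hz t)).trans (by gcongr; exact hP t)
  rw [Real.norm_eq_abs, sub_zero, abs_of_nonneg hT.1] at this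
  calc _ ≤ C * P * T := this
    _ ≤ C * P * N := by gcongr; exact hT.2
    _ = _ := by ring

theorem combine_constants_le {C₁ C₂ C₃ a P e : ℝ} (h₁ : 0 ≤ C₁) (h₂ : 0 ≤ C₂) (h₃ : 0 ≤ C₃)
    (ha : 0 ≤ a) (hP : 0 ≤ P) : C₂ * e ^ 2 + a * (C₃ * P) ≤ (C₁ + C₂ + C₃) * (a * P + e ^ 2) := by
  have : 0 ≤ C₁ * (a * P + e ^ 2) + C₂ * (a * P) + C₃ * e ^ 2 := by positivity
  linarith

/-- The time at which an orbit returns to the section. -/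
structure IsReturnTime (V : ℝ → ℝ) (Φ : ℝ → ℝ × ℝ) (T : ℝ) : Prop where
  pos : 0 < T
  momentum : (Φ T).2 = 0
  force : 0 < deriv V (Φ T).1
  no_return : ∀ t ∈ Ioo 0 T, (Φ t).2 ≠ 0 ∨ deriv V (Φ t).1 < 0

theorem dist_initial_le {q r : ℝ} {x : ℝ × ℝ} {Φ₁ : ℝ → ℝ × ℝ} (h : Φ₁ 0 = (r, 0)) :
    dist (((q, 0), x) : (ℝ × ℝ) × (ℝ × ℝ)) (Φ₁ 0, x) = |q - r| := by
  rw [h, Prod.dist_eq, Prod.dist_eq]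
  simp [Real.dist_eq]

theorem exists_return_estimate_smooth (hV₁ : ContDiff ℝ 2 V₁) (hV₂ : ContDiff ℝ 2 V₂)
    (hVr : ContDiff ℝ 2 Vr) {Φ : ℝ → ℝ × ℝ} (hΦ : IsOrbit V₁ Φ) {R τ r K : ℝ} (hK : 0 ≤ K)
    (hR : ∀ t, ‖Φ t‖ ≤ R) (hΦ0 : Φ 0 = (r, 0)) (hr : 0 < deriv V₁ r) (hτ : IsReturnTime V₁ Φ τ)
    (hq : ∀ t, 0 < (Φ t).1) :
    ∃ ξ > 0, ∃ ε₀ > 0, ∃ C, ∀ Φ₁ Φ₂ r₁ T₀, IsOrbit V₁ Φ₁ → IsOrbit V₂ Φ₂ → (∀ t, ‖Φ₁ t‖ ≤ R) →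
      (∀ t, ‖Φ₂ t‖ ≤ R) → Φ₁ 0 = (r₁, 0) → |r₁ - r| ≤ ξ → IsReturnTime V₁ Φ₁ T₀ →
      ReturnEstimate V₁ V₂ Vr K ε₀ C r₁ T₀ Φ₂ := by
  have hR0 : 0 ≤ R := (norm_nonneg _).trans (hR 0)
  have hfc : Continuous fun t => deriv V₁ (Φ t).1 :=
    (contDiff_deriv hV₁).continuous.comp hΦ.continuous_q
  obtain ⟨s, hs, hsτ, m, hm, ξ', hξ', H⟩ := exists_stable_return (hΦ.isMotion univ) hfc hτ.pos
    (by simpa [hΦ0] using hr) hτ.momentum hτ.force hτ.no_return hq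
  have hτ0 := hτ.pos
  obtain ⟨C, B⟩ := exists_comparisonBound hV₁ hV₂ hVr (show 0 ≤ R + 1 by linarith) (τ + s)
  have hC := B.nonneg
  set A := C ^ 2 + 2 * C + 1
  have hA : 0 < A := by positivity
  set ξ := min 1 ξ' / (2 * A)
  have hξ : 0 < ξ := by positivity
  have hAξ : A * (2 * ξ) = min 1 ξ' := by simp only [ξ]; field_simp
  set L := C / m
  set C₁ := (C + C * L) * (K + 1)
  set C₂ := ((τ + s) * C ^ 2 + C * (R + 1) * L) * (K + 1)
  have hL : 0 ≤ L := by positivity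
  have hC₁ : 0 ≤ C₁ := by positivity
  have hC₂ : 0 ≤ C₂ := by positivity
  refine ⟨ξ, hξ, ξ / (K + 1), by positivity, C₁ + C₂ + (τ + s) * C, ?_⟩
  intro Φ₁ Φ₂ r₁ T₀ hΦ₁ hΦ₂ hR₁ hR₂ hΦ₁0 hr₁ hT₀
  set z : ℝ → (ℝ × ℝ) × (ℝ × ℝ) := fun t => (Φ₁ t, Φ₂ t)
  have hzR : ∀ t, ‖z t‖ ≤ R := fun t => by
    rw [Prod.norm_def]; exact max_le (hR₁ t) (hR₂ t)
  have hzR' : ∀ t, ‖z t‖ ≤ R + 1 := fun t => (hzR t).trans (by linarith)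
  have hz : IsClampedSolution V₁ V₂ Vr (R + 1) 0 z :=
    hΦ₁.isClampedSolution hΦ₂ (fun t => (hR₁ t).trans (by linarith))
      (fun t => (hR₂ t).trans (by linarith))
  have hzs : ∀ s, IsSolutionOn V₁ V₂ Vr 0 z s := fun s => hz.isSolutionOn fun t _ => hzR' t
  -- the unperturbed return time
  have hz0 : dist (z 0) (Φ 0, Φ₂ 0) + |(0 : ℝ)| ≤ 2 * ξ := by
    have := dist_initial_le (x := Φ₂ 0) (q := r₁) hΦ0
    rw [← hΦ₁0] at this
    simp only [z, this, abs_zero]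
    linarith
  obtain ⟨-, hzn⟩ := B.nearMotion_orbit hz hΦ hΦ₂ hR hR₂ hz0 hAξ.le
  obtain ⟨hzw, T, hTw, hTp, hTno, hTq⟩ := H _ _ _ ((hzs _).isMotion) (by simp [z, hΦ₁0]) hzn
  have hT0 : 0 < T := by linarith [hTw.1]
  have hTf := hm.trans_le (hzw T (Ioo_subset_Icc_self hTw))
  simp only [force₁_zero] at hTf hTno hzw
  obtain rfl : T = T₀ := by
    rcases lt_trichotomy T T₀ with h | h | h
    · rcases hT₀.no_return T ⟨hT0, h⟩ with h1 | h1
      · exact absurd hTp h1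
      · exact absurd hTf h1.le.not_gt
    · exact h
    · rcases hTno T₀ ⟨hT₀.pos, h⟩ with h1 | h1
      · exact absurd hT₀.momentum h1
      · exact absurd hT₀.force h1.le.not_gt
  have hTN : T ∈ Icc 0 (τ + s) := ⟨hT0.le, hTw.2.le⟩
  refine ⟨fun t => toPhase (z t), (hzs _).isImpactTrajectory fun t ht => (hTq t ht).le,
    by simp [toPhase, z, hΦ₁0], fun ε q₁ hε hq₁ hsec => ?_⟩
  -- the perturbed trajectory
  have hKε : (K + 1) * |ε| ≤ ξ := by
    rw [mul_comm, ← le_div_iff₀ (by positivity)]; exact hε.le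
  obtain ⟨y, hy, hy0⟩ := exists_isClampedSolution hV₁ hV₂ hVr (show 0 ≤ R + 1 by linarith) ε
    ((q₁, 0), Φ₂ 0)
  have hD : dist (y 0) (z 0) + |ε| ≤ (K + 1) * |ε| := by
    rw [hy0, dist_initial_le hΦ₁0]; linarith
  have hD' : dist (y 0) (Φ 0, Φ₂ 0) + |ε| ≤ 2 * ξ := by
    rw [hy0, dist_initial_le hΦ0]
    linarith [abs_sub_le q₁ r₁ r]
  obtain ⟨hyR, hyn⟩ := B.nearMotion_orbit hy hΦ hΦ₂ hR hR₂ hD' hAξ.le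
  have hys := hy.isSolutionOn hyR
  obtain ⟨hyw, T', hTw', hTp', hTno', hTq'⟩ := H _ _ _ hys.isMotion (by simp [hy0]) hyn
  have hT0' : 0 < T' := by linarith [hTw'.1]
  have hTN' : T' ∈ Icc 0 (τ + s) := ⟨hT0'.le, hTw'.2.le⟩
  have hsub : Icc 0 T' ⊆ Icc 0 (τ + s) := Icc_subset_Icc_right hTN'.2
  have hret := isFirstReturn_iff_of_smooth hV₁ hV₂ hVr hT0' (hys.mono hsub) hTq'
    (by rw [hy0]; exact hsec)
    (mem_section₀_toPhase.2 ⟨hTp', hm.trans_le (hyw T' (Ioo_subset_Icc_self hTw'))⟩)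
    fun t ht hts => by
      obtain ⟨h1, h2⟩ := mem_section₀_toPhase.1 hts
      rcases hTno' t ht with h3 | h3
      · exact h3 h1
      · exact h3.not_gt h2
  have hTT : |T' - T| ≤ L * (dist (y 0) (z 0) + |ε|) := by
    have h1 := mul_abs_sub_le_of_hasDerivAt (u := fun t => -(z t).1.2)
      (u' := fun t => deriv V₁ (z t).1.1)
      (fun t _ => by simpa using (hΦ₁.hasDerivAt_p t).fun_neg) hzw (Ioo_subset_Icc_self hTw')
      (Ioo_subset_Icc_self hTw)
    have h2 := (abs_fst_snd_sub_le _ _).trans (B.dist_le ε y z hy hz T' hTN')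
    simp only [hTp, neg_zero, sub_zero, abs_neg] at h1
    rw [hTp', zero_sub, abs_neg] at h2
    rw [show L * (dist (y 0) (z 0) + |ε|) = C * (dist (y 0) (z 0) + |ε|) / m by
      simp only [L]; ring, le_div_iff₀ hm, mul_comm]
    exact h1.trans h2
  obtain ⟨e1, e2⟩ := B.work_segment hV₂ hVr hy hz hyR hzR' hTN' hTT
  have e2' : |planeEnergy V₂ (y T').2 - planeEnergy V₂ (y 0).2
      + ε * ∫ t in (0 : ℝ)..T, workRate Vr (z t)| ≤ C₂ * ε ^ 2 := by
    refine e2.trans ?_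
    rw [← sq_abs ε]
    calc _ ≤ ((τ + s) * C ^ 2 + C * (R + 1) * L) * (|ε| * ((K + 1) * |ε|)) := by gcongr
      _ = _ := by simp only [C₂]; ring
  rw [hy0] at hret e2'
  refine ⟨toPhase (y T'), hret, ?_, ?_, fun P hP => ?_⟩
  · refine (abs_snd_fst_sub_le (y T') (z T)).trans (e1.trans ?_)
    calc (C + C * L) * (dist (y 0) (z 0) + |ε|) ≤ (C + C * L) * ((K + 1) * |ε|) := by gcongr
      _ = C₁ * |ε| := by simp only [C₁]; ring
      _ ≤ _ := by gcongr; nlinarith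
  · refine e2'.trans ?_
    gcongr
    nlinarith
  · have h3 := abs_integral_workRate_le B hTN hzR' hP
    have hP0 : 0 ≤ P := (abs_nonneg _).trans (hP 0)
    have h7 : |ε * ∫ t in (0 : ℝ)..T, workRate Vr (z t)| ≤ |ε| * ((τ + s) * C * P) := by
      rw [abs_mul]; gcongr
    obtain ⟨h8, h8'⟩ := abs_le.1 e2'
    obtain ⟨h9, h9'⟩ := abs_le.1 h7
    have h10 : |planeEnergy V₂ (y T').2 - planeEnergy V₂ (Φ₂ 0)|
        ≤ C₂ * ε ^ 2 + |ε| * ((τ + s) * C * P) := abs_le.2 ⟨by linarith, by linarith⟩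
    exact h10.trans (combine_constants_le hC₁ hC₂ (mul_nonneg (by linarith) hC) (abs_nonneg ε) hP0)

end Estimate

end ImpactSystem

namespace ImpactSystem

open MeasureTheory

section Estimate

variable {V₁ V₂ : ℝ → ℝ} {Vr : ℝ × ℝ → ℝ}

/-- The time at which an orbit hits the wall `q = 0`, with negative momentum since the start. -/
structure IsHitTime (Φ : ℝ → ℝ × ℝ) (τ : ℝ) : Prop where
  pos : 0 < τ
  wall : (Φ τ).1 = 0
  neg : ∀ t ∈ Ioc 0 τ, (Φ t).2 < 0

theorem IsHitTime.pos_of_lt {V : ℝ → ℝ} {Φ : ℝ → ℝ × ℝ} {τ : ℝ} (h : IsHitTime Φ τ)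
    (hΦ : IsOrbit V Φ) : ∀ t ∈ Ico 0 τ, 0 < (Φ t).1 := by
  intro t ht
  have := strictMonoOn_of_hasDerivAt_pos (u := fun t => -(Φ t).1) (u' := fun t => -(Φ t).2)
    (a := t) (b := τ) (fun x _ => (hΦ.hasDerivAt_q x).fun_neg)
    (fun x hx => neg_pos.2 (h.neg x ⟨ht.1.trans_lt hx.1, hx.2.le⟩))
    (left_mem_Icc.2 ht.2.le) (right_mem_Icc.2 ht.2.le) ht.2
  simp only [h.wall] at this
  linarith

theorem dist_reflectWall (x x' : (ℝ × ℝ) × (ℝ × ℝ)) :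
    dist (reflectWall x) (reflectWall x') = dist x x' := by
  simp [reflectWall, Prod.dist_eq, dist_neg_neg]

theorem workRate_reflectWall (x : (ℝ × ℝ) × (ℝ × ℝ)) :
    workRate Vr (reflectWall x) = workRate Vr x := rfl

set_option maxHeartbeats 800000 in
theorem exists_return_estimate_impact (hV₁ : ContDiff ℝ 2 V₁) (hV₂ : ContDiff ℝ 2 V₂)
    (hVr : ContDiff ℝ 2 Vr) {Φ : ℝ → ℝ × ℝ} (hΦ : IsOrbit V₁ Φ) {R τ r K : ℝ} (hK : 0 ≤ K)
    (hR : ∀ t, ‖Φ t‖ ≤ R) (hΦ0 : Φ 0 = (r, 0)) (hr : 0 < deriv V₁ r) (hτ : IsHitTime Φ τ) :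
    ∃ ξ > 0, ∃ ε₀ > 0, ∃ C, ∀ Φ₁ Φ₂ r₁ τ₁, IsOrbit V₁ Φ₁ → IsOrbit V₂ Φ₂ → (∀ t, ‖Φ₁ t‖ ≤ R) →
      (∀ t, ‖Φ₂ t‖ ≤ R) → Φ₁ 0 = (r₁, 0) → |r₁ - r| ≤ ξ → IsHitTime Φ₁ τ₁ →
      ReturnEstimate V₁ V₂ Vr K ε₀ C r₁ (τ₁ + τ₁) Φ₂ := by
  have hR0 : 0 ≤ R := (norm_nonneg _).trans (hR 0)
  have hVc := (contDiff_deriv hV₁).continuous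
  have hτ0 := hτ.pos
  -- the reversed reference orbit
  set Ψ : ℝ → ℝ × ℝ := fun t => ((Φ (τ - t)).1, -(Φ (τ - t)).2)
  have hΨ : IsOrbit V₁ Ψ := hΦ.reverse τ
  have hΨR : ∀ t, ‖Ψ t‖ ≤ R := fun t => by
    have := hR (τ - t)
    simpa only [Ψ, Prod.norm_def, norm_neg] using this
  obtain ⟨s, hs, hsτ, m, hm, ξ', hξ', H⟩ := exists_stable_hit (hΦ.isMotion univ)
    (hVc.comp hΦ.continuous_q) hτ0 (by simpa [hΦ0] using hr) hτ.neg hτ.wall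
  obtain ⟨s', hs', hsτ', m', hm', ξ'', hξ'', H'⟩ := exists_stable_turn (hΨ.isMotion univ)
    (hVc.comp hΨ.continuous_q) hτ0 (fun t ht => by
      simpa [Ψ] using hτ.neg (τ - t) ⟨by linarith [ht.2], by linarith [ht.1]⟩)
    (by simp [Ψ, hΦ0]) (by simpa [Ψ, hΦ0] using hr)
  obtain ⟨N, hN, hN'⟩ : ∃ N, τ + s ≤ N ∧ τ + s' ≤ N := ⟨_, le_max_left _ _, le_max_right _ _⟩
  obtain ⟨C, B⟩ := exists_comparisonBound hV₁ hV₂ hVr (show 0 ≤ R + 1 by linarith) N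
  have hC := B.nonneg
  obtain ⟨A, hAdef⟩ : ∃ x, x = C ^ 2 + 2 * C + 1 := ⟨_, rfl⟩
  have hA : 0 < A := by rw [hAdef]; positivity
  obtain ⟨L, hLdef⟩ : ∃ x, x = C / m := ⟨_, rfl⟩
  obtain ⟨L', hLdef'⟩ : ∃ x, x = C / m' := ⟨_, rfl⟩
  have hL : 0 ≤ L := by rw [hLdef]; positivity
  have hL' : 0 ≤ L' := by rw [hLdef']; positivity
  obtain ⟨G, hGdef⟩ : ∃ x, x = C + C * L := ⟨_, rfl⟩
  have hG : 0 ≤ G := by rw [hGdef]; positivity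
  obtain ⟨ξ, hξdef⟩ : ∃ x, x = min 1 (min ξ' ξ'') / (A * (2 * G + 2)) := ⟨_, rfl⟩
  have hξ : 0 < ξ := by rw [hξdef]; positivity
  have hAξ : A * ((2 * G + 2) * ξ) = min 1 (min ξ' ξ'') := by rw [hξdef]; field_simp
  have hAξ' : A * ((2 * G + 2) * ξ) ≤ min 1 ξ' := by
    rw [hAξ]; exact min_le_min le_rfl (min_le_left _ _)
  have hAξ'' : A * ((2 * G + 2) * ξ) ≤ min 1 ξ'' := by
    rw [hAξ]; exact min_le_min le_rfl (min_le_right _ _)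
  rw [hAdef] at hAξ' hAξ''
  have hGξ : 0 ≤ G * ξ := by positivity
  obtain ⟨K', hKdef'⟩ : ∃ x, x = G * (K + 1) + 1 := ⟨_, rfl⟩
  have hK' : 0 ≤ K' := by rw [hKdef']; positivity
  obtain ⟨C₁, hC₁def⟩ : ∃ x, x = (C + C * L') * K' := ⟨_, rfl⟩
  obtain ⟨C₂, hC₂def⟩ : ∃ x, x = (N * C ^ 2 + C * (R + 1) * L) * (K + 1)
    + (N * C ^ 2 + C * (R + 1) * L') * K' := ⟨_, rfl⟩
  have hN0 : 0 ≤ N := by linarith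
  have hC₁ : 0 ≤ C₁ := by rw [hC₁def]; positivity
  have hC₂ : 0 ≤ C₂ := by rw [hC₂def]; positivity
  refine ⟨ξ, hξ, ξ / (K + 1), by positivity, C₁ + C₂ + 2 * (N * C), ?_⟩
  intro Φ₁ Φ₂ r₁ τ₁ hΦ₁ hΦ₂ hR₁ hR₂ hΦ₁0 hr₁ hτ₁
  set z : ℝ → (ℝ × ℝ) × (ℝ × ℝ) := fun t => (Φ₁ t, Φ₂ t)
  have hzR' : ∀ t, ‖z t‖ ≤ R + 1 := fun t => by
    rw [Prod.norm_def]; exact max_le ((hR₁ t).trans (by linarith)) ((hR₂ t).trans (by linarith))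
  have hz : IsClampedSolution V₁ V₂ Vr (R + 1) 0 z :=
    hΦ₁.isClampedSolution hΦ₂ (fun t => (hR₁ t).trans (by linarith))
      (fun t => (hR₂ t).trans (by linarith))
  have hzs : ∀ s, IsSolutionOn V₁ V₂ Vr 0 z s := fun s => hz.isSolutionOn fun t _ => hzR' t
  have hτ₁0 := hτ₁.pos
  -- the unperturbed hitting time
  have hdz : dist (z 0) (Φ 0, Φ₂ 0) + |(0 : ℝ)| ≤ ξ := by
    have := dist_initial_le (x := Φ₂ 0) (q := r₁) hΦ0
    rw [← hΦ₁0] at this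
    simp only [z, this, abs_zero, add_zero]
    exact hr₁
  obtain ⟨-, hzn⟩ := B.nearMotion_orbit hz hΦ hΦ₂ hR hR₂ (hdz.trans (by linarith : ξ ≤ _)) hAξ'
  obtain ⟨hzw, τ', hτw, hτq, hτpos, hτneg⟩ := H _ _ _ ((hzs _).isMotion) (by simp [z, hΦ₁0])
    (hzn.mono hN le_rfl)
  obtain rfl : τ' = τ₁ := by
    rcases lt_trichotomy τ' τ₁ with h | h | h
    · exact absurd hτq (hτ₁.pos_of_lt hΦ₁ τ' ⟨by linarith [hτw.1], h⟩).ne'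
    · exact h
    · exact absurd hτ₁.wall (hτpos τ₁ ⟨hτ₁0.le, h⟩).ne'
  -- the unperturbed second segment
  set w : ℝ → (ℝ × ℝ) × (ℝ × ℝ) := fun t =>
    (((Φ₁ (τ' - t)).1, -(Φ₁ (τ' - t)).2), Φ₂ (τ' + t))
  have hwR₁ : ∀ t, ‖((Φ₁ (τ' - t)).1, -(Φ₁ (τ' - t)).2)‖ ≤ R := fun t => by
    have := hR₁ (τ' - t)
    simpa only [Prod.norm_def, norm_neg] using this
  have hw : IsClampedSolution V₁ V₂ Vr (R + 1) 0 w :=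
    (hΦ₁.reverse τ').isClampedSolution (hΦ₂.comp_add τ')
      (fun t => (hwR₁ t).trans (by linarith)) (fun t => (hR₂ _).trans (by linarith))
  have hwR' : ∀ t, ‖w t‖ ≤ R + 1 := fun t => by
    rw [Prod.norm_def]; exact max_le ((hwR₁ t).trans (by linarith)) ((hR₂ _).trans (by linarith))
  have hws : ∀ s, IsSolutionOn V₁ V₂ Vr 0 w s := fun s => hw.isSolutionOn fun t _ => hwR' t
  have hw0 : w 0 = reflectWall (z τ') := by simp [w, reflectWall, z]
  -- comparison of the reflected points with those of the reference orbit
  have hzref : IsClampedSolution V₁ V₂ Vr (R + 1) 0 fun t => (Φ t, Φ₂ t) :=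
    hΦ.isClampedSolution hΦ₂ (fun t => (hR t).trans (by linarith))
      (fun t => (hR₂ t).trans (by linarith))
  have hτN : τ' ∈ Icc 0 N := ⟨hτ₁0.le, hτw.2.le.trans hN⟩
  have htime : ∀ {ε : ℝ} {y : ℝ → (ℝ × ℝ) × (ℝ × ℝ)} {T : ℝ},
      IsClampedSolution V₁ V₂ Vr (R + 1) ε y → T ∈ Ioo (τ - s) (τ + s) → (y T).1.1 = 0 →
      |T - τ'| ≤ L * (dist (y 0) (z 0) + |ε|) := by
    intro ε y T hy hT hyT
    have h1 := mul_abs_sub_le_of_hasDerivAt (u := fun t => -(z t).1.1)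
      (u' := fun t => -(z t).1.2)
      (fun t _ => (hΦ₁.hasDerivAt_q t).fun_neg) (fun t ht => by linarith [hzw t ht] : ∀ t ∈
        Icc (τ - s) (τ + s), m ≤ -(z t).1.2) (Ioo_subset_Icc_self hT) (Ioo_subset_Icc_self hτw)
    have h2 := (abs_fst_fst_sub_le _ _).trans (B.dist_le ε y z hy hz T
      ⟨by linarith [hT.1], hT.2.le.trans hN⟩)
    simp only [hτq, neg_zero, sub_zero, abs_neg] at h1
    rw [hyT, zero_sub, abs_neg] at h2
    rw [hLdef, div_mul_eq_mul_div, le_div_iff₀ hm, mul_comm]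
    exact h1.trans h2
  have hdref : dist (z τ') (Φ τ, Φ₂ τ) ≤ G * ξ := by
    have h1 := htime hzref ⟨by linarith, by linarith⟩ hτ.wall
    have h2 := (B.work_segment hV₂ hVr hzref hz (fun t _ => by
      rw [Prod.norm_def]; exact max_le ((hR t).trans (by linarith)) ((hR₂ t).trans (by linarith)))
      hzR' ⟨hτ0.le, by linarith⟩ h1).1
    rw [dist_comm (Φ 0, Φ₂ 0), ← hGdef] at h2
    rw [dist_comm]
    exact h2.trans (by gcongr)
  have hΨ0 : (Ψ 0, Φ₂ (τ + 0)) = reflectWall (Φ τ, Φ₂ τ) := by simp [Ψ, reflectWall]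
  have hdw : dist (w 0) (Ψ 0, Φ₂ (τ + 0)) ≤ G * ξ := by
    rw [hw0, hΨ0, dist_reflectWall]; exact hdref
  obtain ⟨-, hwn⟩ := B.nearMotion_orbit (D := (2 * G + 2) * ξ) hw hΨ (hΦ₂.comp_add τ) hΨR
    (fun t => hR₂ _) (by rw [abs_zero]; linarith) hAξ''
  obtain ⟨hww, T, hTw, hTp, hTpos⟩ := H' _ _ _ ((hws _).isMotion) (hwn.mono hN' le_rfl)
  simp only [force₁_zero] at hww
  have hwT : (w τ').1.2 = 0 := by simp [w, hΦ₁0]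
  have hTτ : T = τ' := by
    rcases lt_trichotomy T τ' with h | h | h
    · have : (w T).1.2 ≠ 0 := by
        have := hτ₁.neg (τ' - T) ⟨by linarith, by linarith [hTw.1]⟩
        simp only [w, ne_eq, neg_eq_zero]
        exact this.ne
      exact absurd hTp this
    · exact h
    · exact absurd hwT (hTpos τ' ⟨hτ₁0.le, h⟩).ne'
  rw [hTτ] at hTw
  have hwpos : ∀ t ∈ Icc 0 τ', 0 ≤ (w t).1.1 := fun t ht => by
    rcases eq_or_lt_of_le ht.1 with h | h
    · simp only [w, ← h, sub_zero]; exact hτ₁.wall.ge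
    · exact (hτ₁.pos_of_lt hΦ₁ (τ' - t) ⟨by linarith [ht.2], by linarith⟩).le
  have hzpos : ∀ t ∈ Icc 0 τ', 0 ≤ (z t).1.1 := fun t ht => by
    rcases eq_or_lt_of_le ht.2 with h | h
    · rw [h]; exact hτ₁.wall.ge
    · exact (hτ₁.pos_of_lt hΦ₁ t ⟨ht.1, h⟩).le
  set z₀ : ℝ → (ℝ × ℝ) × (ℝ × ℝ) := fun t => if t < τ' then z t else w (t - τ')
  have hz₀int : ∫ t in (0 : ℝ)..(τ' + τ'), workRate Vr (z₀ t)
      = (∫ t in (0 : ℝ)..τ', workRate Vr (z t)) + ∫ t in (0 : ℝ)..τ', workRate Vr (w t) := by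
    have hgc := (contDiff_workRate hVr).continuous
    have hzc : Continuous fun t => workRate Vr (z t) :=
      hgc.comp (continuous_iff_continuousAt.2 fun t => (hz t).continuousAt)
    have hwc : Continuous fun t => workRate Vr (w t) :=
      hgc.comp (continuous_iff_continuousAt.2 fun t => (hw t).continuousAt)
    have i1 : EqOn (fun t => workRate Vr (z t)) (fun t => workRate Vr (z₀ t)) (uIcc 0 τ') := by
      intro t ht
      rw [uIcc_of_le hτ₁0.le] at ht
      rcases eq_or_lt_of_le ht.2 with h | h
      · simp only [z₀, h, lt_irrefl, if_false, sub_self, hw0, workRate_reflectWall]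
      · simp only [z₀, h, if_true]
    have i2 : EqOn (fun t => workRate Vr (w (t - τ'))) (fun t => workRate Vr (z₀ t))
        (uIcc τ' (τ' + τ')) := by
      intro t ht
      rw [uIcc_of_le (by linarith)] at ht
      simp only [z₀, not_lt.2 ht.1, if_false]
    have hwc' : Continuous fun t => workRate Vr (w (t - τ')) :=
      hwc.comp (continuous_id.sub continuous_const)
    rw [← intervalIntegral.integral_add_adjacent_intervals (b := τ')
      ((hzc.intervalIntegrable _ _).congr fun t ht => i1 (uIoc_subset_uIcc ht))
      ((hwc'.intervalIntegrable _ _).congr fun t ht => i2 (uIoc_subset_uIcc ht)),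
      ← intervalIntegral.integral_congr i1, ← intervalIntegral.integral_congr i2,
      intervalIntegral.integral_comp_sub_right (fun t => workRate Vr (w t))]
    simp
  refine ⟨fun t => toPhase (z₀ t), isImpactTrajectory_glue hτ₁0 hτ₁0.le (hzs _) (hws _) hzpos hwpos
    hτ₁.wall (hτ₁.neg τ' ⟨hτ₁0, le_rfl⟩) hw0, by simp [toPhase, z₀, z, hΦ₁0, hτ₁0],
    fun ε q₁ hε hq₁ hsec => ?_⟩
  -- the perturbed trajectory up to the wall
  have hKε : (K + 1) * |ε| ≤ ξ := by
    rw [mul_comm, ← le_div_iff₀ (by positivity)]; exact hε.le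
  obtain ⟨y, hy, hy0⟩ := exists_isClampedSolution hV₁ hV₂ hVr (show 0 ≤ R + 1 by linarith) ε
    ((q₁, 0), Φ₂ 0)
  have hD : dist (y 0) (z 0) + |ε| ≤ (K + 1) * |ε| := by
    rw [hy0, dist_initial_le hΦ₁0]; linarith
  have hD' : dist (y 0) (Φ 0, Φ₂ 0) + |ε| ≤ 2 * ξ := by
    rw [hy0, dist_initial_le hΦ0]
    linarith [abs_sub_le q₁ r₁ r]
  obtain ⟨hyR, hyn⟩ := B.nearMotion_orbit hy hΦ hΦ₂ hR hR₂
    (hD'.trans (by linarith : 2 * ξ ≤ (2 * G + 2) * ξ)) hAξ'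
  have hys := hy.isSolutionOn hyR
  obtain ⟨-, σ, hσw, hσq, hσpos, hσneg⟩ := H _ _ _
    ((hys.mono (Icc_subset_Icc_right hN)).isMotion) (by simp [hy0]) (hyn.mono hN le_rfl)
  have hσN : σ ∈ Icc 0 N := ⟨by linarith [hσw.1], hσw.2.le.trans hN⟩
  obtain ⟨e1, e2⟩ := B.work_segment hV₂ hVr hy hz hyR hzR' hσN (htime hy hσw hσq)
  rw [← hGdef] at e1
  -- the perturbed trajectory after the reflection
  obtain ⟨x, hx, hx0⟩ := exists_isClampedSolution hV₁ hV₂ hVr (show 0 ≤ R + 1 by linarith) ε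
    (reflectWall (y σ))
  have hE : dist (x 0) (w 0) + |ε| ≤ K' * |ε| := by
    rw [hx0, hw0, dist_reflectWall, hKdef', add_mul, one_mul, mul_assoc]
    gcongr
    exact e1.trans (by gcongr)
  have hE' : dist (x 0) (Ψ 0, Φ₂ (τ + 0)) + |ε| ≤ (2 * G + 2) * ξ := by
    have h1 := dist_triangle (x 0) (w 0) (Ψ 0, Φ₂ (τ + 0))
    have h2 : K' * |ε| ≤ (G + 1) * ξ := by
      have h3 : |ε| ≤ (K + 1) * |ε| := by nlinarith [mul_nonneg hK (abs_nonneg ε)]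
      calc K' * |ε| = G * ((K + 1) * |ε|) + |ε| := by rw [hKdef']; ring
        _ ≤ G * ξ + ξ := add_le_add (mul_le_mul_of_nonneg_left hKε hG) (h3.trans hKε)
        _ = _ := by ring
    linarith
  obtain ⟨hxR, hxn⟩ := B.nearMotion_orbit hx hΨ (hΦ₂.comp_add τ) hΨR (fun t => hR₂ _) hE' hAξ''
  have hxs := hx.isSolutionOn hxR
  obtain ⟨hxw, T', hTw', hTp', hTpos'⟩ := H' _ _ _
    ((hxs.mono (Icc_subset_Icc_right hN')).isMotion) (hxn.mono hN' le_rfl)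
  have hTN' : T' ∈ Icc 0 N := ⟨by linarith [hTw'.1], hTw'.2.le.trans hN'⟩
  have hT0' : 0 < T' := by linarith [hTw'.1]
  have hxpos : ∀ t ∈ Ioc 0 T', 0 < (x t).1.1 := fun t ht => by
    have h1 := strictMonoOn_of_hasDerivAt_pos (u := fun t => (x t).1.1) (u' := fun t => (x t).1.2)
      (a := 0) (b := t) (fun u hu => (hxs.isMotion u ⟨hu.1, hu.2.trans (ht.2.trans hTN'.2)⟩).1)
      (fun u hu => hTpos' u ⟨hu.1.le, hu.2.trans_le ht.2⟩) (left_mem_Icc.2 ht.1.le)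
      (right_mem_Icc.2 ht.1.le) ht.1
    simp only [hx0, reflectWall, hσq] at h1
    exact h1
  have hret := isFirstReturn_iff_of_impact hV₁ hV₂ hVr (by linarith [hσw.1]) hT0'
    (hys.mono (Icc_subset_Icc_right hσN.2)) (hxs.mono (Icc_subset_Icc_right hTN'.2)) hσpos hxpos
    hσneg hTpos' hσq hx0 (by rw [hy0]; exact hsec)
    (mem_section₀_toPhase.2 ⟨hTp', hm'.trans_le (hxw T' (Ioo_subset_Icc_self hTw'))⟩)
  have hwd : ∀ t, HasDerivAt (fun t => (w t).1.2) (-deriv V₁ (w t).1.1) t :=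
    fun t => (hΦ₁.reverse τ').hasDerivAt_p t
  have hTT : |T' - τ'| ≤ L' * (dist (x 0) (w 0) + |ε|) := by
    have h1 := mul_abs_sub_le_of_hasDerivAt (u := fun t => -(w t).1.2)
      (u' := fun t => deriv V₁ (w t).1.1)
      (fun t _ => by simpa only [neg_neg] using (hwd t).fun_neg) hww
      (Ioo_subset_Icc_self hTw') (Ioo_subset_Icc_self hTw)
    have h2 := (abs_fst_snd_sub_le _ _).trans (B.dist_le ε x w hx hw T' hTN')
    simp only [hwT, neg_zero, sub_zero, abs_neg] at h1
    rw [hTp', zero_sub, abs_neg] at h2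
    rw [hLdef', div_mul_eq_mul_div, le_div_iff₀ hm', mul_comm]
    exact h1.trans h2
  obtain ⟨f1, f2⟩ := B.work_segment hV₂ hVr hx hw hxR hwR' hTN' hTT
  have hxy : planeEnergy V₂ (x 0).2 = planeEnergy V₂ (y σ).2 := by rw [hx0]; rfl
  have g2 : |planeEnergy V₂ (x T').2 - planeEnergy V₂ (Φ₂ 0)
      + ε * ∫ t in (0 : ℝ)..(τ' + τ'), workRate Vr (z₀ t)| ≤ C₂ * ε ^ 2 := by
    have h1 : planeEnergy V₂ (x T').2 - planeEnergy V₂ (Φ₂ 0)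
        + ε * ∫ t in (0 : ℝ)..(τ' + τ'), workRate Vr (z₀ t)
        = (planeEnergy V₂ (y σ).2 - planeEnergy V₂ (y 0).2
            + ε * ∫ t in (0 : ℝ)..τ', workRate Vr (z t))
          + (planeEnergy V₂ (x T').2 - planeEnergy V₂ (x 0).2
            + ε * ∫ t in (0 : ℝ)..τ', workRate Vr (w t)) := by
      rw [hz₀int, hxy, hy0]; ring
    rw [h1]
    refine (abs_add_le _ _).trans ((add_le_add e2 f2).trans ?_)
    rw [← sq_abs ε]
    have hR1 : 0 ≤ R + 1 := by linarith
    calc _ ≤ (N * C ^ 2 + C * (R + 1) * L) * (|ε| * ((K + 1) * |ε|))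
          + (N * C ^ 2 + C * (R + 1) * L') * (|ε| * (K' * |ε|)) := by gcongr
      _ = _ := by rw [hC₂def]; ring
  rw [hy0] at hret
  have hNC : 0 ≤ 2 * (N * C) := by positivity
  refine ⟨toPhase (x T'), hret, ?_, ?_, fun P hP => ?_⟩
  · refine (abs_snd_fst_sub_le (x T') (w τ')).trans (f1.trans ?_)
    calc (C + C * L') * (dist (x 0) (w 0) + |ε|) ≤ (C + C * L') * (K' * |ε|) := by gcongr
      _ = C₁ * |ε| := by rw [hC₁def]; ring
      _ ≤ _ := by gcongr; linarith
  · refine g2.trans ?_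
    gcongr
    linarith
  · have h3 := abs_integral_workRate_le B hτN hzR' hP
    have h3' := abs_integral_workRate_le B hτN hwR' fun t => hP (τ' + t)
    have hP0 : 0 ≤ P := (abs_nonneg _).trans (hP 0)
    have h7 : |ε * ∫ t in (0 : ℝ)..(τ' + τ'), workRate Vr (z₀ t)| ≤ |ε| * (2 * (N * C) * P) := by
      rw [abs_mul, hz₀int]
      gcongr
      refine (abs_add_le _ _).trans ((add_le_add h3 h3').trans (le_of_eq ?_))
      ring
    obtain ⟨h8, h8'⟩ := abs_le.1 g2
    obtain ⟨h9, h9'⟩ := abs_le.1 h7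
    have h10 : |planeEnergy V₂ (x T').2 - planeEnergy V₂ (Φ₂ 0)|
        ≤ C₂ * ε ^ 2 + |ε| * (2 * (N * C) * P) := abs_le.2 ⟨by linarith, by linarith⟩
    exact h10.trans (combine_constants_le hC₁ hC₂ hNC (abs_nonneg ε) hP0)

end Estimate

end ImpactSystem

namespace ImpactSystem

open MeasureTheory

/-! ### Leaves near a regular leaf -/

section Leaves

variable {V : ℝ → ℝ} {h₀ l r d c : ℝ}

theorem exists_norm_lt_of_planeEnergy_le (hb : BddBelow (range V))
    (hco : Tendsto V (cocompact ℝ) atTop) (E : ℝ) :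
    ∃ R, ∀ x, planeEnergy V x ≤ E → ‖x‖ < R := by
  obtain ⟨b, hb⟩ := hb
  have hlow : ∀ x, b ≤ V x := fun x => hb (mem_range_self x)
  obtain ⟨t, ht, hts⟩ := mem_cocompact.1 (hco.eventually_gt_atTop E)
  obtain ⟨R, hR⟩ := ht.isBounded.exists_norm_le
  refine ⟨max R (2 * (E - b) + 1) + 1, fun x hx => ?_⟩
  rw [planeEnergy] at hx
  have h1 : x.1 ∈ t := by
    by_contra hcon
    have : E < V x.1 := hts hcon
    linarith [sq_nonneg x.2]
  have h2 : ‖x.2‖ ≤ 2 * (E - b) + 1 := by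
    rw [Real.norm_eq_abs]
    nlinarith [hlow x.1, sq_abs x.2, sq_nonneg (|x.2| - 1)]
  rw [Prod.norm_def]
  exact (max_le_max (hR _ h1) h2).trans_lt (lt_add_one _)

theorem IsOrbit.mem_well (hV : ContDiff ℝ 2 V) {Φ : ℝ → ℝ × ℝ} (hΦ : IsOrbit V Φ) {h : ℝ}
    (h0 : planeEnergy V (Φ 0) = h) (t : ℝ) : (Φ t).1 ∈ well V h (Φ 0).1 := by
  have hle : ∀ t, V (Φ t).1 ≤ h := fun t => by
    have h1 := hΦ.energy_eq hV t 0
    rw [h0, planeEnergy] at h1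
    linarith [sq_nonneg (Φ t).2]
  have : IsPreconnected (range fun t => (Φ t).1) := isPreconnected_range hΦ.continuous_q
  exact this.subset_connectedComponentIn (mem_range_self 0) (by rintro _ ⟨t, rfl⟩; exact hle t)
    (mem_range_self t)

theorem leftEnd_eq {h a : ℝ} (hw : well V h a = Icc l r) (hlr : l ≤ r) : leftEnd V h a = l := by
  rw [leftEnd, hw, csInf_Icc hlr]

theorem rightEnd_eq {h a : ℝ} (hw : well V h a = Icc l r) (hlr : l ≤ r) : rightEnd V h a = r := by
  rw [rightEnd, hw, csSup_Icc hlr]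

/-- The leaves near a regular leaf. -/
theorem RegularWindow.exists_leaf (W : RegularWindow V h₀ l r d c) (hV : ContDiff ℝ 2 V)
    {h a : ℝ} (hh : |h - h₀| < c) (ha : a ∈ Icc (l - d) (r + d)) (hVa : V a ≤ h) :
    ∃ l' r', l' ∈ Ioo (l - d) (l + d) ∧ r' ∈ Ioo (r - d) (r + d) ∧ well V h a = Icc l' r' ∧
      V l' = h ∧ V r' = h ∧ l' < r' ∧ (∀ x ∈ Ioo l' r', V x < h) ∧ deriv V l' < 0 ∧
      0 < deriv V r' ∧ IntegrableOn (fun x => 1 / mom V h x) (Ioo l' r') := by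
  obtain ⟨l', r', hl', hr', hVl, hVr, hiff, hin⟩ := W.turning hV hh
  have hs := W.sep
  have hd := W.d_pos
  have hh' := abs_lt.1 hh
  have hlr : l' < r' := by linarith [hl'.2, hr'.1]
  have hset : Icc (l - d) (r + d) ∩ {x | V x ≤ h} = Icc l' r' := by
    ext x
    constructor
    · rintro ⟨h1, h2⟩
      exact (hiff x h1).1 h2
    · intro hx
      have hx' : x ∈ Icc (l - d) (r + d) := ⟨hl'.1.le.trans hx.1, hx.2.trans hr'.2.le⟩
      exact ⟨hx', (hiff x hx').2 hx⟩
  obtain ⟨C, hE⟩ := W.hasActionExpansion hV (sub_one_lt (h₀ - c))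
  have hint := hE.integrable h ⟨by linarith, by linarith⟩
  rw [intervalIntegrable_iff_integrableOn_Ioo_of_le (by linarith)] at hint
  refine ⟨l', r', hl', hr', ?_, hVl, hVr, hlr, hin, W.neg l' (Ioo_subset_Icc_self hl'),
    W.pos r' (Ioo_subset_Icc_self hr'), hint.mono_set (Ioo_subset_Ioo hl'.1.le hr'.2.le)⟩
  rw [well_of_window (by linarith [W.outL]) (by linarith [W.outR])
    (by rw [hset]; exact isPreconnected_Icc) ha hVa, hset]

theorem isReturnTime_of_half_period {Φ : ℝ → ℝ × ℝ} {l r t₁ : ℝ}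
    (h0 : Φ 0 = (r, 0)) (ht₁ : 0 < t₁)
    (hneg : ∀ t ∈ Ioo 0 t₁, (Φ t).2 < 0) (hl : Φ t₁ = (l, 0))
    (hsymm : ∀ t, Φ (2 * t₁ - t) = ((Φ t).1, -(Φ t).2)) (hdl : deriv V l < 0)
    (hdr : 0 < deriv V r) : IsReturnTime V Φ (2 * t₁) := by
  have h2 := hsymm 0
  rw [sub_zero, h0] at h2
  refine ⟨by linarith, by simp [h2], by simpa [h2] using hdr, fun t ht => ?_⟩
  rcases lt_trichotomy t t₁ with h | h | h
  · exact Or.inl (hneg t ⟨ht.1, h⟩).ne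
  · rw [h, hl]; exact Or.inr hdl
  · have h3 := hsymm (2 * t₁ - t)
    rw [sub_sub_cancel] at h3
    have h4 := hneg (2 * t₁ - t) ⟨by linarith [ht.2], by linarith⟩
    rw [h3]
    exact Or.inl (neg_ne_zero.2 h4.ne)

theorem exists_isHitTime_of_half_period {Φ : ℝ → ℝ × ℝ} (hΦ : IsOrbit V Φ) {l r t₁ : ℝ}
    (h0 : Φ 0 = (r, 0)) (ht₁ : 0 < t₁) (hneg : ∀ t ∈ Ioo 0 t₁, (Φ t).2 < 0)
    (hl : Φ t₁ = (l, 0)) (hl0 : l < 0) (hr0 : 0 < r) : ∃ τ, τ < t₁ ∧ IsHitTime Φ τ := by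
  obtain ⟨τ, hτ, hτ0⟩ := intermediate_value_Ioo' ht₁.le hΦ.continuous_q.continuousOn
    (show (0 : ℝ) ∈ Ioo (Φ t₁).1 (Φ 0).1 by rw [h0, hl]; exact ⟨hl0, hr0⟩)
  exact ⟨τ, hτ.2, hτ.1, hτ0, fun t ht => hneg t ⟨ht.1, ht.2.trans_lt hτ.2⟩⟩

theorem period_eq_of_well {h a l r : ℝ} (hw : well V h a = Icc l r) :
    period V h a = 2 * ∫ x in Ioo l r, 1 / mom V h x := by
  rw [period, hw, integral_Icc_eq_integral_Ioo]
  rfl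

theorem impactPeriod_eq_of_pos {h a l r : ℝ} (hw : well V h a = Icc l r) (hlr : l ≤ r)
    (hl : 0 ≤ l) : impactPeriod V h a = 2 * ∫ x in Ioo l r, 1 / mom V h x := by
  rw [impactPeriod, travelTime, leftEnd_eq hw hlr, if_neg hl.not_gt, sub_zero,
    period_eq_of_well hw]

theorem impactPeriod_eq_of_neg {h a l r : ℝ} (hw : well V h a = Icc l r) (hl : l < 0)
    (hr : 0 < r) (hint : IntegrableOn (fun x => 1 / mom V h x) (Ioo l r)) :
    impactPeriod V h a = 2 * ∫ x in Ioo 0 r, 1 / mom V h x := by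
  have hlr := hl.trans hr
  have hi : IntervalIntegrable (fun x => 1 / mom V h x) volume l r := by
    rwa [intervalIntegrable_iff_integrableOn_Ioo_of_le hlr.le]
  have h1 : IntervalIntegrable (fun x => 1 / mom V h x) volume l 0 := hi.mono_set (by
    rw [uIcc_of_le hl.le, uIcc_of_le hlr.le]; exact Icc_subset_Icc_right hr.le)
  have h2 : IntervalIntegrable (fun x => 1 / mom V h x) volume 0 r := hi.mono_set (by
    rw [uIcc_of_le hr.le, uIcc_of_le hlr.le]; exact Icc_subset_Icc_left hl.le)
  have h3 := intervalIntegral.integral_add_adjacent_intervals h1 h2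
  have h4 : travelTime V h a = 2 * ∫ x in l..0, 1 / mom V h x := by
    rw [travelTime, leftEnd_eq hw hlr.le, if_pos hl]; rfl
  rw [impactPeriod, h4, period_eq_of_well hw, ← integral_Ioc_eq_integral_Ioo,
    ← integral_Ioc_eq_integral_Ioo, ← intervalIntegral.integral_of_le hlr.le,
    ← intervalIntegral.integral_of_le hr.le, ← h3]
  ring

end Leaves

/-- The return estimate for all leaves near a regular leaf which reaches into `0 < q₁` and is not
tangent to the wall. -/
theorem exists_return_estimate {V₁ V₂ : ℝ → ℝ} {Vr : ℝ × ℝ → ℝ} (hV₁ : ContDiff ℝ 2 V₁)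
    (hV₂ : ContDiff ℝ 2 V₂) (hVr : ContDiff ℝ 2 Vr) {h₀ l r R K d₁ : ℝ} (hK : 0 ≤ K)
    (hl : V₁ l = h₀) (hr : V₁ r = h₀) (hlr : l < r) (hin : ∀ x ∈ Ioo l r, V₁ x < h₀)
    (hdl : deriv V₁ l < 0) (hdr : 0 < deriv V₁ r) (hl0 : l ≠ 0) (hr0 : 0 < r)
    (hR : ∀ x, planeEnergy V₁ x ≤ h₀ + 1 → ‖x‖ < R) (hd₁ : 0 < d₁) :
    ∃ d > 0, d ≤ d₁ ∧ ∃ c > 0, ∃ ε₀ > 0, ∃ C, ∀ h a, |h - h₀| < c → a ∈ Icc (l - d) (r + d) →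
      V₁ a ≤ h → |rightEnd V₁ h a - r| ≤ d ∧ V₁ (rightEnd V₁ h a) = h ∧
      ∀ Φ₂, IsOrbit V₂ Φ₂ → (∀ t, ‖Φ₂ t‖ ≤ R) →
        ReturnEstimate V₁ V₂ Vr K ε₀ C (rightEnd V₁ h a) (impactPeriod V₁ h a) Φ₂ := by
  obtain ⟨d₀, hd₀, hW⟩ := exists_regularWindow hV₁ hlr hl hr hdl hdr hin
  have horb : ∀ h x, h < h₀ + 1 → V₁ x = h →
      ∃ Φ, IsOrbit V₁ Φ ∧ Φ 0 = (x, 0) ∧ ∀ t, ‖Φ t‖ ≤ R := by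
    intro h x hh hx
    have hx0 : planeEnergy V₁ (x, 0) = h := by simp [planeEnergy, hx]
    obtain ⟨Φ, hΦ, hΦ0⟩ := exists_orbit hV₁ (x := (x, 0)) (R := R) fun y hy =>
      hR y (by rw [hy, hx0]; linarith)
    refine ⟨Φ, hΦ, hΦ0, fun t => (hR _ ?_).le⟩
    rw [hΦ.energy_eq hV₁ t 0, hΦ0, hx0]; exact hh.le
  obtain ⟨Φ, hΦ, hΦ0, hΦR⟩ := horb h₀ r (by linarith) hr
  obtain ⟨c₀, W₀⟩ := hW d₀ hd₀ le_rfl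
  have hint₀ : IntegrableOn (fun x => 1 / mom V₁ h₀ x) (Ioo l r) := by
    obtain ⟨C, hE⟩ := W₀.hasActionExpansion hV₁ (sub_one_lt (h₀ - c₀))
    have hc₀ := W₀.c_pos
    have hint := hE.integrable h₀ ⟨by linarith, by linarith⟩
    rw [intervalIntegrable_iff_integrableOn_Ioo_of_le (by linarith)] at hint
    exact hint.mono_set (Ioo_subset_Ioo (by linarith) (by linarith))
  obtain ⟨t₀, ht₀, hneg, hΦl, hsymm⟩ := hΦ.exists_half_period hV₁ hΦ0 hr hl hlr hin hdr hint₀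
  rcases lt_or_gt_of_ne hl0 with hlneg | hlpos
  · obtain ⟨τ, -, hτ⟩ := exists_isHitTime_of_half_period hΦ hΦ0 ht₀ hneg hΦl hlneg hr0
    obtain ⟨ξ, hξ, ε₀, hε₀, C, hest⟩ := exists_return_estimate_impact hV₁ hV₂ hVr hΦ hK hΦR hΦ0
      hdr hτ
    set d := min (min d₀ d₁) (min ξ (min (-l / 2) (r / 2)))
    have hd : 0 < d := lt_min (lt_min hd₀ hd₁) (lt_min hξ (lt_min (by linarith) (by linarith)))
    have i1 : d ≤ d₀ := (min_le_left _ _).trans (min_le_left _ _)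
    have i2 : d ≤ d₁ := (min_le_left _ _).trans (min_le_right _ _)
    have i3 : d ≤ ξ := (min_le_right _ _).trans (min_le_left _ _)
    have i4 : d ≤ -l / 2 := (min_le_right _ _).trans ((min_le_right _ _).trans (min_le_left _ _))
    have i5 : d ≤ r / 2 := (min_le_right _ _).trans ((min_le_right _ _).trans (min_le_right _ _))
    obtain ⟨c, W⟩ := hW d hd i1
    refine ⟨d, hd, i2, min c 1, lt_min W.c_pos one_pos, ε₀, hε₀, C, fun h a hh ha hVa => ?_⟩
    obtain ⟨l', r', hl', hr', hw, hVl, hVr', hlr', hin', hdl', hdr', hint⟩ :=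
      W.exists_leaf hV₁ (hh.trans_le (min_le_left _ _)) ha hVa
    have hh1 := (abs_lt.1 (hh.trans_le (min_le_right _ _))).2
    have hrr : |r' - r| ≤ d := abs_le.2 ⟨by linarith [hr'.1], by linarith [hr'.2]⟩
    rw [rightEnd_eq hw hlr'.le]
    refine ⟨hrr, hVr', fun Φ₂ hΦ₂ hR₂ => ?_⟩
    obtain ⟨Φ₁, hΦ₁, hΦ₁0, hΦ₁R⟩ := horb h r' (by linarith) hVr'
    obtain ⟨t₁, ht₁, hneg₁, hΦ₁l, -⟩ := hΦ₁.exists_half_period hV₁ hΦ₁0 hVr' hVl hlr' hin' hdr'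
      hint
    have hl'0 : l' < 0 := by linarith [hl'.2]
    have hr'0 : 0 < r' := by linarith [hr'.1]
    obtain ⟨τ₁, hτ₁t, hτ₁⟩ := exists_isHitTime_of_half_period hΦ₁ hΦ₁0 ht₁ hneg₁ hΦ₁l hl'0 hr'0
    have htime := (hΦ₁.time_eq_integral hV₁ hΦ₁0 hVr' hVl hlr' hτ₁.pos
      fun t ht => hτ₁.neg t (Ioo_subset_Ioc_self ht)).2
    rw [hτ₁.wall] at htime
    rw [impactPeriod_eq_of_neg hw hl'0 hr'0 hint, htime, two_mul]
    exact hest Φ₁ Φ₂ r' τ₁ hΦ₁ hΦ₂ hΦ₁R hR₂ hΦ₁0 (hrr.trans i3) hτ₁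
  · have hτ := isReturnTime_of_half_period hΦ0 ht₀ hneg hΦl hsymm hdl hdr
    have hq : ∀ t, 0 < (Φ t).1 := by
      intro t
      obtain ⟨l', r', hl', hr', hw, hVl, hVr', hlr'', hin', -⟩ := W₀.exists_leaf hV₁ (h := h₀)
        (a := r) (by simpa using W₀.c_pos) ⟨by linarith, by linarith⟩ hr.le
      have hl'' : l' = l := by
        rcases lt_trichotomy l' l with h | h | h
        · have := hin' l ⟨h, by linarith [hr'.1, W₀.sep]⟩
          linarith
        · exact h
        · have := hin l' ⟨h, by linarith [hl'.2, W₀.sep]⟩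
          linarith
      have := hΦ.mem_well hV₁ (h := h₀) (by simp [hΦ0, planeEnergy, hr]) t
      rw [hΦ0, hw, hl''] at this
      exact hlpos.trans_le this.1
    obtain ⟨ξ, hξ, ε₀, hε₀, C, hest⟩ := exists_return_estimate_smooth hV₁ hV₂ hVr hΦ hK hΦR hΦ0
      hdr hτ hq
    set d := min (min d₀ d₁) (min ξ (l / 2))
    have hd : 0 < d := lt_min (lt_min hd₀ hd₁) (lt_min hξ (by linarith))
    have i1 : d ≤ d₀ := (min_le_left _ _).trans (min_le_left _ _)
    have i2 : d ≤ d₁ := (min_le_left _ _).trans (min_le_right _ _)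
    have i3 : d ≤ ξ := (min_le_right _ _).trans (min_le_left _ _)
    have i4 : d ≤ l / 2 := (min_le_right _ _).trans (min_le_right _ _)
    obtain ⟨c, W⟩ := hW d hd i1
    refine ⟨d, hd, i2, min c 1, lt_min W.c_pos one_pos, ε₀, hε₀, C, fun h a hh ha hVa => ?_⟩
    obtain ⟨l', r', hl', hr', hw, hVl, hVr', hlr', hin', hdl', hdr', hint⟩ :=
      W.exists_leaf hV₁ (hh.trans_le (min_le_left _ _)) ha hVa
    have hh1 := (abs_lt.1 (hh.trans_le (min_le_right _ _))).2
    have hrr : |r' - r| ≤ d := abs_le.2 ⟨by linarith [hr'.1], by linarith [hr'.2]⟩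
    rw [rightEnd_eq hw hlr'.le]
    refine ⟨hrr, hVr', fun Φ₂ hΦ₂ hR₂ => ?_⟩
    obtain ⟨Φ₁, hΦ₁, hΦ₁0, hΦ₁R⟩ := horb h r' (by linarith) hVr'
    obtain ⟨t₁, ht₁, hneg₁, hΦ₁l, hsymm₁⟩ := hΦ₁.exists_half_period hV₁ hΦ₁0 hVr' hVl hlr' hin'
      hdr' hint
    have htime := (hΦ₁.time_eq_integral hV₁ hΦ₁0 hVr' hVl hlr' ht₁ hneg₁).2
    rw [hΦ₁l] at htime
    rw [impactPeriod_eq_of_pos hw hlr'.le (by linarith [hl'.1]), htime]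
    exact hest Φ₁ Φ₂ r' (2 * t₁) hΦ₁ hΦ₂ hΦ₁R hR₂ hΦ₁0 (hrr.trans i3)
      (isReturnTime_of_half_period hΦ₁0 ht₁ hneg₁ hΦ₁l hsymm₁ hdl' hdr')

end ImpactSystem

namespace ImpactSystem

open Metric NNReal MeasureTheory

/-- The point of the section on the perturbed energy level. -/
theorem exists_section_point {V₁ : ℝ → ℝ} {Vr : ℝ × ℝ → ℝ} (hV₁ : ContDiff ℝ 2 V₁)
    (hVr : ContDiff ℝ 2 Vr) {r₀ : ℝ} (hr₀ : 0 < deriv V₁ r₀) (R : ℝ) :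
    ∃ d > 0, ∃ ε₀ > 0, ∃ K ≥ 0, ∀ r q₂ ε, |r - r₀| ≤ d → |q₂| ≤ R → |ε| < ε₀ →
      ∃ q₁, |q₁ - r| ≤ K * |ε| ∧ V₁ q₁ + ε * Vr (q₁, q₂) = V₁ r ∧
        0 < deriv V₁ q₁ + ε * partial₁ Vr q₁ q₂ ∧
        ∀ y, |y - r| < d → V₁ y + ε * Vr (y, q₂) = V₁ r → y = q₁ := by
  obtain ⟨d₁, hd₁, hpos⟩ := exists_pos_nhds_Icc (contDiff_deriv hV₁).continuous hr₀
  obtain ⟨b, hb, hbV⟩ := (isCompact_Icc (a := r₀ - d₁) (b := r₀ + d₁)).exists_forall_le'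
    (contDiff_deriv hV₁).continuous.continuousOn hpos
  set R' := max (|r₀| + d₁) R
  obtain ⟨M, hM⟩ := exists_bound_closedBall (contDiff_partial₁ hVr).continuous R'
  obtain ⟨M', hM'⟩ := exists_bound_closedBall hVr.continuous R'
  have hM0 : (0 : ℝ) ≤ M := M.2
  have hM0' : (0 : ℝ) ≤ M' := M'.2
  have hbox : ∀ x ∈ Icc (r₀ - d₁) (r₀ + d₁), ∀ q₂, |q₂| ≤ R → (x, q₂) ∈ closedBall (0 : ℝ × ℝ) R' := by
    intro x hx q₂ hq₂
    rw [mem_closedBall_zero_iff, Prod.norm_def]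
    refine max_le ?_ (hq₂.trans (le_max_right _ _))
    refine le_trans ?_ (le_max_left _ _)
    rw [Real.norm_eq_abs, abs_le]
    constructor <;> linarith [hx.1, hx.2, neg_abs_le r₀, le_abs_self r₀]
  set K := 2 * M' / b
  have hK : 0 ≤ K := by positivity
  refine ⟨d₁ / 2, by positivity, min (b / (2 * (M + 1))) (d₁ / (2 * (K + 1))), by positivity, K, hK,
    fun r q₂ ε hr hq₂ hε => ?_⟩
  have hε1 : |ε| * M ≤ b / 2 := by
    have h1 := hε.le.trans (min_le_left _ _)
    rw [le_div_iff₀ (by positivity)] at h1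
    nlinarith [abs_nonneg ε]
  have hε2 : K * |ε| ≤ d₁ / 2 := by
    have h1 := hε.le.trans (min_le_right _ _)
    rw [le_div_iff₀ (by positivity)] at h1
    nlinarith [abs_nonneg ε]
  have hr' := abs_le.1 hr
  have hd : ∀ t ∈ Icc (r₀ - d₁) (r₀ + d₁), HasDerivAt (fun y => V₁ y + ε * Vr (y, q₂))
      (deriv V₁ t + ε * partial₁ Vr t q₂) t := by
    intro t _
    have h1 : DifferentiableAt ℝ (fun x => Vr (x, q₂)) t :=
      (hVr.differentiable (by norm_num)).differentiableAt.comp t (f := fun x : ℝ => (x, q₂))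
        (by fun_prop)
    exact (hasDerivAt_potential hV₁ t).add (h1.hasDerivAt.const_mul ε)
  have hlow : ∀ t ∈ Icc (r₀ - d₁) (r₀ + d₁), b / 2 ≤ deriv V₁ t + ε * partial₁ Vr t q₂ := by
    intro t ht
    have h1 := hM _ (hbox t ht q₂ hq₂)
    have h2 : |ε * partial₁ Vr t q₂| ≤ b / 2 := by
      rw [abs_mul]
      exact (mul_le_mul_of_nonneg_left h1 (abs_nonneg ε)).trans hε1
    linarith [(abs_le.1 h2).1, hbV t ht]
  have hmono := strictMonoOn_of_hasDerivAt_pos hd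
    fun t ht => lt_of_lt_of_le (by linarith) (hlow t (Ioo_subset_Icc_self ht))
  have hcont : ContinuousOn (fun y => V₁ y + ε * Vr (y, q₂)) (Icc (r₀ - d₁) (r₀ + d₁)) :=
    fun t ht => (hd t ht).continuousAt.continuousWithinAt
  have hrm : r ∈ Icc (r₀ - d₁) (r₀ + d₁) := ⟨by linarith, by linarith⟩
  have hVr0 : |ε * Vr (r, q₂)| ≤ |ε| * M' := by
    rw [abs_mul]
    exact mul_le_mul_of_nonneg_left (hM' _ (hbox r hrm q₂ hq₂)) (abs_nonneg ε)
  have hKb : b / 2 * (K * |ε|) = |ε| * M' := by simp only [K]; field_simp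
  have hKε : 0 ≤ K * |ε| := by positivity
  have hm1 : r - K * |ε| ∈ Icc (r₀ - d₁) (r₀ + d₁) := ⟨by linarith, by linarith⟩
  have hm2 : r + K * |ε| ∈ Icc (r₀ - d₁) (r₀ + d₁) := ⟨by linarith, by linarith⟩
  have h1 := (convex_Icc (r₀ - d₁) (r₀ + d₁)).mul_sub_le_image_sub_of_le_deriv hcont
    (fun t ht => (hd t (interior_subset ht)).differentiableAt.differentiableWithinAt)
    (C := b / 2) (fun t ht => by
      rw [(hd t (interior_subset ht)).deriv]; exact hlow t (interior_subset ht))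
  have hlo := h1 _ hm1 _ hrm (by linarith)
  have hhi := h1 _ hrm _ hm2 (by linarith)
  rw [sub_sub_cancel, hKb] at hlo
  rw [add_sub_cancel_left, hKb] at hhi
  obtain ⟨a1, a2⟩ := abs_le.1 hVr0
  obtain ⟨q₁, hq₁, hq₁r⟩ := intermediate_value_Icc (by linarith : r - K * |ε| ≤ r + K * |ε|)
    (hcont.mono (Icc_subset_Icc hm1.1 hm2.2)) (show V₁ r ∈ Icc _ _ from
      ⟨by linarith, by linarith⟩)
  have hq₁m : q₁ ∈ Icc (r₀ - d₁) (r₀ + d₁) := ⟨hm1.1.trans hq₁.1, hq₁.2.trans hm2.2⟩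
  refine ⟨q₁, abs_le.2 ⟨by linarith [hq₁.1], by linarith [hq₁.2]⟩, hq₁r,
    lt_of_lt_of_le (by linarith) (hlow q₁ hq₁m), fun y hy hyr => ?_⟩
  obtain ⟨b1, b2⟩ := abs_lt.1 hy
  exact hmono.injOn ⟨by linarith, by linarith⟩ hq₁m (hyr.trans hq₁r.symm)

theorem isMinLevel_of_mem_regularEnergies {r : ℕ} {V W : ℝ → ℝ} (hV : IsS3BPotential r V)
    {δ H h : ℝ} (hδ : 0 < δ) (hh : h ∈ regularEnergies V W δ H) : IsMinLevel V h := by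
  intro x hx hd
  rcases lt_or_gt_of_ne (hV.nondegenerate x hd) with h1 | h1
  · have := hh.2.1 x ⟨hd, h1⟩
    rw [hx, sub_self, abs_zero] at this
    linarith
  · exact h1

theorem isMinLevel_compl_of_mem_regularEnergies {r : ℕ} {V W : ℝ → ℝ} (hW : IsS3BPotential r W)
    {δ H h : ℝ} (hδ : 0 < δ) (hh : h ∈ regularEnergies V W δ H) : IsMinLevel W (H - h) := by
  intro x hx hd
  rcases lt_or_gt_of_ne (hW.nondegenerate x hd) with h1 | h1
  · have := hh.2.2 x ⟨hd, h1⟩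
    rw [hx, sub_sub_cancel, sub_self, abs_zero] at this
    linarith
  · exact h1

theorem isClosed_regularEnergies (V W : ℝ → ℝ) (δ H : ℝ) : IsClosed (regularEnergies V W δ H) := by
  have : regularEnergies V W δ H = Icc (⨅ x, V x) (H - ⨅ x, W x) ∩
      ((⋂ s ∈ saddles V, {h | δ ≤ |h - V s|}) ∩ ⋂ s ∈ saddles W, {h | δ ≤ |h - (H - W s)|}) := by
    ext h
    simp [regularEnergies]
  rw [this]
  refine isClosed_Icc.inter (IsClosed.inter ?_ ?_) <;>
  exact isClosed_biInter fun s _ => isClosed_le continuous_const (by fun_prop)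

/-- The leaves of regular energies, given by the energy in the second plane and a point over each
of the two leaves. -/
def regularLeaves (V₁ V₂ : ℝ → ℝ) (δ H : ℝ) : Set (ℝ × ℝ × ℝ) :=
  {x | x.1 ∈ regularEnergies V₂ V₁ δ H ∧ V₂ x.2.1 ≤ x.1 ∧ V₁ x.2.2 ≤ H - x.1}

theorem isCompact_sublevel {V : ℝ → ℝ} (hV : Continuous V) (hco : Tendsto V (cocompact ℝ) atTop)
    (E : ℝ) : IsCompact {x | V x ≤ E} := by
  obtain ⟨t, ht, hts⟩ := mem_cocompact.1 (hco.eventually_gt_atTop E)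
  refine ht.of_isClosed_subset (isClosed_le hV continuous_const) fun x hx => ?_
  by_contra hcon
  have : E < V x := hts hcon
  exact absurd hx (not_le.2 this)

theorem isCompact_regularLeaves {r : ℕ} {V₁ V₂ : ℝ → ℝ} (hV₁ : IsS3BPotential r V₁)
    (hV₂ : IsS3BPotential r V₂) (δ H : ℝ) : IsCompact (regularLeaves V₁ V₂ δ H) := by
  have c₁ := hV₁.smooth.continuous
  have c₂ := hV₂.smooth.continuous
  refine ((isCompact_Icc (a := ⨅ x, V₂ x) (b := H - ⨅ x, V₁ x)).prod ((isCompact_sublevel c₂ hV₂.coercive (H - ⨅ x, V₁ x)).prod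
    (isCompact_sublevel c₁ hV₁.coercive (H - ⨅ x, V₂ x)))).of_isClosed_subset
    ?_ ?_
  · exact ((isClosed_regularEnergies V₂ V₁ δ H).preimage continuous_fst).inter
      ((isClosed_le (c₂.comp (continuous_fst.comp continuous_snd)) continuous_fst).inter
        (isClosed_le (c₁.comp (continuous_snd.comp continuous_snd))
          (continuous_const.sub continuous_fst)))
  · rintro ⟨h, a, b⟩ ⟨hh, ha, hb⟩
    have h1 := hh.1.1
    have h2 := hh.1.2
    exact ⟨hh.1, show V₂ a ≤ _ from le_trans ha h2, show V₁ b ≤ _ by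
      simp only at hb h1; linarith⟩

end ImpactSystem

namespace ImpactSystem

open MeasureTheory

section Good

variable {V₁ V₂ : ℝ → ℝ} {Vr : ℝ × ℝ → ℝ}

/-- The first-order formula for the return map on a pair of leaves, with explicit constants. -/
def IsGoodLeaf (V₁ V₂ : ℝ → ℝ) (Vr : ℝ × ℝ → ℝ) (H ε₀ η K C h₂ a₂ a₁ : ℝ) : Prop :=
  ∃ γ : ℝ → ℝ × ℝ, IsAngleChart V₂ h₂ a₂ γ ∧ ∀ θ : ℝ, ∃ z₀ : ℝ → Phase,
    IsImpactTrajectory V₁ V₂ Vr 0 (impactPeriod V₁ (H - h₂) a₁) z₀ ∧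
    z₀ 0 = ⟨rightEnd V₁ (H - h₂) a₁, 0, (γ θ).1, (γ θ).2⟩ ∧
    ∀ ε : ℝ, ε ≠ 0 → |ε| < ε₀ → ∃ q₁ : ℝ,
      |q₁ - rightEnd V₁ (H - h₂) a₁| ≤ K * |ε| ∧
      energy V₁ V₂ Vr ε ⟨q₁, 0, (γ θ).1, (γ θ).2⟩ = H ∧
      (⟨q₁, 0, (γ θ).1, (γ θ).2⟩ : Phase) ∈ section₀ V₁ Vr ε ∧
      (∀ y, |y - rightEnd V₁ (H - h₂) a₁| < η →
        energy V₁ V₂ Vr ε ⟨y, 0, (γ θ).1, (γ θ).2⟩ = H → y = q₁) ∧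
      (∃ x', IsFirstReturn V₁ V₂ Vr ε ⟨q₁, 0, (γ θ).1, (γ θ).2⟩ x') ∧
      ∀ x' f, IsFirstReturn V₁ V₂ Vr ε ⟨q₁, 0, (γ θ).1, (γ θ).2⟩ x' →
        actionAt V₂ x'.q₂ x'.p₂ = action V₂ h₂ a₂ + ε * f →
        |f - -(1 / frequency V₂ h₂ a₂ * ∫ t in (0 : ℝ)..impactPeriod V₁ (H - h₂) a₁,
          partial₂ Vr (z₀ t).q₁ (z₀ t).q₂ * (z₀ t).p₂)| ≤ C * |ε|

theorem IsGoodLeaf.mono {H ε₀ η K C ε₀' η' K' C' h₂ a₂ a₁ : ℝ}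
    (h : IsGoodLeaf V₁ V₂ Vr H ε₀ η K C h₂ a₂ a₁) (h1 : ε₀' ≤ ε₀) (h2 : η' ≤ η) (h3 : K ≤ K')
    (h4 : C ≤ C') : IsGoodLeaf V₁ V₂ Vr H ε₀' η' K' C' h₂ a₂ a₁ := by
  obtain ⟨γ, hγ, hθ⟩ := h
  refine ⟨γ, hγ, fun θ => ?_⟩
  obtain ⟨z₀, hz, hz0, hε⟩ := hθ θ
  refine ⟨z₀, hz, hz0, fun ε hne hlt => ?_⟩
  obtain ⟨q₁, e1, e2, e3, e4, e5, e6⟩ := hε ε hne (hlt.trans_le h1)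
  exact ⟨q₁, e1.trans (by gcongr), e2, e3, fun y hy => e4 y (hy.trans_le h2), e5,
    fun x' f hx hf => (e6 x' f hx hf).trans (by gcongr)⟩

theorem IsOrbit.isAngleChart {V : ℝ → ℝ} {Φ : ℝ → ℝ × ℝ} (hΦ : IsOrbit V Φ) {h a : ℝ}
    (h0 : Φ 0 = (rightEnd V h a, 0)) :
    IsAngleChart V h a fun θ => Φ (θ / frequency V h a) where
  origin := by rw [zero_div, h0]
  flow θ := by
    have h1 : HasDerivAt (fun θ : ℝ => θ / frequency V h a) (1 / frequency V h a) θ :=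
      (hasDerivAt_id θ).div_const _
    have h2 := (hΦ (θ / frequency V h a)).scomp θ h1
    convert! h2 using 1
    simp only [planeField, Prod.smul_mk, smul_eq_mul]
    congr 1 <;> ring

set_option maxHeartbeats 800000 in
theorem exists_isGoodLeaf_of_regular (hV₁ : ContDiff ℝ 2 V₁) (hV₂ : ContDiff ℝ 2 V₂)
    (hVr : ContDiff ℝ 2 Vr) (hb₁ : BddBelow (range V₁)) (hb₂ : BddBelow (range V₂))
    (hco₁ : Tendsto V₁ (cocompact ℝ) atTop) (hco₂ : Tendsto V₂ (cocompact ℝ) atTop)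
    {H h₀ a₀ A B c m C₀ l r : ℝ} (W : WellWindow V₂ h₀ a₀ A B c m C₀)
    (hl : V₁ l = H - h₀) (hr : V₁ r = H - h₀) (hlr : l < r) (hin : ∀ x ∈ Ioo l r, V₁ x < H - h₀)
    (hdl : deriv V₁ l < 0) (hdr : 0 < deriv V₁ r) (hl0 : l ≠ 0) (hr0 : 0 < r) :
    ∃ d > 0, ∃ c' > 0, ∃ ε₀ > 0, ∃ η > 0, ∃ K ≥ 0, ∃ C, ∀ h₂ a₂ a₁, |h₂ - h₀| < c' →
      a₂ ∈ Icc A B → V₂ a₂ ≤ h₂ → a₁ ∈ Icc (l - d) (r + d) → V₁ a₁ ≤ H - h₂ → IsMinLevel V₂ h₂ →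
      IsGoodLeaf V₁ V₂ Vr H ε₀ η K C h₂ a₂ a₁ := by
  obtain ⟨R₁, hR₁⟩ := exists_norm_lt_of_planeEnergy_le hb₁ hco₁ (H - h₀ + 1)
  obtain ⟨R₂, hR₂⟩ := exists_norm_lt_of_planeEnergy_le hb₂ hco₂ (h₀ + 1)
  obtain ⟨R, hR1, hR2⟩ : ∃ R, R₁ ≤ R ∧ R₂ ≤ R := ⟨_, le_max_left _ _, le_max_right _ _⟩
  have hR0 : 0 ≤ R := (norm_nonneg _).trans ((hR₁ (r, 0) (by simp [planeEnergy, hr])).le.trans hR1)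
  obtain ⟨d₁, hd₁, ε₁, hε₁, K, hK, hsec⟩ := exists_section_point hV₁ hVr hdr R
  obtain ⟨d, hd, hdd₁, c₁, hc₁, ε₂, hε₂, C₁, hret⟩ := exists_return_estimate (V₂ := V₂) hV₁ hV₂ hVr
    hK hl hr hlr hin hdl hdr hl0 hr0 (fun x hx => (hR₁ x hx).trans_le hR1) hd₁
  obtain ⟨E, hE0, hE⟩ := W.exists_abs_one_div_frequency_le hV₂.continuous
  obtain ⟨C₂, hC₂⟩ := W.action_expansion hV₂.continuous (2 * |C₁|)
  have hc := W.c_pos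
  obtain ⟨dA, hdA, hA⟩ := exists_pos_nhds_Icc (f := fun x => V₂ x - (h₀ + c / 2)) (c := A)
    (hV₂.continuous.sub continuous_const) (by linarith [W.outA])
  obtain ⟨dB, hdB, hB⟩ := exists_pos_nhds_Icc (f := fun x => V₂ x - (h₀ + c / 2)) (c := B)
    (hV₂.continuous.sub continuous_const) (by linarith [W.outB])
  have hC₁ := abs_nonneg C₁
  have hC₁' := le_abs_self C₁
  obtain ⟨ε₀, hε₀, i1, i2, i3, i4, i5, i6⟩ : ∃ ε₀ > 0, ε₀ ≤ ε₁ ∧ ε₀ ≤ ε₂ ∧ ε₀ ≤ 1 ∧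
      |C₁| * ε₀ ≤ dA ∧ |C₁| * ε₀ ≤ dB ∧ |C₁| * (R + 1) * ε₀ < c / 2 := by
    have t : ∀ᶠ ε in 𝓝[>] (0 : ℝ), 0 < ε ∧ ε ≤ ε₁ ∧ ε ≤ ε₂ ∧ ε ≤ 1 ∧
        |C₁| * ε ≤ dA ∧ |C₁| * ε ≤ dB ∧ |C₁| * (R + 1) * ε < c / 2 := by
      have key : ∀ a b : ℝ, 0 < b → ∀ᶠ ε in 𝓝[>] (0 : ℝ), a * ε < b := fun a b hb => by
        have : Tendsto (fun ε : ℝ => a * ε) (𝓝 0) (𝓝 (a * 0)) :=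
          (continuous_const.mul continuous_id).tendsto 0
        rw [mul_zero] at this
        exact (this.eventually_lt_const hb).filter_mono nhdsWithin_le_nhds
      filter_upwards [self_mem_nhdsWithin, key 1 _ hε₁, key 1 _ hε₂, key 1 1 one_pos,
        key |C₁| _ hdA, key |C₁| _ hdB, key (|C₁| * (R + 1)) _ (half_pos hc)]
        with ε h0 h1 h2 h3 h4 h5 h6
      rw [one_mul] at h1 h2 h3
      exact ⟨h0, h1.le, h2.le, h3.le, h4.le, h5.le, h6⟩
    obtain ⟨ε, hε⟩ := t.exists
    exact ⟨ε, hε⟩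
  refine ⟨d, hd, min (min c₁ (c / 2)) 1, lt_min (lt_min hc₁ (half_pos hc)) one_pos, ε₀, hε₀, d₁, hd₁,
    K, hK, C₂ + E * |C₁|, fun h₂ a₂ a₁ hh ha₂ hVa₂ ha₁ hVa₁ hmin => ?_⟩
  have hh1 : |h₂ - h₀| < c₁ := hh.trans_le ((min_le_left _ _).trans (min_le_left _ _))
  have hh2 : |h₂ - h₀| < c / 2 := hh.trans_le ((min_le_left _ _).trans (min_le_right _ _))
  have hh3 : |h₂ - h₀| < 1 := hh.trans_le (min_le_right _ _)
  have hhc : |h₂ - h₀| < c := by linarith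
  have hm := W.bottom_le ha₂ hVa₂
  -- the leaf in the second plane
  obtain ⟨l₂, r₂, har, hleaf⟩ := exists_isLeaf hV₂.continuous hco₂ hVa₂
  have hw₂ := hleaf.well_eq har
  have hVr₂ := (hleaf.dichotomy hV₂ hmin).2.1
  have hr₂ : rightEnd V₂ h₂ a₂ = r₂ := rightEnd_eq hw₂ hleaf.le
  have hx0 : planeEnergy V₂ (r₂, 0) = h₂ := by simp [planeEnergy, hVr₂]
  have hbd : ∀ x, planeEnergy V₂ x = h₂ → ‖x‖ < R := fun x hx =>
    (hR₂ x (by rw [hx]; linarith [(abs_lt.1 hh3).2])).trans_le hR2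
  obtain ⟨Φ₂, hΦ₂, hΦ₂0⟩ := exists_orbit hV₂ (x := (r₂, 0)) (R := R) fun y hy =>
    hbd y (by rw [hy, hx0])
  have hen : ∀ t, planeEnergy V₂ (Φ₂ t) = h₂ := fun t => by rw [hΦ₂.energy_eq hV₂ t 0, hΦ₂0, hx0]
  have hΦR : ∀ t, ‖Φ₂ t‖ ≤ R := fun t => (hbd _ (hen t)).le
  have hwell : ∀ t, (Φ₂ t).1 ∈ Icc A B ∩ {x | V₂ x ≤ h₂} := fun t => by
    have h1 := hΦ₂.mem_well hV₂ (hen 0) t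
    rw [hΦ₂0, hleaf.well_eq (right_mem_Icc.2 hleaf.le), ← hw₂, W.well_eq hhc ha₂ hVa₂] at h1
    exact h1
  have hP : ∀ t, |(Φ₂ t).2| ≤ √(2 * (h₂ - m)) := fun t => by
    refine Real.abs_le_sqrt ?_
    have h1 := hen t
    rw [planeEnergy] at h1
    linarith [W.bot _ (hwell t).1]
  refine ⟨_, hΦ₂.isAngleChart (by rw [hr₂, hΦ₂0]), fun θ => ?_⟩
  obtain ⟨s, hs⟩ : ∃ s, s = θ / frequency V₂ h₂ a₂ := ⟨_, rfl⟩
  simp only [← hs]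
  -- the leaf in the first plane
  obtain ⟨hrr, hVr₁, hest⟩ := hret (H - h₂) a₁ (by
    rw [sub_sub_sub_cancel_left, abs_sub_comm]; exact hh1) ha₁ hVa₁
  obtain ⟨z₀, hz₀, hz₀0, hpert⟩ := hest _ (hΦ₂.comp_add s) fun t => hΦR _
  simp only [add_zero] at hz₀0 hpert
  refine ⟨z₀, hz₀, hz₀0, fun ε hne hε => ?_⟩
  have hε' := abs_pos.2 hne
  obtain ⟨q₁, hq₁, hq₁e, hq₁f, hq₁u⟩ := hsec (rightEnd V₁ (H - h₂) a₁) (Φ₂ s).1 ε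
    (hrr.trans hdd₁) ((norm_fst_le _).trans (hΦR s)) (hε.trans_le i1)
  have henergy : ∀ y, energy V₁ V₂ Vr ε ⟨y, 0, (Φ₂ s).1, (Φ₂ s).2⟩ = H ↔
      V₁ y + ε * Vr (y, (Φ₂ s).1) = V₁ (rightEnd V₁ (H - h₂) a₁) := by
    intro y
    have h1 := hen s
    rw [planeEnergy] at h1
    simp only [energy, hVr₁]
    constructor <;> intro h2 <;> linarith
  have hq₁s : (⟨q₁, 0, (Φ₂ s).1, (Φ₂ s).2⟩ : Phase) ∈ section₀ V₁ Vr ε :=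
    ⟨rfl, neg_neg_of_pos hq₁f⟩
  obtain ⟨x₁, hx₁, e1, e2, e3⟩ := hpert ε q₁ (hε.trans_le i2) hq₁ hq₁s
  refine ⟨q₁, hq₁, (henergy q₁).2 hq₁e, hq₁s, fun y hy hye => hq₁u y hy ((henergy y).1 hye),
    ⟨x₁, (hx₁ x₁).2 rfl⟩, fun x' f hx' hf => ?_⟩
  obtain rfl := (hx₁ x').1 hx'
  rw [hen s] at e2 e3
  rw [actionAt] at hf
  obtain ⟨h', hh'⟩ : ∃ h', h' = x'.p₂ ^ 2 / 2 + V₂ x'.q₂ := ⟨_, rfl⟩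
  rw [← hh'] at e2 e3 hf
  have hε1 : |ε| < 1 := hε.trans_le i3
  have hsq : ε ^ 2 = |ε| * |ε| := by rw [← sq, sq_abs]
  -- the energy of the return point
  have e3R := e3 R fun t => (norm_snd_le _).trans (hΦR _)
  have hh'c : |h' - h₂| < c / 2 := by
    refine lt_of_le_of_lt (e3R.trans ?_) i6
    have h1 : |ε| * R + ε ^ 2 ≤ (R + 1) * ε₀ := by
      rw [hsq]
      calc _ ≤ ε₀ * R + 1 * ε₀ := add_le_add (mul_le_mul_of_nonneg_right hε.le hR0)
            (mul_le_mul hε1.le hε.le hε'.le zero_le_one)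
        _ = _ := by ring
    calc C₁ * (|ε| * R + ε ^ 2) ≤ |C₁| * (|ε| * R + ε ^ 2) := by gcongr
      _ ≤ |C₁| * ((R + 1) * ε₀) := by gcongr
      _ = _ := by ring
  have hh'c' : |h' - h₀| < c := by
    have := abs_sub_le h' h₂ h₀
    linarith
  -- the position of the return point
  have hq' : x'.q₂ ∈ Icc A B := by
    obtain ⟨⟨w1, w2⟩, w3⟩ := hwell (s + impactPeriod V₁ (H - h₂) a₁)
    have w3' : V₂ (Φ₂ (s + impactPeriod V₁ (H - h₂) a₁)).1 ≤ h₀ + c / 2 :=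
      le_trans w3 (by linarith [(abs_lt.1 hh2).2])
    have h1 : |x'.q₂ - (Φ₂ (s + impactPeriod V₁ (H - h₂) a₁)).1| ≤ |C₁| * ε₀ :=
      e1.trans (mul_le_mul hC₁' hε.le hε'.le hC₁)
    obtain ⟨h2, h3⟩ := abs_le.1 h1
    constructor
    · by_contra hcon
      have := hA (Φ₂ (s + impactPeriod V₁ (H - h₂) a₁)).1
        ⟨by linarith, by linarith [not_le.1 hcon]⟩
      linarith
    · by_contra hcon
      have := hB (Φ₂ (s + impactPeriod V₁ (H - h₂) a₁)).1
        ⟨by linarith [not_le.1 hcon], by linarith⟩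
      linarith
  have hVq' : V₂ x'.q₂ ≤ h' := by rw [hh']; linarith [sq_nonneg x'.p₂]
  have e3P := e3 _ fun t => hP _
  have hexp := hC₂ h₂ h' a₂ x'.q₂ ε hhc hh'c' ha₂ hq' hVa₂ hVq' (by
    refine e3P.trans ?_
    have h1 : √(2 * (h₂ - m)) ≤ 2 * √(h₂ - m) := by
      rw [Real.sqrt_mul (by norm_num)]
      gcongr
      rw [Real.sqrt_le_left (by norm_num)]
      norm_num
    have h2 := sq_nonneg ε
    calc C₁ * (|ε| * √(2 * (h₂ - m)) + ε ^ 2)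
        ≤ |C₁| * (|ε| * (2 * √(h₂ - m)) + 2 * ε ^ 2) := by
          gcongr
          linarith
      _ = _ := by ring)
  rw [hf, add_sub_cancel_left] at hexp
  have hEf := hE h₂ a₂ hhc ha₂ hVa₂
  obtain ⟨ω', hω'⟩ : ∃ ω', ω' = 1 / frequency V₂ h₂ a₂ := ⟨_, rfl⟩
  rw [← hω'] at hexp hEf ⊢
  change |f - -(ω' * ∫ t in (0 : ℝ)..impactPeriod V₁ (H - h₂) a₁,
    workRate Vr (ofPhase (z₀ t)))| ≤ _
  obtain ⟨I, hI⟩ : ∃ I, I = ∫ t in (0 : ℝ)..impactPeriod V₁ (H - h₂) a₁,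
    workRate Vr (ofPhase (z₀ t)) := ⟨_, rfl⟩
  rw [← hI] at e2 ⊢
  have hfin : |ε| * |f - -(ω' * I)| ≤ |ε| * ((C₂ + E * |C₁|) * |ε|) := by
    rw [← abs_mul]
    have h1 : ε * (f - -(ω' * I)) = (ε * f - (h' - h₂) * ω') + ω' * (h' - h₂ + ε * I) := by ring
    rw [h1]
    refine (abs_add_le _ _).trans ?_
    rw [abs_mul ω']
    calc _ ≤ C₂ * ε ^ 2 + E * (|C₁| * ε ^ 2) := by
          gcongr
          exact e2.trans (by gcongr)
      _ = _ := by rw [hsq]; ring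
  exact le_of_mul_le_mul_left hfin hε'

end Good

end ImpactSystem

namespace ImpactSystem

open MeasureTheory

section Compactness

variable {V₁ V₂ : ℝ → ℝ} {Vr : ℝ × ℝ → ℝ} {δ ρ κ H : ℝ} {n : ℕ}

theorem IsS3BPotential.contDiff_two {V : ℝ → ℝ} (hV : IsS3BPotential n V) (hn : 3 < n) :
    ContDiff ℝ 2 V := hV.smooth.of_le (by exact_mod_cast (by omega : 2 ≤ n + 1))

theorem WellWindow.eventually_abs_action_sub_lt {V : ℝ → ℝ} {h₀ a₀ A B c m C : ℝ}
    (W : WellWindow V h₀ a₀ A B c m C) (hV : Continuous V) (hVa₀ : V a₀ ≤ h₀) {b : ℝ}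
    (hb : 0 < b) : ∀ᶠ x : ℝ × ℝ in 𝓝 (h₀, a₀), V x.2 ≤ x.1 →
      |x.1 - h₀| < c ∧ x.2 ∈ Icc A B ∧ |action V x.1 x.2 - action V h₀ a₀| < b := by
  have h1 : Continuous fun x : ℝ × ℝ => |x.1 - h₀| := by fun_prop
  have h2 : Continuous fun x : ℝ × ℝ => 1 / Real.pi * (√(2 * |x.1 - h₀|) * (B - A)) := by fun_prop
  have e1 : ∀ᶠ x : ℝ × ℝ in 𝓝 (h₀, a₀), |x.1 - h₀| < c :=
    h1.continuousAt.eventually_lt_const (by simpa using W.c_pos)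
  have e2 : ∀ᶠ x : ℝ × ℝ in 𝓝 (h₀, a₀), 1 / Real.pi * (√(2 * |x.1 - h₀|) * (B - A)) < b :=
    h2.continuousAt.eventually_lt_const (by simpa using hb)
  have e3 : ∀ᶠ x : ℝ × ℝ in 𝓝 (h₀, a₀), x.2 ∈ Ioo A B :=
    continuous_snd.continuousAt.eventually (Ioo_mem_nhds W.mem.1 W.mem.2)
  filter_upwards [e1, e2, e3] with x h1 h2 h3 hx
  exact ⟨h1, Ioo_subset_Icc_self h3,
    (W.abs_action_sub_le hV hVa₀ h1 (Ioo_subset_Icc_self h3) hx).trans_lt h2⟩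

/-- Uniform constants in a neighbourhood of a pair of leaves. -/
theorem exists_isGoodLeaf_nhds (hn : 3 < n) (hV₁ : IsS3BPotential n V₁) (hV₂ : IsS3BPotential n V₂)
    (hVr : ContDiff ℝ 2 Vr) (hδ : 0 < δ) (hρ : 0 < ρ) (hκ : 0 < κ) {x : ℝ × ℝ × ℝ}
    (hx : x ∈ regularLeaves V₁ V₂ δ H) :
    ∃ ε₀ > 0, ∃ η > 0, ∃ K ≥ 0, ∃ C, ∀ᶠ y : ℝ × ℝ × ℝ in 𝓝 x, y ∈ regularLeaves V₁ V₂ δ H →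
      FarFromTangency V₁ V₂ ρ H y.1 y.2.1 → 0 < rightEnd V₁ (H - y.1) y.2.2 →
      κ ≤ action V₁ (H - y.1) y.2.2 → IsGoodLeaf V₁ V₂ Vr H ε₀ η K C y.1 y.2.1 y.2.2 := by
  obtain ⟨h₀, a₂, a₁⟩ := x
  obtain ⟨hh₀, hVa₂, hVa₁⟩ := hx
  simp only at hh₀ hVa₂ hVa₁
  have c₁ := hV₁.contDiff_two hn
  have c₂ := hV₂.contDiff_two hn
  have hmin₁ := isMinLevel_compl_of_mem_regularEnergies hV₁ hδ hh₀
  have hmin₂ := isMinLevel_of_mem_regularEnergies hV₂ hδ hh₀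
  obtain ⟨A, B, c, m, C₀, W⟩ := exists_wellWindow c₂ hV₂.bddBelow hV₂.coercive hmin₂ hVa₂
  have t₂ : Tendsto (fun y : ℝ × ℝ × ℝ => (y.1, y.2.1)) (𝓝 (h₀, a₂, a₁)) (𝓝 (h₀, a₂)) :=
    Continuous.tendsto (by fun_prop) (h₀, a₂, a₁)
  have t₁ : Tendsto (fun y : ℝ × ℝ × ℝ => (H - y.1, y.2.2)) (𝓝 (h₀, a₂, a₁))
      (𝓝 (H - h₀, a₁)) := Continuous.tendsto (by fun_prop) (h₀, a₂, a₁)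
  obtain ⟨l, r, ha₁, hleaf⟩ := exists_isLeaf c₁.continuous hV₁.coercive hVa₁
  obtain ⟨hl, hr, ⟨hlr, -⟩ | ⟨hlr, hdl, hdr, hin⟩⟩ := hleaf.dichotomy c₁ hmin₁
  · -- a centre in the first plane
    obtain ⟨A₁, B₁, c', m', C', W₁⟩ := exists_wellWindow c₁ hV₁.bddBelow hV₁.coercive hmin₁ hVa₁
    have hzero : action V₁ (H - h₀) a₁ = 0 := by
      rw [action, hleaf.well_eq ha₁, hlr]; simp
    refine ⟨1, one_pos, 1, one_pos, 0, le_rfl, 0, ?_⟩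
    filter_upwards [t₁.eventually (W₁.eventually_abs_action_sub_lt c₁.continuous hVa₁ hκ)]
      with y hy hyr _ _ hyκ
    have h1 := (hy hyr.2.2).2.2
    rw [hzero, sub_zero] at h1
    exact absurd ((le_abs_self _).trans_lt h1) (not_lt.2 hyκ)
  by_cases htan : V₁ 0 = H - h₀
  · -- tangency to the wall
    have hH : H - V₁ 0 = h₀ := by linarith
    refine ⟨1, one_pos, 1, one_pos, 0, le_rfl, 0, ?_⟩
    filter_upwards [t₂.eventually (W.eventually_abs_action_sub_lt c₂.continuous hVa₂ hρ)]
      with y hy hyr hyf _ _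
    obtain ⟨h1, h2, h3⟩ := hy hyr.2.1
    have h4 := hyf a₂ (by rw [hH]; exact hVa₂)
      (by rw [hH]; exact W.sameBranch hVa₂ h1 h2 hyr.2.1)
    rw [hH] at h4
    exact absurd h3 (not_lt.2 h4)
  have hl0 : l ≠ 0 := fun h => htan (by rw [← h, hl])
  have hr0 : r ≠ 0 := fun h => htan (by rw [← h, hr])
  rcases lt_or_gt_of_ne hr0 with hrneg | hrpos
  · -- the leaf is behind the wall
    obtain ⟨d₀, hd₀, hW⟩ := exists_regularWindow c₁ hlr hl hr hdl hdr hin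
    obtain ⟨c', W₁⟩ := hW (min d₀ (-r)) (lt_min hd₀ (by linarith)) (min_le_left _ _)
    have hd := W₁.d_pos
    have e1 : ∀ᶠ z : ℝ × ℝ in 𝓝 (H - h₀, a₁), |z.1 - (H - h₀)| < c' := by
      have : Continuous fun z : ℝ × ℝ => |z.1 - (H - h₀)| := by fun_prop
      exact this.continuousAt.eventually_lt_const (by simpa using W₁.c_pos)
    have e2 : ∀ᶠ z : ℝ × ℝ in 𝓝 (H - h₀, a₁), z.2 ∈ Ioo (l - min d₀ (-r)) (r + min d₀ (-r)) :=
      continuous_snd.continuousAt.eventually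
        (Ioo_mem_nhds (by linarith [ha₁.1] : l - min d₀ (-r) < a₁)
          (by linarith [ha₁.2] : a₁ < r + min d₀ (-r)))
    refine ⟨1, one_pos, 1, one_pos, 0, le_rfl, 0, ?_⟩
    filter_upwards [t₁.eventually e1, t₁.eventually e2] with y h1 h2 hyr _ hy0 _
    obtain ⟨l', r', -, hr', hw, -, -, hlr', -⟩ :=
      W₁.exists_leaf c₁ h1 (Ioo_subset_Icc_self h2) hyr.2.2
    rw [rightEnd_eq hw hlr'.le] at hy0
    have := min_le_right d₀ (-r)
    linarith [hr'.2]
  · obtain ⟨d, hd, c', hc', ε₀, hε₀, η, hη, K, hK, C, hgood⟩ := exists_isGoodLeaf_of_regular c₁ c₂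
      hVr hV₁.bddBelow hV₂.bddBelow hV₁.coercive hV₂.coercive W hl hr hlr hin hdl hdr hl0 hrpos
    have e1 : ∀ᶠ y : ℝ × ℝ × ℝ in 𝓝 (h₀, a₂, a₁), |y.1 - h₀| < c' := by
      have : Continuous fun z : ℝ × ℝ × ℝ => |z.1 - h₀| := by fun_prop
      exact this.continuousAt.eventually_lt_const (by simpa using hc')
    have e2 : ∀ᶠ z : ℝ × ℝ in 𝓝 (H - h₀, a₁), z.2 ∈ Ioo (l - d) (r + d) :=
      continuous_snd.continuousAt.eventually
        (Ioo_mem_nhds (by linarith [ha₁.1] : l - d < a₁) (by linarith [ha₁.2] : a₁ < r + d))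
    refine ⟨ε₀, hε₀, η, hη, K, hK, C, ?_⟩
    filter_upwards [e1, t₁.eventually e2,
      t₂.eventually (W.eventually_abs_action_sub_lt c₂.continuous hVa₂ one_pos)]
      with y h1 h2 h3 hyr _ _ _
    exact hgood y.1 y.2.1 y.2.2 h1 (h3 hyr.2.1).2.1 hyr.2.1 (Ioo_subset_Icc_self h2) hyr.2.2
      (isMinLevel_of_mem_regularEnergies hV₂ hδ hyr.1)

/-- Uniform constants for all pairs of regular leaves. -/
theorem exists_isGoodLeaf (hn : 3 < n) (hV₁ : IsS3BPotential n V₁) (hV₂ : IsS3BPotential n V₂)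
    (hVr : ContDiff ℝ 2 Vr) (hδ : 0 < δ) (hρ : 0 < ρ) (hκ : 0 < κ) (H : ℝ) :
    ∃ ε₀ > 0, ∃ η > 0, ∃ K ≥ 0, ∃ C, ∀ y ∈ regularLeaves V₁ V₂ δ H,
      FarFromTangency V₁ V₂ ρ H y.1 y.2.1 → 0 < rightEnd V₁ (H - y.1) y.2.2 →
      κ ≤ action V₁ (H - y.1) y.2.2 → IsGoodLeaf V₁ V₂ Vr H ε₀ η K C y.1 y.2.1 y.2.2 := by
  have key := (isCompact_regularLeaves hV₁ hV₂ δ H).induction_on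
    (p := fun s => ∃ ε₀ > 0, ∃ η > 0, ∃ K ≥ 0, ∃ C, ∀ y ∈ s, y ∈ regularLeaves V₁ V₂ δ H →
      FarFromTangency V₁ V₂ ρ H y.1 y.2.1 → 0 < rightEnd V₁ (H - y.1) y.2.2 →
      κ ≤ action V₁ (H - y.1) y.2.2 → IsGoodLeaf V₁ V₂ Vr H ε₀ η K C y.1 y.2.1 y.2.2)
    ⟨1, one_pos, 1, one_pos, 0, le_rfl, 0, fun y hy => absurd hy (notMem_empty y)⟩
    (fun s t hst ⟨ε₀, hε₀, η, hη, K, hK, C, h⟩ =>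
      ⟨ε₀, hε₀, η, hη, K, hK, C, fun y hy => h y (hst hy)⟩)
    (fun s t ⟨ε₀, hε₀, η, hη, K, hK, C, h⟩ ⟨ε₀', hε₀', η', hη', K', hK', C', h'⟩ =>
      ⟨min ε₀ ε₀', lt_min hε₀ hε₀', min η η', lt_min hη hη', max K K', le_max_of_le_left hK,
        max C C', fun y hy hyr h1 h2 h3 => hy.elim
          (fun hy => (h y hy hyr h1 h2 h3).mono (min_le_left _ _) (min_le_left _ _)
            (le_max_left _ _) (le_max_left _ _))
          (fun hy => (h' y hy hyr h1 h2 h3).mono (min_le_right _ _) (min_le_right _ _)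
            (le_max_right _ _) (le_max_right _ _))⟩)
    (fun x hx => by
      obtain ⟨ε₀, hε₀, η, hη, K, hK, C, h⟩ := exists_isGoodLeaf_nhds hn hV₁ hV₂ hVr hδ hρ hκ hx
      exact ⟨_, mem_nhdsWithin_of_mem_nhds h, ε₀, hε₀, η, hη, K, hK, C, fun y hy => hy⟩)
  obtain ⟨ε₀, hε₀, η, hη, K, hK, C, h⟩ := key
  exact ⟨ε₀, hε₀, η, hη, K, hK, C, fun y hy => h y hy hy⟩

end Compactness

end ImpactSystem

theorem mainTheorem5 (r : ℕ) (hr : 3 < r)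
    (V₁ V₂ : ℝ → ℝ) (Vr : ℝ × ℝ → ℝ)
    (hV₁ : IsS3BPotential r V₁) (hV₂ : IsS3BPotential r V₂)
    (hVr : ContDiff ℝ ((r + 1 : ℕ) : WithTop ℕ∞) Vr)
    (hwall : IsRegularWall V₁)
    (δ ρ κ : ℝ) (hδ : 0 < δ) (hρ : 0 < ρ) (hκ : 0 < κ)
    (H : ℝ) (hH : IsRegularLevel V₁ V₂ δ H) :
    ∃ ε₀ > 0, ∃ η > 0, ∃ C : ℝ,
      -- every leaf of regular energy `h₂` in the second plane, outside the tangency interval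
      ∀ h₂ ∈ regularEnergies V₂ V₁ δ H, ∀ a₂, V₂ a₂ ≤ h₂ → FarFromTangency V₁ V₂ ρ H h₂ a₂ →
      -- every leaf of the complementary energy in the first plane, reaching into the billiard
      ∀ a₁, V₁ a₁ ≤ H - h₂ → 0 < rightEnd V₁ (H - h₂) a₁ → κ ≤ action V₁ (H - h₂) a₁ →
      ∃ γ : ℝ → ℝ × ℝ, IsAngleChart V₂ h₂ a₂ γ ∧ ∀ θ : ℝ,
      -- the unperturbed impact trajectory starting on the section at action-angle `(I, θ)`
      ∃ z₀ : ℝ → Phase,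
        IsImpactTrajectory V₁ V₂ Vr 0 (impactPeriod V₁ (H - h₂) a₁) z₀ ∧
        z₀ 0 = ⟨rightEnd V₁ (H - h₂) a₁, 0, (γ θ).1, (γ θ).2⟩ ∧
        ∀ ε : ℝ, ε ≠ 0 → |ε| < ε₀ →
          -- the point of the section with coordinates `(I, θ)` on the perturbed level `H`
          ∃ q₁ : ℝ,
            (∀ y : ℝ, (|y - rightEnd V₁ (H - h₂) a₁| < η ∧
                energy V₁ V₂ Vr ε ⟨y, 0, (γ θ).1, (γ θ).2⟩ = H ∧
                (⟨y, 0, (γ θ).1, (γ θ).2⟩ : Phase) ∈ section₀ V₁ Vr ε) ↔ y = q₁) ∧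
            -- the return map is defined there
            (∃ x', IsFirstReturn V₁ V₂ Vr ε ⟨q₁, 0, (γ θ).1, (γ θ).2⟩ x') ∧
            -- the change `I' = I + ε f` of the action
            ∀ x' f, IsFirstReturn V₁ V₂ Vr ε ⟨q₁, 0, (γ θ).1, (γ θ).2⟩ x' →
              actionAt V₂ x'.q₂ x'.p₂ = action V₂ h₂ a₂ + ε * f →
              |f - -(1 / frequency V₂ h₂ a₂ *
                ∫ t in (0 : ℝ)..impactPeriod V₁ (H - h₂) a₁,
                  partial₂ Vr (z₀ t).q₁ (z₀ t).q₂ * (z₀ t).p₂)| ≤ C * |ε| := by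
  obtain ⟨ε₀, hε₀, η, hη, K, hK, C, hgood⟩ := exists_isGoodLeaf (Vr := Vr) hr hV₁ hV₂
    (hVr.of_le (by exact_mod_cast (by omega : 2 ≤ r + 1))) hδ hρ hκ H
  refine ⟨min ε₀ (η / (K + 1)), lt_min hε₀ (by positivity), η, hη, C,
    fun h₂ hh₂ a₂ ha₂ hfar a₁ ha₁ hpos hact => ?_⟩
  obtain ⟨γ, hγ, hθ⟩ := hgood (h₂, a₂, a₁) ⟨hh₂, ha₂, ha₁⟩ hfar hpos hact
  refine ⟨γ, hγ, fun θ => ?_⟩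
  obtain ⟨z₀, hz₀, hz₀0, hε⟩ := hθ θ
  refine ⟨z₀, hz₀, hz₀0, fun ε hne hlt => ?_⟩
  obtain ⟨q₁, e1, e2, e3, e4, e5, e6⟩ := hε ε hne (hlt.trans_le (min_le_left _ _))
  have hK' : K * |ε| < η := by
    have h1 := hlt.trans_le (min_le_right _ _)
    rw [lt_div_iff₀ (by positivity)] at h1
    linarith [abs_nonneg ε]
  refine ⟨q₁, fun y => ⟨fun hy => e4 y hy.1 hy.2.1, ?_⟩, e5, e6⟩
  rintro rfl
  exact ⟨e1.trans_lt hK', e2, e3⟩
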